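/- **Model.** Consider $n$ asynchronous processes $p_0,\dots,p_{n-1}$ that may crash and that communicate through shared objects. A shared object is given by its prefix-closed set of finite histories, which are sequences of invocations by processes, responses to processes, and internal steps of the implementation of the object; in each of them, each process has at most one pending operation at a time. In a randomized algorithm, each step of a process invokes an operation on a shared object, receives the response to its pending operation, makes a local random choice with a discrete distribution, or returns an output. All random choices are independent. A *strong adversary* is a scheduler that sees the whole past (including local states, histories of the objects with their internal steps, and outcomes of past random choices) and decides what happens next, including the responses and internal steps of objects, within their sets of histories. A process is *correct* in a run if it takes infinitely many steps (internal steps of objects are not counted). An algorithm *terminates with probability 1 against a strong adversary* if, for every legal input and every strong adversary, with probability 1 every correct process returns. A *task* $T$ specifies the legal input vectors and, for each of them, the allowed (possibly partial) output vectors; an algorithm *solves* $T$ if, in every run on a legal input, the outputs returned so far always form an allowed vector. **Registers.** A linearization of a register history $H$ is a sequential history that contains all completed operations of $H$ and possibly some pending ones (with responses added), that preserves the order of any two operations of which the first responds before the second is invoked, and in which each read returns the value of the last preceding write, or the initial value of the register if there is none. A register with set of histories $\mathcal H$ is *linearizable* if there is a function $f$ mapping each $H\in\mathcal H$ to a linearization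 of $H$. It is *write strongly-linearizable* if $f$ can be chosen such that, in addition, whenever $G,H\in\mathcal H$ and $G$ is a prefix of $H$, the sequence of write operations in $f(G)$ is a prefix of the sequence of write operations in $f(H)$. It is *only linearizable* if it is linearizable and nothing beyond linearizability restricts it: every well-formed sequence of invocations and responses all of whose prefixes have a linearization is one of its histories. **Corollary.** Let $n\ge 3$, and let $\mathcal A$ be any randomized algorithm that solves a task $T$ for $n$ processes and terminates with probability 1 against a strong adversary. There is a randomized algorithm $\mathcal A'$ for $n$ processes such that: 1. $\mathcal A'$ uses a set $\mathcal R$ of three shared multi-writer multi-reader registers (with value sets and initial values fixed by $\mathcal A'$) in addition to the base objects of $\mathcal A$, and $\mathcal A'$ solves $T$ whenever the registers in $\mathcal R$ are linearizable. 2. If the registers in $\mathcal R$ are only linearizable, then a strong adversary can prevent the termination of $\mathcal A'$: for every legal input there is a strong adversary against which, with probability 1, all processes take infinitely many steps and none of them ever returns. 3. If the registers in $\mathcal R$ are write strongly-linearizable, then $\mathcal A'$ terminates with probability 1 against a strong adversary. -/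

import Mathlib

/-! Asynchronous shared-memory systems with `n` processes, register linearizability,
randomized algorithms and strong adversaries. -/

/-- An event in a history of a shared object: the invocation of an operation by a process, the
response to the pending operation of a process, or an internal step of the implementation of the
object (such as an access to a lower-level object or the delivery of a message). -/
inductive Event (n : ℕ) (Op Res Intl : Type) where
  | inv (p : Fin n) (op : Op)
  | res (p : Fin n) (r : Res)
  | tau (e : Intl)

namespace Event

variable {n : ℕ} {Op Res Intl : Type}

/-- Whether process `p` has a pending operation at the end of the history. -/
def pendingAfter (p : Fin n) (H : List (Event n Op Res Intl)) : Bool :=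
  H.foldl (fun b e => match e with
    | inv q _ => if q = p then true else b
    | res q _ => if q = p then false else b
    | tau _ => b) false

/-- Well-formed histories: each process invokes an operation only when it has none pending, and
receives a response only when it has one pending. -/
def WellFormed (H : List (Event n Op Res Intl)) : Prop :=
  ∀ L e, L ++ [e] <+: H → match e with
    | inv p _ => pendingAfter p L = false
    | res p _ => pendingAfter p L = true
    | tau _ => True

/-- The operation of `H` invoked at position `i` has its response `r` at position `j`. (An operation
of a history is identified by the position of its invocation.) -/
def RespondsAt (H : List (Event n Op Res Intl)) (i j : ℕ) (r : Res) : Prop :=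
  ∃ p op, i < j ∧ H[i]? = some (inv p op) ∧ H[j]? = some (res p r) ∧
    ∀ k r', i < k → k < j → H[k]? ≠ some (res p r')

/-- The operation invoked at position `i` precedes the one invoked at position `i'`: the
response of the former occurs before the invocation of the latter. -/
def Precedes (H : List (Event n Op Res Intl)) (i i' : ℕ) : Prop :=
  ∃ j r, RespondsAt H i j r ∧ j < i'

end Event

/-- A shared object (an atomic object, or an implementation of an object), given by its set of
finite histories. No restriction is placed on which invocations are possible, so that, for example,
a single-writer register is covered. In an atomic object, an operation takes effect in one internal
step between its invocation and its response. -/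
structure SharedObject (n : ℕ) (Op Res : Type) where
  Internal : Type
  histories : Set (List (Event n Op Res Internal))
  nil_mem : [] ∈ histories
  prefix_closed : ∀ G H, G <+: H → H ∈ histories → G ∈ histories
  wellFormed : ∀ H ∈ histories, Event.WellFormed H

/-! ### Registers and their linearizability -/

/-- Operations of a multi-writer multi-reader register with values in `V`. -/
inductive RegOp (V : Type) where
  | read
  | write (v : V)

/-- Responses of a register: a write is acknowledged, a read returns a value. -/
inductive RegRes (V : Type) where
  | ack
  | val (v : V)

/-- A complete register operation, as it occurs in a sequential history: its identity (the position
of its invocation in the original history), its process, the operation and its response. -/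
structure SeqOp (n : ℕ) (V : Type) where
  id : ℕ
  proc : Fin n
  op : RegOp V
  res : RegRes V

namespace SeqOp

variable {n : ℕ} {V : Type}

def isWrite (o : SeqOp n V) : Bool :=
  match o.op with
  | .read => false
  | .write _ => true

/-- The value of the register after the sequential history `L`, when its initial value is `v₀`. -/
def lastValue (v₀ : V) (L : List (SeqOp n V)) : V :=
  L.foldl (fun v o => match o.op with
    | .read => v
    | .write w => w) v₀

/-- The subsequence of write operations of a sequential history. -/
def writes (L : List (SeqOp n V)) : List (SeqOp n V) := L.filter isWrite

end SeqOp

/-- `L` is a linearization of the register history `H`, for the initial value `v₀`. -/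
structure IsLinearization {n : ℕ} {V Intl : Type} (v₀ : V)
    (H : List (Event n (RegOp V) (RegRes V) Intl)) (L : List (SeqOp n V)) : Prop where
  /-- No operation occurs twice. -/
  nodup : (L.map SeqOp.id).Nodup
  /-- Every operation in `L` is an operation of `H`. -/
  mem_history : ∀ o ∈ L, H[o.id]? = some (.inv o.proc o.op)
  /-- Every complete operation of `H` is in `L`, with the same response. -/
  complete : ∀ i j r, Event.RespondsAt H i j r → ∃ o ∈ L, o.id = i ∧ o.res = r
  /-- The order of `L` respects precedence in `H`. -/
  order : L.Pairwise fun o o' => ¬ Event.Precedes H o'.id o.id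
  /-- Every read returns the value of the last write before it, or the initial value if there is
  none; writes are acknowledged. -/
  legal : ∀ L₁ o L₂, L = L₁ ++ o :: L₂ → match o.op with
    | .read => o.res = .val (SeqOp.lastValue v₀ L₁)
    | .write _ => o.res = .ack

namespace SharedObject

variable {n : ℕ} {V : Type}

/-- `f` is a linearization function for the set of histories of `R`. -/
def IsLinearizationFunction (R : SharedObject n (RegOp V) (RegRes V)) (v₀ : V)
    (f : List (Event n (RegOp V) (RegRes V) R.Internal) → List (SeqOp n V)) : Prop :=
  ∀ H ∈ R.histories, IsLinearization v₀ H (f H)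

/-- `R` is a linearizable register with initial value `v₀`. -/
def IsLinearizable (R : SharedObject n (RegOp V) (RegRes V)) (v₀ : V) : Prop :=
  ∃ f, R.IsLinearizationFunction v₀ f

/-- `R` is a write strongly-linearizable register with initial value `v₀`. -/
def IsWriteStronglyLinearizable (R : SharedObject n (RegOp V) (RegRes V)) (v₀ : V) : Prop :=
  ∃ f, R.IsLinearizationFunction v₀ f ∧
    ∀ G ∈ R.histories, ∀ H ∈ R.histories, G <+: H →
      SeqOp.writes (f G) <+: SeqOp.writes (f H)

/-- `R` is *only* linearizable: it is linearizable, and linearizability is all that constrains its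
behaviour, that is, every well-formed sequence of invocations and responses, all of whose prefixes
are linearizable, is a history of `R`. -/
def IsOnlyLinearizable (R : SharedObject n (RegOp V) (RegRes V)) (v₀ : V) : Prop :=
  R.IsLinearizable v₀ ∧
    ∀ H : List (Event n (RegOp V) (RegRes V) R.Internal),
      (∀ e, Event.tau e ∉ H) → Event.WellFormed H →
      (∀ G, G <+: H → ∃ L, IsLinearization v₀ G L) → H ∈ R.histories

/-- The register whose histories are exactly the linearizable ones. -/
def mostGeneralLinearizable (n : ℕ) (v₀ : V) : SharedObject n (RegOp V) (RegRes V) where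
  Internal := Empty
  histories := {H | Event.WellFormed H ∧ ∀ G, G <+: H → ∃ L, IsLinearization v₀ G L}
  nil_mem := by
    constructor
    · intro L e h
      simp at h
    · intro G hG
      obtain rfl : G = [] := by simpa using hG
      refine ⟨[], by simp, by simp, ?_, by simp, ?_⟩
      · rintro i j r ⟨p, op, -, h, -⟩
        simp at h
      · intro L₁ o L₂ h
        simp at h
  prefix_closed := fun G H hGH hH =>
    ⟨fun L e h => hH.1 L e (h.trans hGH), fun G' h => hH.2 G' (h.trans hGH)⟩
  wellFormed := fun H hH => hH.1

theorem mostGeneralLinearizable_isOnlyLinearizable (n : ℕ) (v₀ : V) :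
    (mostGeneralLinearizable n v₀).IsOnlyLinearizable v₀ := by
  classical
  refine ⟨⟨fun H => if h : ∃ L, IsLinearization v₀ H L then h.choose else [], ?_⟩, ?_⟩
  · intro H hH
    have h : ∃ L, IsLinearization v₀ H L := hH.2 H (List.prefix_refl H)
    simpa [h] using h.choose_spec
  · intro H _ hw hl
    exact ⟨hw, hl⟩

end SharedObject

/-! ### Randomized algorithms and strong adversaries -/

/-- The interface of a family of shared objects: names, operations and responses. -/
structure Signature where
  Name : Type
  Op : Name → Type
  Res : Name → Type

/-- A family of shared objects with a given interface. -/
def Objects (n : ℕ) (σ : Signature) : Type 1 :=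
  ∀ i : σ.Name, SharedObject n (σ.Op i) (σ.Res i)

/-- The interface `σ` together with three further registers, with values in `V 0`, `V 1`, `V 2`. -/
def Signature.addRegisters (σ : Signature) (V : Fin 3 → Type) : Signature where
  Name := σ.Name ⊕ Fin 3
  Op := Sum.elim σ.Op fun i => RegOp (V i)
  Res := Sum.elim σ.Res fun i => RegRes (V i)

/-- The objects `B` together with the three registers `R 0`, `R 1`, `R 2`. -/
def Objects.addRegisters {n : ℕ} {σ : Signature} (B : Objects n σ) {V : Fin 3 → Type}
    (R : ∀ i, SharedObject n (RegOp (V i)) (RegRes (V i))) : Objects n (σ.addRegisters V)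
  | .inl i => B i
  | .inr i => R i

/-- The next step of a process: it invokes an operation on a shared object (and continues with the
response), makes a local random choice (and continues with its outcome), or returns an output. -/
inductive ProcessAction (σ : Signature) (Coin State Out : Type) where
  | invoke (i : σ.Name) (op : σ.Op i) (k : σ.Res i → State)
  | flip (c : Coin) (k : ℕ → State)
  | ret (y : Out)

/-- A randomized algorithm for `n` processes, using shared objects with interface `σ`. Each coin has
an arbitrary discrete distribution, with outcomes coded by natural numbers. -/
structure Algorithm (n : ℕ) (σ : Signature) (In Out : Type) where
  State : Type
  Coin : Type
  law : Coin → PMF ℕ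
  init : Fin n → In → State
  next : Fin n → State → ProcessAction σ Coin State Out

/-- The local status of a process: about to execute its next step, waiting for the response to its
pending operation, or having returned. -/
inductive Status (σ : Signature) (State Out : Type) where
  | ready (s : State)
  | waiting (i : σ.Name) (k : σ.Res i → State)
  | returned (y : Out)

/-- What the adversary may schedule next: the next step of a process, the response to the pending
operation of a process, an internal step of a shared object, or nothing. -/
inductive Decision (n : ℕ) (σ : Signature) (B : Objects n σ) where
  | step (p : Fin n)
  | respond (p : Fin n) (i : σ.Name) (r : σ.Res i)
  | internal (i : σ.Name) (e : (B i).Internal)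
  | idle

namespace Algorithm

variable {n : ℕ} {σ : Signature} {In Out : Type}

/-- A configuration: the status of every process, the history of every shared object, the number of
steps that every process has taken, and the log of everything that has happened so far (most recent
first), with the outcomes of the random choices. -/
structure Config (A : Algorithm n σ In Out) (B : Objects n σ) where
  status : Fin n → Status σ A.State Out
  hist : ∀ i, List (Event n (σ.Op i) (σ.Res i) (B i).Internal)
  steps : Fin n → ℕ
  log : List (Decision n σ B × Option ℕ)

variable (A : Algorithm n σ In Out) (B : Objects n σ)

/-- The initial configuration for the input vector `x`. -/
def initial (x : Fin n → In) : A.Config B where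
  status p := .ready (A.init p (x p))
  hist _ := []
  steps _ := 0
  log := []

/-- A strong adversary: a scheduler that sees the whole past, including all local states, the
histories of all objects, and all outcomes of past random choices. -/
abbrev Adversary : Type := A.Config B → Decision n σ B

variable {A B}

/-- Process `p` takes a step and gets the status `s`. -/
def Config.setStatus (C : A.Config B) (p : Fin n) (s : Status σ A.State Out) : A.Config B :=
  { C with
    status := Function.update C.status p s
    steps := Function.update C.steps p (C.steps p + 1) }

open Classical in
/-- The event `e` is appended to the history of object `i`. -/
noncomputable def Config.addEvent (C : A.Config B) (i : σ.Name)
    (e : Event n (σ.Op i) (σ.Res i) (B i).Internal) : A.Config B :=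
  { C with hist := Function.update C.hist i (C.hist i ++ [e]) }

open Classical in
/-- The effect of a decision, where `v c` is the outcome of coin `c` if it is flipped in this step.
A decision that is impossible (as it contradicts the behaviour of a shared object, for
instance) has no effect. Processes that have returned keep taking empty steps. -/
noncomputable def Config.effect (C : A.Config B) (v : A.Coin → ℕ) :
    Decision n σ B → A.Config B
  | .step p =>
    match C.status p with
    | .ready s =>
      match A.next p s with
      | .invoke i op k =>
        if C.hist i ++ [.inv p op] ∈ (B i).histories then
          (C.addEvent i (.inv p op)).setStatus p (.waiting i k)
        else C
      | .flip c k => C.setStatus p (.ready (k (v c)))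
      | .ret y => C.setStatus p (.returned y)
    | .waiting _ _ => C
    | .returned y => C.setStatus p (.returned y)
  | .respond p i r =>
    match C.status p with
    | .waiting j k =>
      if h : i = j then
        if C.hist i ++ [.res p r] ∈ (B i).histories then
          (C.addEvent i (.res p r)).setStatus p (.ready (k (h ▸ r)))
        else C
      else C
    | _ => C
  | .internal i e =>
    if C.hist i ++ [.tau e] ∈ (B i).histories then C.addEvent i (.tau e) else C
  | .idle => C

/-- The outcome of the random choice made when the decision `d` is carried out, if there is one. -/
def Config.outcome (C : A.Config B) (v : A.Coin → ℕ) (d : Decision n σ B) : Option ℕ :=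
  match d with
  | .step p =>
    match C.status p with
    | .ready s =>
      match A.next p s with
      | .flip c _ => some (v c)
      | _ => none
    | _ => none
  | _ => none

/-- Carry out the decision `d` and record it. -/
noncomputable def Config.exec (C : A.Config B) (v : A.Coin → ℕ) (d : Decision n σ B) :
    A.Config B :=
  { C.effect v d with log := (d, C.outcome v d) :: C.log }

variable (A B)

/-- The run against the adversary `S` on the input `x`, where `ω (t, c)` is the outcome of coin `c`
if it is flipped at time `t`. -/
noncomputable def run (x : Fin n → In) (S : A.Adversary B) (ω : ℕ × A.Coin → ℕ) :
    ℕ → A.Config B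
  | 0 => A.initial B x
  | t + 1 => (run x S ω t).exec (fun c => ω (t, c)) (S (run x S ω t))

/-- The probability measure on the outcomes of random choices: all choices are independent, and
those made with coin `c` have the distribution of `c`. -/
noncomputable def coinMeasure : MeasureTheory.Measure (ℕ × A.Coin → ℕ) :=
  MeasureTheory.Measure.infinitePi fun i : ℕ × A.Coin => (A.law i.2).toMeasure

variable {A B}

/-- Process `p` is correct in the run `ρ`: it takes infinitely many steps. The steps counted here
are the invocations, responses, random choices and returns of `p` (and empty steps after it has
returned), not the internal steps of implemented objects. -/
def IsCorrect (ρ : ℕ → A.Config B) (p : Fin n) : Prop :=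
  ∀ N, ∃ t, N ≤ (ρ t).steps p

/-- Process `p` returns in the run `ρ`. -/
def Returns (ρ : ℕ → A.Config B) (p : Fin n) : Prop :=
  ∃ t y, (ρ t).status p = .returned y

/-- The outputs of the processes that have returned. -/
def Config.outputs (C : A.Config B) (p : Fin n) : Option Out :=
  match C.status p with
  | .returned y => some y
  | _ => none

end Algorithm

/-- A task for `n` processes: the legal input vectors, and the output vectors allowed for each
input vector. An output vector may be partial, as some processes may not have returned. (For a
relation between full vectors, a partial vector is allowed if it extends to a related one.) -/
structure DistributedTask (n : ℕ) (In Out : Type) where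
  legal : Set (Fin n → In)
  allowed : (Fin n → In) → Set (Fin n → Option Out)

namespace Algorithm

variable {n : ℕ} {σ : Signature} {In Out : Type}

/-- `A`, with shared objects `B`, solves the task `T`: in every run on a legal input, against every
adversary and for all possible outcomes of the random choices, the outputs are always allowed. -/
def Solves (A : Algorithm n σ In Out) (B : Objects n σ) (T : DistributedTask n In Out) : Prop :=
  ∀ x ∈ T.legal, ∀ (S : A.Adversary B) (ω : ℕ × A.Coin → ℕ),
    (∀ i, ω i ∈ (A.law i.2).support) → ∀ t, (A.run B x S ω t).outputs ∈ T.allowed x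

/-- `A`, with shared objects `B`, terminates with probability 1 against a strong adversary: on every
legal input and against every strong adversary, with probability 1 all correct processes return. -/
def TerminatesAlmostSurely (A : Algorithm n σ In Out) (B : Objects n σ) (T : DistributedTask n In Out) :
    Prop :=
  ∀ x ∈ T.legal, ∀ S : A.Adversary B, ∀ᵐ ω ∂A.coinMeasure,
    ∀ p, IsCorrect (A.run B x S ω) p → Returns (A.run B x S ω) p

/-- A strong adversary can prevent the termination of `A` with shared objects `B`: on every legal
input, some strong adversary ensures that, with probability 1, all processes take infinitely many
steps and none of them ever returns. -/
def AdversaryPreventsTermination (A : Algorithm n σ In Out) (B : Objects n σ)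
    (T : DistributedTask n In Out) : Prop :=
  ∀ x ∈ T.legal, ∃ S : A.Adversary B, ∀ᵐ ω ∂A.coinMeasure,
    ∀ p, IsCorrect (A.run B x S ω) p ∧ ¬ Returns (A.run B x S ω) p

end Algorithm

/-! In the new algorithm, `withGame A`, each process plays a game before it starts `A`. In round
`j`, process 0 writes `(j, false)` and process 1 writes `(j, true)` to register 0, while process 2
reads this register twice. If process 2 sees both values of the round, it announces the one it saw
first by writing it to register 1. Process 0 flips a fair coin after its write has responded, and
goes on to round `j + 1` only if the announced bit agrees with the coin. The others go on when they
have seen, or made, an announcement for the round. Whoever misses the value it needs leaves the game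
and starts `A`.

The game cannot spoil `A`. When its steps are erased and every process in the game is regarded as
not having started, a run of the new algorithm becomes a run of `A` (`rebuild_run`), which gives
safety. If the outcomes of the game coin are fixed, the erased run is a run against one strong
adversary; by Fubini, a correct process that leaves the game returns almost surely
(`ae_returns_of_left`).

With only linearizable registers, the order of two concurrent writes may be settled after the fact.
The adversary lets process 0 complete its write, sees the coin, and only then makes the pending
first read return the value that belongs to the coin and the second read the other one
(`Quiescent.contest`). The announcement then always agrees with the coin, and rounds repeat forever
(`forcesIn_round`).

With write strongly-linearizable registers, the completed write of process 0 fixes which write of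
the round comes first before the coin is flipped, and process 2 can only announce that one
(`Alternates.firstOf`). So process 0 survives a round with probability at most 1/2. To make this
precise, give process 0 the mass `2 ^ j` in round `j`, doubled at a flip that agrees with the first
write and lost at one that does not. This is a nonnegative supermartingale starting at `1`
(`lintegral_mass_run_le`). A correct process that never leaves the game passes all rounds, each of
which needs an announcement and hence a write by process 0; then the mass takes all values `2 ^ j`
and its liminf is infinite, an event of probability zero by Fatou's lemma (`ae_not_unbounded`,
`ae_left`). -/

namespace Event

variable {n : ℕ} {Op Res Intl : Type}

/-! ### Histories, pending operations and extensions by one event -/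

@[simp] theorem pendingAfter_append_inv (p q : Fin n) (op : Op) (H : List (Event n Op Res Intl)) :
    pendingAfter p (H ++ [inv q op]) = if q = p then true else pendingAfter p H := by
  simp [pendingAfter]

@[simp] theorem pendingAfter_append_res (p q : Fin n) (r : Res) (H : List (Event n Op Res Intl)) :
    pendingAfter p (H ++ [res q r]) = if q = p then false else pendingAfter p H := by
  simp [pendingAfter]

@[simp] theorem pendingAfter_append_tau (p : Fin n) (e : Intl) (H : List (Event n Op Res Intl)) :
    pendingAfter p (H ++ [tau e]) = pendingAfter p H := by
  simp [pendingAfter]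

/-- Position `i` of `H ++ [e]` is a position of `H` or the last one. -/
theorem getElem?_snoc {α : Type*} {H : List α} {e a : α} {i : ℕ} (h : (H ++ [e])[i]? = some a) :
    (i < H.length ∧ H[i]? = some a) ∨ (i = H.length ∧ e = a) := by
  rcases lt_trichotomy i H.length with hi | hi | hi
  · exact .inl ⟨hi, by rwa [List.getElem?_append_left hi] at h⟩
  · subst hi
    exact .inr ⟨rfl, by simpa using h⟩
  · rw [List.getElem?_eq_none (by simp; omega)] at h
    cases h

theorem lt_length_of_getElem? {α : Type*} {H : List α} {a : α} {i : ℕ} (h : H[i]? = some a) :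
    i < H.length :=
  (List.getElem?_eq_some_iff.1 h).1

theorem getElem?_snoc_of_some {α : Type*} {H : List α} {a : α} {i : ℕ} (e : α)
    (h : H[i]? = some a) : (H ++ [e])[i]? = some a := by
  rw [List.getElem?_append_left (lt_length_of_getElem? h), h]

/-- The condition under which a well-formed history may be extended by an event. -/
def Enabled (H : List (Event n Op Res Intl)) : Event n Op Res Intl → Prop
  | inv p _ => pendingAfter p H = false
  | res p _ => pendingAfter p H = true
  | tau _ => True

theorem WellFormed.snoc {H : List (Event n Op Res Intl)} {e : Event n Op Res Intl}
    (h : WellFormed H) (he : Enabled H e) : WellFormed (H ++ [e]) := by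
  intro L e' hL
  rcases List.prefix_concat_iff.1 hL with h' | h'
  · obtain ⟨rfl, h2⟩ := List.append_inj' h' rfl
    obtain rfl : e' = e := by simpa using h2
    exact he
  · exact h L e' h'

theorem WellFormed.enabled {H : List (Event n Op Res Intl)} {e : Event n Op Res Intl}
    (h : WellFormed (H ++ [e])) : Enabled H e := h H e (List.prefix_refl _)

/-- Pending operations are tracked by a running flag, responses by positions; this passes from the
former to the latter. The flag is decided by the last event of `p`, hence the induction from the
right. -/
theorem exists_res_of_pendingAfter_eq_false {p : Fin n} {H : List (Event n Op Res Intl)}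
    (h : pendingAfter p H = false) {i : ℕ} {op : Op} (hi : H[i]? = some (inv p op)) :
    ∃ k r, i < k ∧ H[k]? = some (res p r) := by
  induction H using List.reverseRecOn with
  | nil => simp at hi
  | append_singleton H e ih =>
    have key : pendingAfter p H = false → H[i]? = some (inv p op) →
        ∃ k r, i < k ∧ (H ++ [e])[k]? = some (res p r) := fun h1 h2 => by
      obtain ⟨k, r, hk, hr⟩ := ih h1 h2
      exact ⟨k, r, hk, getElem?_snoc_of_some e hr⟩
    rcases getElem?_snoc hi with ⟨hlt, h2⟩ | ⟨-, rfl⟩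
    · cases e with
      | inv q op' =>
        rw [pendingAfter_append_inv] at h
        split_ifs at h
        exact key h h2
      | res q r =>
        rw [pendingAfter_append_res] at h
        split_ifs at h with hq
        · subst hq
          exact ⟨H.length, r, hlt, by simp⟩
        · exact key h h2
      | tau e =>
        rw [pendingAfter_append_tau] at h
        exact key h h2
    · simp at h

/-- In `H`, the operation invoked at position `m` is the pending operation of `p`. -/
structure OpenAt (H : List (Event n Op Res Intl)) (p : Fin n) (m : ℕ) (op : Op) : Prop where
  get : H[m]? = some (inv p op)
  quiet : ∀ k r, m < k → H[k]? ≠ some (res p r)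
  unique : ∀ i op', H[i]? = some (inv p op') → (∀ k r, i < k → H[k]? ≠ some (res p r)) → i = m

/-- The cleared flag is needed for uniqueness: every earlier invocation by `p` already has a
response behind it. -/
theorem OpenAt.of_inv {H : List (Event n Op Res Intl)} {p : Fin n} (h : pendingAfter p H = false)
    (op : Op) : OpenAt (H ++ [inv p op]) p H.length op where
  get := by simp
  quiet k r hk hr := by
    have := lt_length_of_getElem? hr
    simp at this
    omega
  unique i op' hi hq := by
    rcases getElem?_snoc hi with ⟨-, h2⟩ | ⟨h1, -⟩
    · obtain ⟨k, r, hk, hr⟩ := exists_res_of_pendingAfter_eq_false h h2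
      exact absurd (getElem?_snoc_of_some _ hr) (hq k r hk)
    · exact h1

theorem OpenAt.snoc {H : List (Event n Op Res Intl)} {p : Fin n} {m : ℕ} {op : Op}
    (h : OpenAt H p m op) {e : Event n Op Res Intl} (h1 : ∀ op, e ≠ inv p op)
    (h2 : ∀ r, e ≠ res p r) : OpenAt (H ++ [e]) p m op where
  get := getElem?_snoc_of_some _ h.get
  quiet k r hk hr := by
    rcases getElem?_snoc hr with ⟨-, h'⟩ | ⟨-, h'⟩
    · exact h.quiet k r hk h'
    · exact h2 r h'
  unique i op' hi hq := by
    rcases getElem?_snoc hi with ⟨-, h'⟩ | ⟨-, h'⟩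
    · exact h.unique i op' h' fun k r hk hr => hq k r hk (getElem?_snoc_of_some _ hr)
    · exact absurd h' (h1 op')

theorem OpenAt.snoc_inv {H : List (Event n Op Res Intl)} {p q : Fin n} {m : ℕ} {op : Op}
    (h : OpenAt H p m op) (hq : q ≠ p) (op' : Op) : OpenAt (H ++ [inv q op']) p m op :=
  h.snoc (fun _ h' => hq (by injection h')) (fun _ h' => by cases h')

theorem OpenAt.snoc_res {H : List (Event n Op Res Intl)} {p q : Fin n} {m : ℕ} {op : Op}
    (h : OpenAt H p m op) (hq : q ≠ p) (r : Res) : OpenAt (H ++ [res q r]) p m op :=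
  h.snoc (fun _ h' => by cases h') (fun _ h' => hq (by injection h'))

theorem OpenAt.lt_length {H : List (Event n Op Res Intl)} {p : Fin n} {m : ℕ} {op : Op}
    (h : OpenAt H p m op) : m < H.length := lt_length_of_getElem? h.get

theorem OpenAt.respondsAt {H : List (Event n Op Res Intl)} {p : Fin n} {m : ℕ} {op : Op}
    (h : OpenAt H p m op) (r : Res) : RespondsAt (H ++ [res p r]) m H.length r := by
  refine ⟨p, op, h.lt_length, getElem?_snoc_of_some _ h.get, by simp, fun k r' hk hk' hr => ?_⟩
  rw [List.getElem?_append_left hk'] at hr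
  exact h.quiet k r' hk hr

theorem OpenAt.not_precedes {H : List (Event n Op Res Intl)} {p : Fin n} {m : ℕ} {op : Op}
    (h : OpenAt H p m op) (i : ℕ) : ¬ Precedes H m i := by
  rintro ⟨j, r, ⟨q, op', hlt, hm, hj, -⟩, -⟩
  have := h.get.symm.trans hm
  simp only [Option.some.injEq, inv.injEq] at this
  obtain ⟨rfl, rfl⟩ := this
  exact h.quiet j r hlt hj

theorem RespondsAt.snoc {H : List (Event n Op Res Intl)} {i j : ℕ} {r : Res}
    (h : RespondsAt H i j r) (e : Event n Op Res Intl) : RespondsAt (H ++ [e]) i j r := by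
  obtain ⟨p, op, hlt, hi, hj, hq⟩ := h
  refine ⟨p, op, hlt, getElem?_snoc_of_some _ hi, getElem?_snoc_of_some _ hj, ?_⟩
  intro k r' hk hk' hr
  rw [List.getElem?_append_left (hk'.trans (lt_length_of_getElem? hj))] at hr
  exact hq k r' hk hk' hr

/-- A new event can complete an operation only at the last position, so a linearization of the
shorter history has to be checked against that one response alone. -/
theorem RespondsAt.of_snoc {H : List (Event n Op Res Intl)} {i j : ℕ} {r : Res}
    {e : Event n Op Res Intl} (h : RespondsAt (H ++ [e]) i j r) :
    RespondsAt H i j r ∨ j = H.length ∧ ∃ p op, e = res p r ∧ H[i]? = some (inv p op) ∧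
      ∀ k r', i < k → H[k]? ≠ some (res p r') := by
  obtain ⟨p, op, hlt, hi, hj, hq⟩ := h
  have hq' : ∀ k r', i < k → k < j → H[k]? ≠ some (res p r') := fun k r' hk hk' hr =>
    hq k r' hk hk' (getElem?_snoc_of_some _ hr)
  rcases getElem?_snoc hj with ⟨hj1, hj2⟩ | ⟨hj1, hj2⟩
  · rw [List.getElem?_append_left (hlt.trans hj1)] at hi
    exact .inl ⟨p, op, hlt, hi, hj2, hq'⟩
  · rw [List.getElem?_append_left (hj1 ▸ hlt)] at hi
    exact .inr ⟨hj1, p, op, hj2, hi, fun k r' hk hr =>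
      hq' k r' hk (hj1 ▸ lt_length_of_getElem? hr) hr⟩

theorem RespondsAt.lt_length {H : List (Event n Op Res Intl)} {i j : ℕ} {r : Res}
    (h : RespondsAt H i j r) : j < H.length := by
  obtain ⟨p, op, -, -, hj, -⟩ := h
  exact lt_length_of_getElem? hj

theorem Precedes.of_snoc {H : List (Event n Op Res Intl)} {i i' : ℕ} {e : Event n Op Res Intl}
    (h : Precedes (H ++ [e]) i i') (hi' : i' < H.length) : Precedes H i i' := by
  obtain ⟨j, r, hr, hj⟩ := h
  rcases hr.of_snoc with h | ⟨h, -⟩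
  · exact ⟨j, r, h, hj⟩
  · omega

end Event

/-! ### Sequential histories and linearizations that grow event by event -/

namespace SeqOp

variable {n : ℕ} {V : Type}

@[simp] theorem lastValue_append_read (v₀ : V) (L : List (SeqOp n V)) (m : ℕ) (p : Fin n)
    (r : RegRes V) : lastValue v₀ (L ++ [⟨m, p, .read, r⟩]) = lastValue v₀ L := by
  simp [lastValue]

@[simp] theorem lastValue_append_write (v₀ v : V) (L : List (SeqOp n V)) (m : ℕ) (p : Fin n)
    (r : RegRes V) : lastValue v₀ (L ++ [⟨m, p, .write v, r⟩]) = v := by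
  simp [lastValue]

end SeqOp

namespace IsLinearization

open Event

variable {n : ℕ} {V Intl : Type} {v₀ : V} {H : List (Event n (RegOp V) (RegRes V) Intl)}
  {L : List (SeqOp n V)}

theorem id_lt (h : IsLinearization v₀ H L) {o : SeqOp n V} (ho : o ∈ L) : o.id < H.length :=
  lt_length_of_getElem? (h.mem_history o ho)

theorem nil : IsLinearization v₀ ([] : List (Event n (RegOp V) (RegRes V) Intl)) [] where
  nodup := by simp
  mem_history := by simp
  complete := by
    rintro i j r ⟨p, op, -, h, -⟩
    simp at h
  order := by simp
  legal := by
    intro L₁ o L₂ h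
    simp at h

/-- A linearization remains one when the history is extended by an event, provided that the
operation that responds, if there is one, is already in it. -/
theorem snoc_event (h : IsLinearization v₀ H L) {e : Event n (RegOp V) (RegRes V) Intl}
    (he : ∀ i r, RespondsAt (H ++ [e]) i H.length r → ∃ o ∈ L, o.id = i ∧ o.res = r) :
    IsLinearization v₀ (H ++ [e]) L where
  nodup := h.nodup
  mem_history o ho := getElem?_snoc_of_some _ (h.mem_history o ho)
  complete i j r hr := by
    rcases hr.of_snoc with h' | ⟨rfl, -⟩
    · exact h.complete i j r h'
    · exact he i r hr
  order := h.order.imp_of_mem fun ho _ hn hp => hn (hp.of_snoc (h.id_lt ho))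
  legal := h.legal

theorem snoc_inv (h : IsLinearization v₀ H L) (p : Fin n) (op : RegOp V) :
    IsLinearization v₀ (H ++ [inv p op]) L :=
  h.snoc_event fun i r hr => by
    rcases hr.of_snoc with h' | ⟨-, q, op', h', -⟩
    · exact absurd h'.lt_length (lt_irrefl _)
    · cases h'

/-- By `OpenAt.unique`, the operation that completes is the one invoked at `m`; since it has already
taken effect with response `r`, the linearization needs no change. -/
theorem snoc_res (h : IsLinearization v₀ H L) {p : Fin n} {m : ℕ} {op : RegOp V} {r : RegRes V}
    (ho : OpenAt H p m op) (hm : ∃ o ∈ L, o.id = m ∧ o.res = r) :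
    IsLinearization v₀ (H ++ [res p r]) L :=
  h.snoc_event fun i r' hr => by
    rcases hr.of_snoc with h' | ⟨-, q, op', h', hi, hq⟩
    · exact absurd h'.lt_length (lt_irrefl _)
    · injection h' with h1 h2
      subst h1 h2
      rwa [ho.unique i op' hi hq]

/-- The response that an operation gets when it takes effect at the end of `L`. -/
def response (v₀ : V) (L : List (SeqOp n V)) : RegOp V → RegRes V
  | .read => .val (SeqOp.lastValue v₀ L)
  | .write _ => .ack

/-- A pending operation may take effect at the end of a linearization. -/
theorem snoc_op (h : IsLinearization v₀ H L) {p : Fin n} {m : ℕ} {op : RegOp V}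
    (ho : OpenAt H p m op) (hm : ∀ o ∈ L, o.id ≠ m) :
    IsLinearization v₀ H (L ++ [⟨m, p, op, response v₀ L op⟩]) where
  nodup := by
    simp only [List.map_append, List.map_cons, List.map_nil]
    rw [List.nodup_append]
    refine ⟨h.nodup, by simp, ?_⟩
    rintro a ha b hb rfl
    obtain ⟨o, ho, rfl⟩ := List.mem_map.1 ha
    exact hm o ho (by simpa using hb)
  mem_history o hoL := by
    rcases List.mem_append.1 hoL with h' | h'
    · exact h.mem_history o h'
    · obtain rfl := List.mem_singleton.1 h'
      exact ho.get
  complete i j r hr := by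
    obtain ⟨o, h1, h2⟩ := h.complete i j r hr
    exact ⟨o, List.mem_append_left _ h1, h2⟩
  order := by
    rw [List.pairwise_append]
    refine ⟨h.order, by simp, ?_⟩
    rintro o - o' ho'
    obtain rfl := List.mem_singleton.1 ho'
    exact ho.not_precedes _
  legal L₁ o L₂ hL := by
    -- Either `o` is the new operation, whose response is right by construction, or the new
    -- operation ends `L₂`, and legality is inherited because it looks only at what precedes `o`.
    rcases List.eq_nil_or_concat L₂ with rfl | ⟨L₃, a, rfl⟩
    · obtain ⟨rfl, h2⟩ := List.append_inj' hL rfl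
      obtain rfl : _ = o := by simpa using h2
      cases op <;> rfl
    · rw [List.concat_eq_append, ← List.cons_append, ← List.append_assoc] at hL
      obtain ⟨h1, -⟩ := List.append_inj' hL rfl
      exact h.legal L₁ o L₃ h1

end IsLinearization

/-! ### Histories that an only linearizable register must allow, and the contest of two writes -/

namespace Event

variable {n : ℕ} {V Intl : Type} {v₀ : V} {H : List (Event n (RegOp V) (RegRes V) Intl)}

/-- The register histories that an only linearizable register has to allow. -/
structure Admissible (v₀ : V) (H : List (Event n (RegOp V) (RegRes V) Intl)) : Prop where
  no_tau : ∀ e, tau e ∉ H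
  wellFormed : WellFormed H
  linearizable : ∀ G, G <+: H → ∃ L, IsLinearization v₀ G L

theorem Admissible.nil : Admissible v₀ ([] : List (Event n (RegOp V) (RegRes V) Intl)) where
  no_tau := by simp
  wellFormed := by
    intro L e h
    simp at h
  linearizable := by
    intro G hG
    obtain rfl : G = [] := by simpa using hG
    exact ⟨[], .nil⟩

theorem Admissible.of_prefix {G : List (Event n (RegOp V) (RegRes V) Intl)} (h : Admissible v₀ H)
    (hG : G <+: H) : Admissible v₀ G where
  no_tau e he := h.no_tau e (hG.subset he)
  wellFormed L e hL := h.wellFormed L e (hL.trans hG)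
  linearizable G' hG' := h.linearizable G' (hG'.trans hG)

theorem Admissible.snoc (h : Admissible v₀ H) {e : Event n (RegOp V) (RegRes V) Intl}
    (he : Enabled H e) (hτ : ∀ i, e ≠ tau i) (hL : ∃ L, IsLinearization v₀ (H ++ [e]) L) :
    Admissible v₀ (H ++ [e]) where
  no_tau i hi := by
    rcases List.mem_append.1 hi with h' | h'
    · exact h.no_tau i h'
    · exact hτ i (List.mem_singleton.1 h').symm
  wellFormed := h.wellFormed.snoc he
  linearizable G hG := by
    rcases List.prefix_concat_iff.1 hG with rfl | h'
    · exact hL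
    · exact h.linearizable G h'

/-- An admissible history without pending operations, with a linearization in which the final value
of the register is `v`. -/
structure Quiescent (v₀ : V) (H : List (Event n (RegOp V) (RegRes V) Intl)) (v : V) : Prop where
  admissible : Admissible v₀ H
  not_pending : ∀ p, pendingAfter p H = false
  linearization : ∃ L, IsLinearization v₀ H L ∧ SeqOp.lastValue v₀ L = v

theorem Quiescent.nil :
    Quiescent v₀ ([] : List (Event n (RegOp V) (RegRes V) Intl)) v₀ where
  admissible := .nil
  not_pending _ := rfl
  linearization := ⟨[], .nil, rfl⟩

/-- The read takes effect at the end of the linearization just before it responds; with nothing else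
pending, quiescence is restored. -/
theorem Quiescent.read {v : V} (h : Quiescent v₀ H v) (p : Fin n) :
    Quiescent v₀ (H ++ [inv p .read, res p (.val v)]) v := by
  obtain ⟨L, hL, rfl⟩ := h.linearization
  have ho := OpenAt.of_inv (h.not_pending p) (RegOp.read (V := V))
  have h1 := h.admissible.snoc (e := inv p .read) (h.not_pending p) (by simp)
    ⟨L, hL.snoc_inv p .read⟩
  have h2 := ((hL.snoc_inv p .read).snoc_op ho fun o ho => (hL.id_lt ho).ne).snoc_res ho
    ⟨_, List.mem_append_right _ (List.mem_singleton_self _), rfl, rfl⟩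
  have h3 := h1.snoc (e := res p (.val (SeqOp.lastValue v₀ L)))
    (by simp [Enabled]) (by simp) ⟨_, h2⟩
  have e : H ++ [inv p .read, res p (.val (SeqOp.lastValue v₀ L))] =
    H ++ [inv p .read] ++ [res p (.val (SeqOp.lastValue v₀ L))] := by simp
  rw [e]
  refine ⟨h3, fun q => ?_, _, h2, by simp⟩
  rw [pendingAfter_append_res, pendingAfter_append_inv]
  split_ifs
  exacts [rfl, h.not_pending q]

theorem Quiescent.write {v : V} (h : Quiescent v₀ H v) (p : Fin n) (w : V) :
    Quiescent v₀ (H ++ [inv p (.write w), res p .ack]) w := by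
  obtain ⟨L, hL, rfl⟩ := h.linearization
  have ho := OpenAt.of_inv (h.not_pending p) (RegOp.write w)
  have h1 := h.admissible.snoc (e := inv p (.write w)) (h.not_pending p) (by simp)
    ⟨L, hL.snoc_inv p (.write w)⟩
  have h2 := ((hL.snoc_inv p (.write w)).snoc_op ho fun o ho => (hL.id_lt ho).ne).snoc_res ho
    ⟨_, List.mem_append_right _ (List.mem_singleton_self _), rfl, rfl⟩
  have h3 := h1.snoc (e := res p .ack) (by simp [Enabled]) (by simp) ⟨_, h2⟩
  have e : H ++ [inv p (.write w), res p .ack] =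
    H ++ [inv p (.write w)] ++ [res p .ack] := by simp
  rw [e]
  refine ⟨h3, fun q => ?_, _, h2, by simp⟩
  rw [pendingAfter_append_res, pendingAfter_append_inv]
  split_ifs
  exacts [rfl, h.not_pending q]

/-- Two concurrent writes by `p₀` and `p₁` of the values `w false` and `w true`, overlapped by the
first of two reads by `p₂`, where the reads return `w c` and `w (!c)`. -/
def contest (p₀ p₁ p₂ : Fin n) (w : Bool → V) (c : Bool) :
    List (Event n (RegOp V) (RegRes V) Intl) :=
  [inv p₀ (.write (w false)), inv p₁ (.write (w true)), inv p₂ .read, res p₀ .ack, res p₁ .ack,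
    res p₂ (.val (w c)), inv p₂ .read, res p₂ (.val (w (!c)))]

/-- While both writes and the first read are pending, their order is open: the write of `w c`, the
read, the write of `w (!c)` is a possible order for either `c`. Both writes are acknowledged before
a read reveals the choice, so the first five events are the same for both `c`; this allows `c` to be
chosen late. -/
theorem Quiescent.contest {v : V} (h : Quiescent v₀ H v) {p₀ p₁ p₂ : Fin n} (h01 : p₀ ≠ p₁)
    (h02 : p₀ ≠ p₂) (h12 : p₁ ≠ p₂) (w : Bool → V) (c : Bool) :
    Quiescent v₀ (H ++ Event.contest p₀ p₁ p₂ w c) (w (!c)) := by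
  obtain ⟨L, hL, -⟩ := h.linearization
  set H₁ := H ++ [inv p₀ (.write (w false))] with hH₁
  set H₂ := H₁ ++ [inv p₁ (.write (w true))] with hH₂
  set H₃ := H₂ ++ [inv p₂ .read] with hH₃
  set H₄ := H₃ ++ [res p₀ .ack] with hH₄
  set H₅ := H₄ ++ [res p₁ .ack] with hH₅
  set H₆ := H₅ ++ [res p₂ (.val (w c))] with hH₆
  set H₇ := H₆ ++ [inv p₂ .read] with hH₇
  set H₈ := H₇ ++ [res p₂ (.val (w (!c)))] with hH₈
  have e : H ++ Event.contest p₀ p₁ p₂ w c = H₈ := by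
    simp [hH₁, hH₂, hH₃, hH₄, hH₅, hH₆, hH₇, hH₈, Event.contest]
  have l1 : H₁.length = H.length + 1 := by simp [hH₁]
  have l2 : H₂.length = H.length + 2 := by simp [hH₂, l1]
  have l3 : H₃.length = H.length + 3 := by simp [hH₃, l2]
  have l6 : H₆.length = H.length + 6 := by simp [hH₆, hH₅, hH₄, l3]
  have q0 := h.not_pending
  have a1 : Admissible v₀ H₁ := h.admissible.snoc (q0 p₀) (by simp) ⟨L, hL.snoc_inv _ _⟩
  have L1 := hL.snoc_inv p₀ (.write (w false))
  have a2 : Admissible v₀ H₂ :=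
    a1.snoc (by simp [-List.append_assoc, Enabled, hH₁, h01, q0]) (by simp) ⟨L, L1.snoc_inv _ _⟩
  have L2 := L1.snoc_inv p₁ (.write (w true))
  have a3 : Admissible v₀ H₃ :=
    a2.snoc (by simp [-List.append_assoc, Enabled, hH₁, hH₂, h02, h12, q0]) (by simp) ⟨L, L2.snoc_inv _ _⟩
  have L3 : IsLinearization v₀ H₃ L := L2.snoc_inv p₂ .read
  have o0 : OpenAt H₃ p₀ H.length (.write (w false)) :=
    ((OpenAt.of_inv (q0 p₀) _).snoc_inv h01.symm _).snoc_inv h02.symm _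
  have o1 : OpenAt H₃ p₁ (H.length + 1) (.write (w true)) := by
    rw [← l1]
    exact (OpenAt.of_inv (by simp [-List.append_assoc, hH₁, h01, q0]) _).snoc_inv h12.symm _
  have o2 : OpenAt H₃ p₂ (H.length + 2) .read := by
    rw [← l2]
    exact OpenAt.of_inv (by simp [-List.append_assoc, hH₁, hH₂, h02, h12, q0]) _
  have hid : ∀ o ∈ L, o.id < H.length := fun o ho => hL.id_lt ho
  -- `L'` lets all three pending operations take effect, so that their later responses change
  -- nothing. The bound on identities serves the second read, which is invoked at position `H.length
  -- + 6`.
  obtain ⟨L', hL', hm0, hm1, hm2, hlast, hlt⟩ : ∃ L', IsLinearization v₀ H₃ L' ∧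
      (∃ o ∈ L', o.id = H.length ∧ o.res = .ack) ∧ (∃ o ∈ L', o.id = H.length + 1 ∧ o.res = .ack) ∧
      (∃ o ∈ L', o.id = H.length + 2 ∧ o.res = .val (w c)) ∧
      SeqOp.lastValue v₀ L' = w (!c) ∧ ∀ o ∈ L', o.id < H.length + 3 := by
    cases c
    -- For `c = false` the order is: write of `p₀`, read, write of `p₁`. For `c = true` the two
    -- writes change places.
    · have s1 := L3.snoc_op o0 fun o ho => (hid o ho).ne
      have s2 := s1.snoc_op o2 (by
        intro o ho
        rcases List.mem_append.1 ho with h' | h'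
        · have := hid o h'
          omega
        · obtain rfl := List.mem_singleton.1 h'
          simp)
      have s3 := s2.snoc_op o1 (by
        intro o ho
        simp only [List.mem_append, List.mem_singleton] at ho
        rcases ho with (h' | rfl) | rfl
        · have := hid o h'
          omega
        · simp
        · simp)
      refine ⟨_, s3, ?_, ?_, ?_, ?_, ?_⟩
      · exact ⟨_, List.mem_append_left _ (List.mem_append_left _ (List.mem_append_right _
          (List.mem_singleton_self _))), rfl, rfl⟩
      · exact ⟨_, List.mem_append_right _ (List.mem_singleton_self _), rfl, rfl⟩
      · refine ⟨_, List.mem_append_left _ (List.mem_append_right _ (List.mem_singleton_self _)), rfl, ?_⟩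
        simp [IsLinearization.response]
      · simp [-List.append_assoc]
      · intro o ho
        simp only [List.mem_append, List.mem_singleton] at ho
        rcases ho with ((h' | rfl) | rfl) | rfl
        · have := hid o h'
          omega
        all_goals simp
    · have s1 := L3.snoc_op o1 fun o ho => by have := hid o ho; omega
      have s2 := s1.snoc_op o2 (by
        intro o ho
        rcases List.mem_append.1 ho with h' | h'
        · have := hid o h'
          omega
        · obtain rfl := List.mem_singleton.1 h'
          simp)
      have s3 := s2.snoc_op o0 (by
        intro o ho
        simp only [List.mem_append, List.mem_singleton] at ho
        rcases ho with (h' | rfl) | rfl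
        · exact (hid o h').ne
        · simp
        · simp)
      refine ⟨_, s3, ?_, ?_, ?_, ?_, ?_⟩
      · exact ⟨_, List.mem_append_right _ (List.mem_singleton_self _), rfl, rfl⟩
      · exact ⟨_, List.mem_append_left _ (List.mem_append_left _ (List.mem_append_right _
          (List.mem_singleton_self _))), rfl, rfl⟩
      · refine ⟨_, List.mem_append_left _ (List.mem_append_right _ (List.mem_singleton_self _)), rfl, ?_⟩
        simp [IsLinearization.response]
      · simp [-List.append_assoc]
      · intro o ho
        simp only [List.mem_append, List.mem_singleton] at ho
        rcases ho with ((h' | rfl) | rfl) | rfl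
        · have := hid o h'
          omega
        all_goals simp
  have L4 : IsLinearization v₀ H₄ L' := hL'.snoc_res o0 hm0
  have L5 : IsLinearization v₀ H₅ L' := L4.snoc_res (o1.snoc_res h01 _) hm1
  have L6 : IsLinearization v₀ H₆ L' := L5.snoc_res ((o2.snoc_res h02 _).snoc_res h12 _) hm2
  have L7 : IsLinearization v₀ H₇ L' := L6.snoc_inv _ _
  have a4 : Admissible v₀ H₄ :=
    a3.snoc (by simp [-List.append_assoc, Enabled, hH₁, hH₂, hH₃, h01.symm, h02.symm]) (by simp) ⟨L', L4⟩
  have a5 : Admissible v₀ H₅ :=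
    a4.snoc (by simp [-List.append_assoc, Enabled, hH₂, hH₃, hH₄, h01, h12.symm]) (by simp) ⟨L', L5⟩
  have a6 : Admissible v₀ H₆ :=
    a5.snoc (by simp [-List.append_assoc, Enabled, hH₃, hH₄, hH₅, h02, h12]) (by simp) ⟨L', L6⟩
  have n6 : pendingAfter p₂ H₆ = false := by simp [hH₆]
  have a7 : Admissible v₀ H₇ := a6.snoc n6 (by simp) ⟨L', L7⟩
  have o3 : OpenAt H₇ p₂ (H.length + 6) .read := by
    rw [← l6]
    exact OpenAt.of_inv n6 _
  have s8 := L7.snoc_op o3 fun o ho => by have := hlt o ho; omega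
  have L8 := s8.snoc_res o3 (r := .val (w (!c))) ⟨_,
    List.mem_append_right _ (List.mem_singleton_self _), rfl, by
    simp [IsLinearization.response, hlast]⟩
  have a8 : Admissible v₀ H₈ := a7.snoc (by simp [-List.append_assoc, Enabled, hH₇]) (by simp) ⟨_, L8⟩
  rw [e]
  refine ⟨a8, fun p => ?_, _, L8, by simp [hlast]⟩
  simp only [hH₁, hH₂, hH₃, hH₄, hH₅, hH₆, hH₇, hH₈, pendingAfter_append_inv,
    pendingAfter_append_res, q0]
  split_ifs <;> simp_all

end Event

/-! ### Independent coins: drawing one of them anew, and splitting off the coin of the game -/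

open MeasureTheory in
/-- Drawing one coordinate anew does not change a product measure. -/
theorem map_update_infinitePi {ι : Type*} [DecidableEq ι] {X : ι → Type*}
    [∀ i, MeasurableSpace (X i)] (μ : ∀ i, Measure (X i)) [∀ i, IsProbabilityMeasure (μ i)]
    (i₀ : ι) :
    ((Measure.infinitePi μ).prod (μ i₀)).map (fun z => Function.update z.1 i₀ z.2) =
      Measure.infinitePi μ := by
  have hm : Measurable fun z : (∀ i, X i) × X i₀ => Function.update z.1 i₀ z.2 :=
    measurable_update'
  -- A product measure is determined by finite boxes. The preimage of a box constrains the redrawn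
  -- value by the side at `i₀`, or not at all if `i₀` is not among the coordinates of the box.
  refine Measure.eq_infinitePi μ fun s t ht => ?_
  rw [Measure.map_apply hm (.pi s.countable_toSet fun i _ => ht i)]
  have h0 : MeasurableSet ((↑(s.erase i₀) : Set ι).pi t) :=
    .pi (Finset.countable_toSet _) fun i _ => ht i
  by_cases hi : i₀ ∈ s
  · have : (fun z : (∀ i, X i) × X i₀ => Function.update z.1 i₀ z.2) ⁻¹' (s : Set ι).pi t =
        ((↑(s.erase i₀) : Set ι).pi t) ×ˢ t i₀ := by
      ext ⟨ω, x⟩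
      simp only [Set.mem_preimage, Set.mem_pi, Set.mem_prod, Finset.coe_erase, Finset.mem_coe,
        Set.mem_sdiff, Set.mem_singleton_iff]
      constructor
      · intro h
        refine ⟨fun i hi' => ?_, by simpa using h i₀ hi⟩
        simpa [hi'.2] using h i hi'.1
      · rintro ⟨h1, h2⟩ i his
        by_cases h : i = i₀
        · subst h
          simpa using h2
        · simpa [h] using h1 i ⟨his, h⟩
    rw [this, Measure.prod_prod, Measure.infinitePi_pi μ fun i _ => ht i, mul_comm,
      Finset.mul_prod_erase s (fun i => μ i (t i)) hi]
  · have : (fun z : (∀ i, X i) × X i₀ => Function.update z.1 i₀ z.2) ⁻¹' (s : Set ι).pi t =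
        ((s : Set ι).pi t) ×ˢ Set.univ := by
      ext ⟨ω, x⟩
      simp only [Set.mem_preimage, Set.mem_pi, Set.mem_prod, Finset.mem_coe, Set.mem_univ, and_true]
      refine forall₂_congr fun i his => ?_
      have h : i ≠ i₀ := fun h => hi (h ▸ his)
      simp [h]
    rw [this, Measure.prod_prod, Measure.infinitePi_pi μ fun i _ => ht i]
    simp

open MeasureTheory in
theorem lintegral_infinitePi_update {ι : Type*} [DecidableEq ι] {X : ι → Type*}
    [∀ i, MeasurableSpace (X i)] (μ : ∀ i, Measure (X i)) [∀ i, IsProbabilityMeasure (μ i)]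
    (i₀ : ι) {f : (∀ i, X i) → ENNReal} (hf : Measurable f) :
    ∫⁻ ω, f ω ∂Measure.infinitePi μ =
      ∫⁻ ω, ∫⁻ x, f (Function.update ω i₀ x) ∂μ i₀ ∂Measure.infinitePi μ := by
  have hm : Measurable fun z : (∀ i, X i) × X i₀ => Function.update z.1 i₀ z.2 :=
    measurable_update'
  conv_lhs => rw [← map_update_infinitePi μ i₀]
  rw [lintegral_map hf hm, lintegral_prod (fun z : (∀ i, X i) × X i₀ => f (Function.update z.1 i₀ z.2))
    (hf.comp hm).aemeasurable]

/-- Outcomes of the coins in `Option κ`, put together from outcomes of the coin `none` and outcomes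
of the other coins. -/
def joinCoins {κ : Type} (z : (ℕ → ℕ) × (ℕ × κ → ℕ)) : ℕ × Option κ → ℕ
  | (t, none) => z.1 t
  | (t, some c) => z.2 (t, c)

theorem measurable_joinCoins {κ : Type} : Measurable (joinCoins (κ := κ)) := by
  rw [measurable_pi_iff]
  rintro ⟨t, _ | c⟩
  · exact (measurable_pi_apply t).comp measurable_fst
  · exact (measurable_pi_apply (t, c)).comp measurable_snd

-- The coordinates of a finite box split into those of coin `none` and the others, and the product
-- of the side measures factors accordingly. This prepares for Fubini, with the outcomes of the game
-- coin fixed first.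
open MeasureTheory in
theorem map_joinCoins {κ : Type} (μ : Option κ → Measure ℕ) [∀ c, IsProbabilityMeasure (μ c)] :
    ((Measure.infinitePi fun _ : ℕ => μ none).prod
      (Measure.infinitePi fun i : ℕ × κ => μ (some i.2))).map joinCoins =
      Measure.infinitePi fun i : ℕ × Option κ => μ i.2 := by
  classical
  refine Measure.eq_infinitePi _ fun s t ht => ?_
  rw [Measure.map_apply measurable_joinCoins (.pi s.countable_toSet fun i _ => ht i)]
  have i0 : Function.Injective fun n : ℕ => (n, (none : Option κ)) := fun a b h => by simpa using h
  have i1 : Function.Injective fun i : ℕ × κ => (i.1, some i.2) := fun a b h => by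
    simpa [Prod.ext_iff] using h
  set s0 := s.preimage _ i0.injOn with hs0
  set s1 := s.preimage _ i1.injOn with hs1
  have : joinCoins ⁻¹' (s : Set (ℕ × Option κ)).pi t =
      ((s0 : Set ℕ).pi fun n => t (n, none)) ×ˢ
        ((s1 : Set (ℕ × κ)).pi fun i => t (i.1, some i.2)) := by
    ext ⟨g, ω⟩
    simp only [Set.mem_preimage, Set.mem_pi, Finset.mem_coe, Set.mem_prod, hs0, hs1,
      Finset.mem_preimage]
    constructor
    · exact fun h => ⟨fun n hn => h _ hn, fun i hi => h _ hi⟩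
    · rintro ⟨h0, h1⟩ ⟨n, _ | c⟩ hi
      · exact h0 n hi
      · exact h1 (n, c) hi
  rw [this, Measure.prod_prod, Measure.infinitePi_pi _ fun i _ => ht _,
    Measure.infinitePi_pi _ fun i _ => ht _, hs0, hs1,
    Finset.prod_preimage' _ s i0.injOn fun i => μ i.2 (t i),
    Finset.prod_preimage' _ s i1.injOn fun i => μ i.2 (t i),
    ← Finset.prod_filter_mul_prod_filter_not s
      (fun i => i ∈ Set.range fun n : ℕ => (n, (none : Option κ)))]
  congr 2
  ext ⟨n, _ | c⟩ <;> simp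

/-! ### Effects of decisions, dependence of runs on coins, measurability -/

namespace Algorithm

variable {n : ℕ} {σ : Signature} {In Out : Type} {A : Algorithm n σ In Out} {B : Objects n σ}

namespace Config

@[simp] theorem setStatus_hist (C : A.Config B) (p : Fin n) (s : Status σ A.State Out) :
    (C.setStatus p s).hist = C.hist := rfl

@[simp] theorem setStatus_status (C : A.Config B) (p : Fin n) (s : Status σ A.State Out) :
    (C.setStatus p s).status = Function.update C.status p s := rfl

@[simp] theorem setStatus_steps (C : A.Config B) (p : Fin n) (s : Status σ A.State Out) :
    (C.setStatus p s).steps = Function.update C.steps p (C.steps p + 1) := rfl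

@[simp] theorem addEvent_status (C : A.Config B) (i : σ.Name)
    (e : Event n (σ.Op i) (σ.Res i) (B i).Internal) : (C.addEvent i e).status = C.status := rfl

@[simp] theorem addEvent_steps (C : A.Config B) (i : σ.Name)
    (e : Event n (σ.Op i) (σ.Res i) (B i).Internal) : (C.addEvent i e).steps = C.steps := rfl

@[simp] theorem addEvent_hist_self (C : A.Config B) (i : σ.Name)
    (e : Event n (σ.Op i) (σ.Res i) (B i).Internal) :
    (C.addEvent i e).hist i = C.hist i ++ [e] := by
  simp [addEvent]

theorem addEvent_hist_of_ne (C : A.Config B) {i j : σ.Name} (h : j ≠ i)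
    (e : Event n (σ.Op i) (σ.Res i) (B i).Internal) : (C.addEvent i e).hist j = C.hist j := by
  simp [addEvent, h]

@[simp] theorem exec_status (C : A.Config B) (v : A.Coin → ℕ) (d : Decision n σ B) :
    (C.exec v d).status = (C.effect v d).status := rfl

@[simp] theorem exec_hist (C : A.Config B) (v : A.Coin → ℕ) (d : Decision n σ B) :
    (C.exec v d).hist = (C.effect v d).hist := rfl

@[simp] theorem exec_steps (C : A.Config B) (v : A.Coin → ℕ) (d : Decision n σ B) :
    (C.exec v d).steps = (C.effect v d).steps := rfl

@[simp] theorem exec_log (C : A.Config B) (v : A.Coin → ℕ) (d : Decision n σ B) :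
    (C.exec v d).log = (d, C.outcome v d) :: C.log := rfl

/-- The possible effects of a decision. -/
inductive Move (C : A.Config B) (v : A.Coin → ℕ) (d : Decision n σ B) : A.Config B → Prop
  | stay : Move C v d C
  | invoke (p s i op k) (hs : C.status p = .ready s) (hn : A.next p s = .invoke i op k)
      (hm : C.hist i ++ [.inv p op] ∈ (B i).histories) :
      Move C v d ((C.addEvent i (.inv p op)).setStatus p (.waiting i k))
  | flip (p s c k) (hs : C.status p = .ready s) (hn : A.next p s = .flip c k) (hd : d = .step p) :
      Move C v d (C.setStatus p (.ready (k (v c))))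
  | ret (p s y) (hs : C.status p = .ready s) (hn : A.next p s = .ret y) :
      Move C v d (C.setStatus p (.returned y))
  | again (p y) (hs : C.status p = .returned y) : Move C v d (C.setStatus p (.returned y))
  | respond (p i k r) (hs : C.status p = .waiting i k)
      (hm : C.hist i ++ [.res p r] ∈ (B i).histories) :
      Move C v d ((C.addEvent i (.res p r)).setStatus p (.ready (k r)))
  | internal (i e) (hm : C.hist i ++ [.tau e] ∈ (B i).histories) :
      Move C v d (C.addEvent i (.tau e))

theorem effect_step_invoke {C : A.Config B} {v : A.Coin → ℕ} {p s i op k}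
    (hs : C.status p = .ready s) (hn : A.next p s = .invoke i op k)
    (hm : C.hist i ++ [.inv p op] ∈ (B i).histories) :
    C.effect v (.step p) = (C.addEvent i (.inv p op)).setStatus p (.waiting i k) := by
  simp only [effect, hs, hn, if_pos hm]

theorem effect_step_invoke_of_notMem {C : A.Config B} {v : A.Coin → ℕ} {p s i op k}
    (hs : C.status p = .ready s) (hn : A.next p s = .invoke i op k)
    (hm : C.hist i ++ [.inv p op] ∉ (B i).histories) : C.effect v (.step p) = C := by
  simp only [effect, hs, hn, if_neg hm]

theorem effect_step_ret {C : A.Config B} {v : A.Coin → ℕ} {p s y}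
    (hs : C.status p = .ready s) (hn : A.next p s = .ret y) :
    C.effect v (.step p) = C.setStatus p (.returned y) := by
  simp only [effect, hs, hn]

theorem effect_step_flip {C : A.Config B} {v : A.Coin → ℕ} {p s c k}
    (hs : C.status p = .ready s) (hn : A.next p s = .flip c k) :
    C.effect v (.step p) = C.setStatus p (.ready (k (v c))) := by
  simp only [effect, hs, hn]

theorem effect_step_returned {C : A.Config B} {v : A.Coin → ℕ} {p y}
    (hs : C.status p = .returned y) :
    C.effect v (.step p) = C.setStatus p (.returned y) := by
  simp only [effect, hs]

theorem effect_step_waiting {C : A.Config B} {v : A.Coin → ℕ} {p i k}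
    (hs : C.status p = .waiting i k) : C.effect v (.step p) = C := by
  simp only [effect, hs]

theorem effect_respond {C : A.Config B} {v : A.Coin → ℕ} {p i k r}
    (hs : C.status p = .waiting i k) (hm : C.hist i ++ [.res p r] ∈ (B i).histories) :
    C.effect v (.respond p i r) = (C.addEvent i (.res p r)).setStatus p (.ready (k r)) := by
  simp only [effect, hs, if_pos hm, dif_pos]

/-- Invariants of runs are checked against the cases of `Move`, in which all decisions without
effect have merged into `stay`. -/
theorem move_effect (C : A.Config B) (v : A.Coin → ℕ) (d : Decision n σ B) :
    C.Move v d (C.effect v d) := by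
  cases d with
  | step p =>
    rcases hs : C.status p with s | ⟨i, k⟩ | y
    · rcases hn : A.next p s with ⟨i, op, k⟩ | ⟨c, k⟩ | y
      · simp only [effect, hs, hn]
        split_ifs with hm
        · exact .invoke p s i op k hs hn hm
        · exact .stay
      · simp only [effect, hs, hn]
        exact .flip p s c k hs hn rfl
      · simp only [effect, hs, hn]
        exact .ret p s y hs hn
    · simp only [effect, hs]
      exact .stay
    · simp only [effect, hs]
      exact .again p y hs
  | respond p i r =>
    rcases hs : C.status p with s | ⟨j, k⟩ | y
    · simp only [effect, hs]
      exact .stay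
    · simp only [effect, hs]
      split_ifs with h hm
      · subst h
        exact .respond p i k r hs hm
      · exact .stay
      · exact .stay
    · simp only [effect, hs]
      exact .stay
  | internal i e =>
    simp only [effect]
    split_ifs with hm
    · exact .internal i e hm
    · exact .stay
  | idle => exact .stay

/-- Carrying out the decision `d` in the configuration `C` flips the coin `c`. -/
def Flips (C : A.Config B) (d : Decision n σ B) (c : A.Coin) : Prop :=
  ∃ p s k, d = .step p ∧ C.status p = .ready s ∧ A.next p s = .flip c k

theorem exec_congr {C : A.Config B} {v v' : A.Coin → ℕ} {d : Decision n σ B}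
    (h : ∀ c, C.Flips d c → v c = v' c) : C.exec v d = C.exec v' d := by
  have key : C.effect v d = C.effect v' d ∧ C.outcome v d = C.outcome v' d := by
    cases d with
    | step p =>
      rcases hs : C.status p with s | ⟨i, k⟩ | y
      · rcases hn : A.next p s with ⟨i, op, k⟩ | ⟨c, k⟩ | y
        · simp [effect, outcome, hs, hn]
        · have := h c ⟨p, s, k, rfl, hs, hn⟩
          simp [effect, outcome, hs, hn, this]
        · simp [effect, outcome, hs, hn]
      · simp [effect, outcome, hs]
      · simp [effect, outcome, hs]
    | respond p i r => exact ⟨rfl, rfl⟩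
    | internal i e => exact ⟨rfl, rfl⟩
    | idle => exact ⟨rfl, rfl⟩
  simp only [exec, key]

theorem Flips.unique {C : A.Config B} {d : Decision n σ B} {c c' : A.Coin} (h : C.Flips d c)
    (h' : C.Flips d c') : c = c' := by
  obtain ⟨p, s, k, rfl, hs, hn⟩ := h
  obtain ⟨p', s', k', hp, hs', hn'⟩ := h'
  obtain rfl : p = p' := by injection hp
  obtain rfl : s = s' := by simpa [hs] using hs'
  rw [hn] at hn'
  injection hn'

/-- A decision flips at most one coin, so for given `C` and `d` there are only countably many next
configurations, however many coins there are. -/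
theorem exec_factors (C : A.Config B) (d : Decision n σ B) :
    ∃ F : ℕ → A.Config B, (∃ c, ∀ v, C.exec v d = F (v c)) ∨ ∀ v, C.exec v d = F 0 := by
  by_cases h : ∃ c, C.Flips d c
  · obtain ⟨c, hc⟩ := h
    refine ⟨fun m => C.exec (fun _ => m) d, .inl ⟨c, fun v => exec_congr fun c' hc' => ?_⟩⟩
    rw [hc.unique hc']
  · exact ⟨fun m => C.exec (fun _ => m) d, .inr fun v => exec_congr fun c' hc' => absurd ⟨c', hc'⟩ h⟩

end Config

variable (x : Fin n → In) (S : A.Adversary B)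

/-- The log serves as a clock: an adversary is a function of the configuration alone and reads the
time from it. -/
theorem run_log_length (ω : ℕ × A.Coin → ℕ) (t : ℕ) : (A.run B x S ω t).log.length = t := by
  induction t with
  | zero => rfl
  | succ t ih => simp [run, ih]

/-- The configuration at time `t` depends on the random choices made before time `t`. -/
theorem run_congr {ω ω' : ℕ × A.Coin → ℕ} {t : ℕ} (h : ∀ s c, s < t → ω (s, c) = ω' (s, c)) :
    A.run B x S ω t = A.run B x S ω' t := by
  induction t with
  | zero => rfl
  | succ t ih =>
    simp only [run]
    rw [ih fun s c hs => h s c (hs.trans (Nat.lt_succ_self t))]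
    exact Config.exec_congr fun c _ => h t c (Nat.lt_succ_self t)

/-- The type of configurations may be uncountable, but against a fixed adversary only countably many
are reachable at time `t`, each on a measurable set of outcomes. Hence every property of the
configuration at time `t` is measurable. -/
theorem countable_run_and_measurableSet (t : ℕ) : ∃ K : Set (A.Config B), K.Countable ∧
    (∀ ω, A.run B x S ω t ∈ K) ∧ ∀ C, MeasurableSet {ω | A.run B x S ω t = C} := by
  induction t with
  | zero => exact ⟨{A.initial B x}, Set.countable_singleton _, fun ω => rfl, fun C => by simp [run]⟩
  | succ t ih =>
    obtain ⟨K, hK, hmem, hmeas⟩ := ih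
    choose F hF using fun C : A.Config B => C.exec_factors (S C)
    refine ⟨⋃ C ∈ K, Set.range (F C), hK.biUnion fun C _ => Set.countable_range _, fun ω => ?_,
      fun D => ?_⟩
    · refine Set.mem_biUnion (hmem ω) ?_
      simp only [run]
      rcases hF (A.run B x S ω t) with ⟨c, h⟩ | h
      · exact ⟨_, (h _).symm⟩
      · exact ⟨_, (h _).symm⟩
    · have : {ω | A.run B x S ω (t + 1) = D} = ⋃ C ∈ K, {ω | A.run B x S ω t = C} ∩
          {ω | C.exec (fun c => ω (t, c)) (S C) = D} := by
        ext ω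
        simp only [Set.mem_ofPred_eq, Set.mem_iUnion, Set.mem_inter_iff, exists_prop, run]
        constructor
        · exact fun h => ⟨_, hmem ω, rfl, h⟩
        · rintro ⟨C, -, rfl, h⟩
          exact h
      rw [this]
      refine .biUnion hK fun C _ => (hmeas C).inter ?_
      rcases hF C with ⟨c, h⟩ | h
      · simp only [h]
        have h1 : Measurable fun ω : ℕ × A.Coin → ℕ => ω (t, c) := measurable_pi_apply _
        exact h1 (MeasurableSet.of_discrete (s := {m | F C m = D}))
      · simp only [h]
        exact .const _

theorem measurableSet_run (t : ℕ) (Q : A.Config B → Prop) :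
    MeasurableSet {ω | Q (A.run B x S ω t)} := by
  obtain ⟨K, hK, hmem, hmeas⟩ := countable_run_and_measurableSet x S t
  have : {ω | Q (A.run B x S ω t)} = ⋃ C ∈ K ∩ {C | Q C}, {ω | A.run B x S ω t = C} := by
    ext ω
    simp only [Set.mem_ofPred_eq, Set.mem_iUnion, exists_prop, Set.mem_inter_iff]
    constructor
    · exact fun h => ⟨_, ⟨hmem ω, h⟩, rfl⟩
    · rintro ⟨C, ⟨-, h⟩, rfl⟩
      exact h
  rw [this]
  exact .biUnion (hK.mono Set.inter_subset_left) fun C _ => hmeas C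

theorem measurable_comp_run {β : Type*} [MeasurableSpace β] (t : ℕ) (f : A.Config B → β) :
    Measurable fun ω => f (A.run B x S ω t) := fun s _ =>
  measurableSet_run x S t fun C => f C ∈ s

/-- An invariant of all runs. -/
theorem run_induction {P : A.Config B → Prop} (h0 : P (A.initial B x))
    (hs : ∀ C v d, P C → P (Config.exec C v d)) (ω : ℕ × A.Coin → ℕ) (t : ℕ) :
    P (A.run B x S ω t) := by
  induction t with
  | zero => exact h0
  | succ t ih => exact hs _ _ _ ih

theorem steps_le_succ (C : A.Config B) (v : A.Coin → ℕ) (d : Decision n σ B) (p : Fin n) :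
    C.steps p ≤ (C.exec v d).steps p := by
  rw [Config.exec_steps]
  have := C.move_effect v d
  generalize C.effect v d = C' at this
  have aux : ∀ q, C.steps p ≤ Function.update C.steps q (C.steps q + 1) p := fun q => by
    rcases eq_or_ne p q with rfl | h
    · simp
    · simp [h]
  cases this <;> simp [aux]

theorem steps_mono (ω : ℕ × A.Coin → ℕ) (p : Fin n) :
    Monotone fun t => (A.run B x S ω t).steps p :=
  monotone_nat_of_le_succ fun _ => steps_le_succ _ _ _ _

theorem returned_exec {C : A.Config B} {p : Fin n} {y : Out} (h : C.status p = .returned y)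
    (v : A.Coin → ℕ) (d : Decision n σ B) : (C.exec v d).status p = .returned y := by
  rw [Config.exec_status]
  have := C.move_effect v d
  generalize C.effect v d = C' at this
  cases this <;> simp_all [Function.update_apply] <;> grind

theorem returned_of_le {ω : ℕ × A.Coin → ℕ} {p : Fin n} {y : Out} {s t : ℕ} (hst : s ≤ t)
    (h : (A.run B x S ω s).status p = .returned y) : (A.run B x S ω t).status p = .returned y := by
  induction hst with
  | refl => exact h
  | step _ ih => exact returned_exec ih _ _

theorem hist_prefix_exec (C : A.Config B) (v : A.Coin → ℕ) (d : Decision n σ B) (i : σ.Name) :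
    C.hist i <+: (C.exec v d).hist i := by
  rw [Config.exec_hist]
  have := C.move_effect v d
  generalize C.effect v d = C' at this
  have aux : ∀ j e, C.hist i <+: (C.addEvent j e).hist i := fun j e => by
    rcases eq_or_ne i j with rfl | h
    · simp
    · rw [Config.addEvent_hist_of_ne C h]
  cases this <;> simp [aux]

end Algorithm

/-! ### A game that precedes the algorithm -/

namespace CoinGame

variable {n : ℕ} {σ : Signature} {In Out : Type}

/-- Values of the registers: nothing, or a bit that belongs to a round. -/
abbrev Val : Type := Option (ℕ × Bool)

/-- The local phases of a round. Process `0` runs through `write0`, `flip`, `check`, process `1`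
through `write1`, `listen`, process `2` through `read1`, `read2`, `announce`, and all other
processes only `listen`. -/
inductive Phase where
  | write0
  | flip
  | check (c : Bool)
  | write1
  | listen
  | read1
  | read2 (v : Val)
  | announce (b : Bool)

/-- The phase in which process `p` starts a round. -/
def start (p : Fin n) : Phase :=
  match p.val with
  | 0 => .write0
  | 1 => .write1
  | 2 => .read1
  | _ => .listen

/-- The interface with the three registers. -/
abbrev sig (σ : Signature) : Signature where
  Name := σ.Name ⊕ Fin 3
  Op
    | .inl i => σ.Op i
    | .inr _ => RegOp Val
  Res
    | .inl i => σ.Res i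
    | .inr _ => RegRes Val

/-- The objects `B` together with the three registers. -/
abbrev withRegs (B : Objects n σ) (R : Fin 3 → SharedObject n (RegOp Val) (RegRes Val)) :
    Objects n (sig σ)
  | .inl i => B i
  | .inr i => R i

/-- Local states: the input, the round and the phase, or a state of the algorithm `A` after the
game. -/
abbrev State (A : Algorithm n σ In Out) : Type := (In × ℕ × Phase) ⊕ A.State

/-- A step of `A`, executed after the game. -/
def liftAction (A : Algorithm n σ In Out) :
    ProcessAction σ A.Coin A.State Out → ProcessAction (sig σ) (Option A.Coin) (State A) Out
  | .invoke i op k => .invoke (.inl i) op fun r => .inr (k r)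
  | .flip c k => .flip (some c) fun m => .inr (k m)
  | .ret y => .ret y

variable (A : Algorithm n σ In Out) (p : Fin n) (a : In) (j : ℕ)

/-- What process `0` does with the value it reads in the phase `check c`. -/
def afterCheck (c : Bool) : RegRes Val → State A
  | .ack => .inl (a, j, .check c)
  | .val v => if v = some (j, c) then .inl (a, j + 1, start p) else .inr (A.init p a)

/-- What a process does with the value it reads in the phase `listen`. -/
def afterListen : RegRes Val → State A
  | .ack => .inl (a, j, .listen)
  | .val v => if v.map Prod.fst = some j then .inl (a, j + 1, start p) else .inr (A.init p a)

/-- What process `2` does with the value it reads in the phase `read1`. -/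
def afterRead1 : RegRes Val → State A
  | .ack => .inl (a, j, .read1)
  | .val v => .inl (a, j, .read2 v)

/-- What process `2` does with the value it reads in the phase `read2 v`. -/
def afterRead2 (v : Val) : RegRes Val → State A
  | .ack => .inl (a, j, .read2 v)
  | .val w =>
    if v = some (j, false) ∧ w = some (j, true) then .inl (a, j, .announce false)
    else if v = some (j, true) ∧ w = some (j, false) then .inl (a, j, .announce true)
    else .inr (A.init p a)

/-- The steps of the game. -/
def gameNext : Phase → ProcessAction (sig σ) (Option A.Coin) (State A) Out
  | .write0 => .invoke (.inr 0) (RegOp.write (some (j, false))) fun _ => .inl (a, j, .flip)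
  | .flip => .flip none fun m => .inl (a, j, .check (decide (m = 1)))
  | .check c => .invoke (.inr 1) (RegOp.read (V := Val)) (afterCheck A p a j c)
  | .write1 => .invoke (.inr 0) (RegOp.write (some (j, true))) fun _ => .inl (a, j, .listen)
  | .listen => .invoke (.inr 1) (RegOp.read (V := Val)) (afterListen A p a j)
  | .read1 => .invoke (.inr 0) (RegOp.read (V := Val)) (afterRead1 A a j)
  | .read2 v => .invoke (.inr 0) (RegOp.read (V := Val)) (afterRead2 A p a j v)
  | .announce b => .invoke (.inr 1) (RegOp.write (some (j, b))) fun _ => .inl (a, j + 1, start p)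

/-- A fair coin with outcomes `0` and `1`. -/
noncomputable def fairCoin : PMF ℕ := (PMF.uniformOfFintype Bool).map fun b => b.toNat

/-- The algorithm `A`, preceded by the game. -/
noncomputable abbrev withGame : Algorithm n (sig σ) In Out where
  State := State A
  Coin := Option A.Coin
  law
    | none => fairCoin
    | some c => A.law c
  init p a := .inl (a, 0, start p)
  next p s :=
    match s with
    | .inl (a, j, ph) => gameNext A p a j ph
    | .inr s => liftAction A (A.next p s)

/-! ### Projection to runs of the algorithm without the game -/

variable {B : Objects n σ} {R : Fin 3 → SharedObject n (RegOp Val) (RegRes Val)}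

variable {A} in
/-- The state of `A` that corresponds to a local state: during the game, `A` has not started. -/
def toA (p : Fin n) : State A → A.State
  | .inl (a, _, _) => A.init p a
  | .inr s => s

variable {A} in
/-- The status in `A` that corresponds to a status. -/
def projStatus (p : Fin n) : Status (sig σ) (State A) Out → Status σ A.State Out
  | .ready s => .ready (toA p s)
  | .waiting (.inl i) k => .waiting i fun r => toA p (k r)
  | .waiting (.inr _) k => .ready (toA p (k (RegRes.ack (V := Val))))
  | .returned y => .returned y

/-- Configurations of the algorithm with the game. -/
abbrev Cfg (B : Objects n σ) (R : Fin 3 → SharedObject n (RegOp Val) (RegRes Val)) : Type :=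
  (withGame A).Config (withRegs B R)

variable {A} in
/-- The decision of an adversary against `A` that corresponds to a decision: steps of the game become
idle. -/
def projDecision (C : Cfg A B R) : Decision n (sig σ) (withRegs B R) → Decision n σ B
  | .step p =>
    match C.status p with
    | .ready (.inl _) => .idle
    | .waiting _ _ => .idle
    | _ => .step p
  | .respond p (.inl i) r => .respond p i r
  | .respond _ (.inr _) _ => .idle
  | .internal (.inl i) e => .internal i e
  | .internal (.inr _) _ => .idle
  | .idle => .idle

variable {A} in
/-- `C` is the configuration of `A` that corresponds to `C'`, apart from the numbers of steps. -/
structure Projects (C' : Cfg A B R) (C : A.Config B) : Prop where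
  status : ∀ p, C.status p = projStatus p (C'.status p)
  hist : ∀ i, C.hist i = C'.hist (.inl i)

variable {A} in
/-- Pending register operations do not change the corresponding state of `A`, and pending operations
on base objects are those of `A`. -/
def WaitOK (C : Cfg A B R) : Prop :=
  (∀ p i k, C.status p = .waiting (.inr i) k → ∀ r, toA p (k r) = toA p (k (RegRes.ack (V := Val)))) ∧
  ∀ p i k, C.status p = .waiting (.inl i) k → ∀ r, ∃ s, k r = .inr s

variable {A} in
/-- Process `p` has finished the game. -/
def Left (C : Cfg A B R) (p : Fin n) : Prop :=
  (∃ s, C.status p = .ready (.inr s)) ∨ (∃ i k, C.status p = .waiting (.inl i) k) ∨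
    ∃ y, C.status p = .returned y

variable {A}

/-- Whatever a register responds, the process is then in the game with the same input or in the
initial state of `A`, and both project to `A.init p a`. Register responses are thus invisible in the
projected run. -/
theorem toA_after {p : Fin n} {a : In} {j : ℕ} {ph : Phase} {i op k}
    (h : gameNext A p a j ph = .invoke i op k) (r) : toA p (k r) = A.init p a := by
  cases ph <;> cases h
  all_goals
    first
    | rfl
    | (rcases r with _ | v <;> simp only [afterCheck, afterListen, afterRead1, afterRead2] <;>
        (try split_ifs) <;> rfl)

theorem gameNext_invoke_inr {p : Fin n} {a : In} {j : ℕ} {ph : Phase} {i op k} :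
    gameNext A p a j ph ≠ .invoke (.inl i) op k := by
  intro h
  cases ph <;> cases h

theorem WaitOK.setStatus {C : Cfg A B R} (h : WaitOK C) {C' : Cfg A B R} {p : Fin n} {s}
    (hC : C'.status = Function.update C.status p s)
    (h1 : ∀ i k, s = .waiting (.inr i) k → ∀ r, toA p (k r) = toA p (k (RegRes.ack (V := Val))))
    (h2 : ∀ i k, s = .waiting (.inl i) k → ∀ r, ∃ s, k r = .inr s) : WaitOK C' := by
  constructor
  · intro q i k hq
    rw [hC, Function.update_apply] at hq
    split_ifs at hq with hqp
    · subst hqp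
      exact h1 i k hq
    · exact h.1 q i k hq
  · intro q i k hq
    rw [hC, Function.update_apply] at hq
    split_ifs at hq with hqp
    · exact h2 i k hq
    · exact h.2 q i k hq

theorem waitOK_exec (C : Cfg A B R) (v : Option A.Coin → ℕ) (d) (h : WaitOK C) :
    WaitOK (C.exec v d) := by
  suffices H : ∀ C' : Cfg A B R, C.Move v d C' → WaitOK C' from H (C.effect v d) (C.move_effect v d)
  intro C' hC
  cases hC with
  | stay => exact h
  | invoke p s i op k hs hn hm =>
    refine h.setStatus (p := p) (by rfl) ?_ ?_
    · rintro i' k' hk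
      cases hk
      rcases s with ⟨a, j, ph⟩ | s
      · intro r
        rw [toA_after hn, toA_after hn]
      · exfalso
        change liftAction A (A.next p s) = _ at hn
        rcases hA : A.next p s with ⟨i, op, k⟩ | ⟨c, k⟩ | y <;> rw [hA] at hn <;> cases hn
    · rintro i' k' hk
      cases hk
      rcases s with ⟨a, j, ph⟩ | s
      · exact absurd hn gameNext_invoke_inr
      · change liftAction A (A.next p s) = _ at hn
        rcases hA : A.next p s with ⟨i, op, k⟩ | ⟨c, k⟩ | y <;> rw [hA] at hn <;> cases hn
        exact fun r => ⟨_, rfl⟩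
  | flip p s c k hs hn => exact h.setStatus (p := p) (by rfl) (by simp) (by simp)
  | ret p s y hs hn => exact h.setStatus (p := p) (by rfl) (by simp) (by simp)
  | again p y hs => exact h.setStatus (p := p) (by rfl) (by simp) (by simp)
  | respond p i k r hs hm => exact h.setStatus (p := p) (by rfl) (by simp) (by simp)
  | internal i e hm => exact h

theorem waitOK_initial (x : Fin n → In) : WaitOK ((withGame A).initial (withRegs B R) x) :=
  ⟨by simp [Algorithm.initial], by simp [Algorithm.initial]⟩

theorem projects_initial (x : Fin n → In) :
    Projects ((withGame A).initial (withRegs B R) x) (A.initial B x) :=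
  ⟨fun _ => rfl, fun _ => rfl⟩

/-- One step of the simulation. -/
structure SimStep (C₁' C₂' : Cfg A B R) (C₁ C₂ : A.Config B) : Prop where
  projects : Projects C₂' C₂
  steps : ∀ q, Left C₁' q → Left C₂' q ∧ C₂'.steps q + C₁.steps q = C₁'.steps q + C₂.steps q

theorem SimStep.refl {C' : Cfg A B R} {C : A.Config B} (h : Projects C' C) : SimStep C' C' C C :=
  ⟨h, fun _ hq => ⟨hq, rfl⟩⟩

/-- A step of a process after the game. -/
theorem SimStep.both {C₁' C₂' : Cfg A B R} {C₁ C₂ : A.Config B} (h : Projects C₁' C₁) {p : Fin n}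
    {s' : Status (sig σ) (State A) Out} {s : Status σ A.State Out}
    (h1 : C₂'.status = Function.update C₁'.status p s')
    (h2 : C₂.status = Function.update C₁.status p s) (hs : s = projStatus p s')
    (h3 : C₂'.steps = Function.update C₁'.steps p (C₁'.steps p + 1))
    (h4 : C₂.steps = Function.update C₁.steps p (C₁.steps p + 1))
    (h5 : ∀ i, C₂.hist i = C₂'.hist (.inl i))
    (h6 : (∃ s, s' = .ready (.inr s)) ∨ (∃ i k, s' = .waiting (.inl i) k) ∨ ∃ y, s' = .returned y) :
    SimStep C₁' C₂' C₁ C₂ := by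
  refine ⟨⟨fun q => ?_, h5⟩, fun q hq => ?_⟩
  · rw [h1, h2]
    rcases eq_or_ne q p with rfl | hqp
    · simpa using hs
    · simpa [hqp] using h.status q
  · rw [Left, h1, h3, h4]
    rcases eq_or_ne q p with rfl | hqp
    · simpa using ⟨h6, by omega⟩
    · simp only [ne_eq, hqp, not_false_eq_true, Function.update_of_ne]
      exact ⟨hq, trivial⟩

/-- A step of a process during the game. -/
theorem SimStep.idle {C₁' C₂' : Cfg A B R} {C : A.Config B} (h : Projects C₁' C) {p : Fin n}
    {s' : Status (sig σ) (State A) Out} (h1 : C₂'.status = Function.update C₁'.status p s')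
    (hs : C.status p = projStatus p s') (hl : ¬ Left C₁' p)
    (h3 : C₂'.steps = Function.update C₁'.steps p (C₁'.steps p + 1))
    (h5 : ∀ i, C₂'.hist (.inl i) = C₁'.hist (.inl i)) : SimStep C₁' C₂' C C := by
  refine ⟨⟨fun q => ?_, fun i => (h.hist i).trans (h5 i).symm⟩, fun q hq => ?_⟩
  · rw [h1]
    rcases eq_or_ne q p with rfl | hqp
    · simpa using hs
    · simpa [hqp] using h.status q
  · have hqp : q ≠ p := fun hqp => hl (hqp ▸ hq)
    rw [Left, h1, h3]
    simp only [ne_eq, hqp, not_false_eq_true, Function.update_of_ne]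
    exact ⟨hq, trivial⟩

theorem addEvent_hist_inl (C : Cfg A B R) {C₁ : A.Config B} (h : Projects C C₁) (i : σ.Name)
    (e : Event n (σ.Op i) (σ.Res i) (B i).Internal) (j : σ.Name) :
    (C₁.addEvent i e).hist j = (C.addEvent (.inl i) e).hist (.inl j) := by
  rcases eq_or_ne j i with rfl | hji
  · rw [Algorithm.Config.addEvent_hist_self, h.hist]
    exact (Algorithm.Config.addEvent_hist_self C (Sum.inl j) e).symm
  · rw [Algorithm.Config.addEvent_hist_of_ne _ hji, h.hist]
    exact (Algorithm.Config.addEvent_hist_of_ne C (fun h' => hji (Sum.inl.inj h')) _).symm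

theorem addEvent_inr_hist (C : Cfg A B R) (i : Fin 3)
    (e : Event n (RegOp Val) (RegRes Val) (R i).Internal) (j : σ.Name) :
    (C.addEvent (.inr i) e).hist (.inl j) = C.hist (.inl j) :=
  Algorithm.Config.addEvent_hist_of_ne C (i := .inr i) (j := .inl j) (by simp) e

/-- Steps of the game and events of the registers correspond to no step of `A`; all other decisions
are carried out on both sides. They are possible on both or on neither, since the base objects have
the same histories (`hmiff`). -/
theorem simStep_effect {C' : Cfg A B R} {C : A.Config B} (h : Projects C' C) (hw : WaitOK C')
    {v' : Option A.Coin → ℕ} {v : A.Coin → ℕ} (hv : ∀ c, v' (some c) = v c)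
    (d : Decision n (sig σ) (withRegs B R)) :
    SimStep C' (C'.effect v' d) C (C.effect v (projDecision C' d)) := by
  cases d with
  | step p =>
    have hp := h.status p
    rcases hs : C'.status p with (⟨a, j, ph⟩ | s) | ⟨i, k⟩ | y
    · have hl : ¬ Left C' p := by simp [Left, hs]
      have e1 : projDecision C' (.step p) = .idle := by simp [projDecision, hs]
      rw [e1]
      change SimStep C' _ C C
      rw [hs] at hp
      rcases hn : (withGame A).next p (.inl (a, j, ph)) with ⟨i, op, k⟩ | ⟨c, k⟩ | y
      · by_cases hm : C'.hist i ++ [.inv p op] ∈ (withRegs B R i).histories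
        · rw [Algorithm.Config.effect_step_invoke hs hn hm]
          rcases i with i | i
          · exact absurd hn gameNext_invoke_inr
          · refine .idle h (p := p) (s' := .waiting (.inr i) k) rfl ?_ hl rfl fun i' => ?_
            · rw [hp]
              simp only [projStatus]
              rw [toA_after hn]
              rfl
            · exact addEvent_inr_hist C' i _ i'
        · rw [Algorithm.Config.effect_step_invoke_of_notMem hs hn hm]
          exact .refl h
      · rw [Algorithm.Config.effect_step_flip hs hn]
        refine .idle h (p := p) (s' := .ready (k (v' c))) rfl ?_ hl rfl fun _ => rfl
        rw [hp]
        change gameNext A p a j ph = _ at hn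
        cases ph <;> cases hn
        rfl
      · change gameNext A p a j ph = _ at hn
        cases ph <;> cases hn
    · have e1 : projDecision C' (.step p) = .step p := by simp [projDecision, hs]
      rw [e1]
      rw [hs] at hp
      change C.status p = .ready s at hp
      have hn' : (withGame A).next p (.inr s) = liftAction A (A.next p s) := rfl
      rcases hn : A.next p s with ⟨i, op, k⟩ | ⟨c, k⟩ | y
      · rw [hn] at hn'
        have hmiff : (C'.hist (.inl i) ++ [.inv p op] ∈ ((withRegs B R) (.inl i)).histories) ↔
            C.hist i ++ [.inv p op] ∈ (B i).histories := by
          rw [h.hist]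
        by_cases hm : C.hist i ++ [.inv p op] ∈ (B i).histories
        · rw [Algorithm.Config.effect_step_invoke hs hn' (hmiff.2 hm),
            Algorithm.Config.effect_step_invoke hp hn hm]
          refine .both h (p := p) rfl rfl rfl rfl rfl (fun i' => ?_) (.inr (.inl ⟨_, _, rfl⟩))
          exact addEvent_hist_inl C' h i _ i'
        · rw [Algorithm.Config.effect_step_invoke_of_notMem hs hn' (mt hmiff.1 hm),
            Algorithm.Config.effect_step_invoke_of_notMem hp hn hm]
          exact .refl h
      · rw [hn] at hn'
        rw [Algorithm.Config.effect_step_flip hs hn', Algorithm.Config.effect_step_flip hp hn]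
        refine .both h (p := p) rfl rfl ?_ rfl rfl h.hist (.inl ⟨_, rfl⟩)
        rw [hv]
        rfl
      · rw [hn] at hn'
        rw [Algorithm.Config.effect_step_ret hs hn', Algorithm.Config.effect_step_ret hp hn]
        exact .both h (p := p) rfl rfl rfl rfl rfl h.hist (.inr (.inr ⟨_, rfl⟩))
    · have e1 : projDecision C' (.step p) = .idle := by simp [projDecision, hs]
      rw [e1, Algorithm.Config.effect_step_waiting hs]
      exact .refl h
    · have e1 : projDecision C' (.step p) = .step p := by simp [projDecision, hs]
      rw [hs] at hp
      change C.status p = .returned y at hp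
      rw [e1, Algorithm.Config.effect_step_returned hs, Algorithm.Config.effect_step_returned hp]
      exact .both h (p := p) rfl rfl rfl rfl rfl h.hist (.inr (.inr ⟨_, rfl⟩))
  | respond p i r =>
    have hp := h.status p
    rcases hs : C'.status p with s | ⟨i', k⟩ | y
    · have e3 : C'.effect v' (.respond p i r) = C' := by simp only [Algorithm.Config.effect, hs]
      rw [hs] at hp
      rw [e3]
      rcases i with i | i
      · have e2 : C.effect v (.respond p i r) = C := by simp only [Algorithm.Config.effect, hp, projStatus]
        change SimStep C' C' C (C.effect v (.respond p i r))
        rw [e2]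
        exact .refl h
      · exact .refl h
    · rw [hs] at hp
      rcases i with i | i
      · change SimStep C' _ C (C.effect v (.respond p i r))
        rcases i' with i' | i'
        · change C.status p = .waiting i' fun r => toA p (k r) at hp
          by_cases hi : i = i'
          · subst hi
            have hmiff : (C'.hist (.inl i) ++ [.res p r] ∈ ((withRegs B R) (.inl i)).histories) ↔
                C.hist i ++ [.res p r] ∈ (B i).histories := by
              rw [h.hist]
            by_cases hm : C.hist i ++ [.res p r] ∈ (B i).histories
            · rw [Algorithm.Config.effect_respond hs (hmiff.2 hm),
                Algorithm.Config.effect_respond hp hm]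
              refine .both h (p := p) rfl rfl rfl rfl rfl (fun j => ?_) ?_
              · exact addEvent_hist_inl C' h i _ j
              · obtain ⟨s, hs'⟩ := hw.2 p i k hs r
                exact .inl ⟨s, by rw [hs']⟩
            · have e2 : C.effect v (.respond p i r) = C := by
                simp only [Algorithm.Config.effect, hp, if_neg hm, dif_pos]
              have e3 : C'.effect v' (.respond p (.inl i) r) = C' := by
                simp only [Algorithm.Config.effect, hs, if_neg (mt hmiff.1 hm), dif_pos]
              rw [e2, e3]
              exact .refl h
          · have e2 : C.effect v (.respond p i r) = C := by
              simp only [Algorithm.Config.effect, hp, dif_neg hi]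
            have e3 : C'.effect v' (.respond p (.inl i) r) = C' := by
              simp only [Algorithm.Config.effect, hs, dif_neg (mt Sum.inl.inj hi)]
            rw [e2, e3]
            exact .refl h
        · have e2 : C.effect v (.respond p i r) = C := by
            simp only [Algorithm.Config.effect, hp, projStatus]
          have e3 : C'.effect v' (.respond p (.inl i) r) = C' := by
            simp [Algorithm.Config.effect, hs]
          rw [e2, e3]
          exact .refl h
      · change SimStep C' _ C C
        by_cases hi : (Sum.inr i : (sig σ).Name) = i'
        · subst hi
          by_cases hm : C'.hist (.inr i) ++ [.res p r] ∈ ((withRegs B R) (.inr i)).histories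
          · rw [Algorithm.Config.effect_respond hs hm]
            refine .idle h (p := p) (s' := .ready (k r)) rfl ?_ ?_ rfl fun j => ?_
            · rw [hp]
              simp only [projStatus]
              rw [hw.1 p i k hs r]
            · simp [Left, hs]
            · exact addEvent_inr_hist C' i _ j
          · have e3 : C'.effect v' (.respond p (.inr i) r) = C' := by
              simp only [Algorithm.Config.effect, hs, if_neg hm, dif_pos]
            rw [e3]
            exact .refl h
        · have e3 : C'.effect v' (.respond p (.inr i) r) = C' := by
            simp only [Algorithm.Config.effect, hs, dif_neg hi]
          rw [e3]
          exact .refl h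
    · have e3 : C'.effect v' (.respond p i r) = C' := by simp only [Algorithm.Config.effect, hs]
      rw [hs] at hp
      rw [e3]
      rcases i with i | i
      · have e2 : C.effect v (.respond p i r) = C := by simp only [Algorithm.Config.effect, hp, projStatus]
        change SimStep C' C' C (C.effect v (.respond p i r))
        rw [e2]
        exact .refl h
      · exact .refl h
  | internal i e =>
    rcases i with i | i
    · change SimStep C' _ C (C.effect v (.internal i e))
      have hmiff : (C'.hist (.inl i) ++ [.tau e] ∈ ((withRegs B R) (.inl i)).histories) ↔
          C.hist i ++ [.tau e] ∈ (B i).histories := by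
        rw [h.hist]
      by_cases hm : C.hist i ++ [.tau e] ∈ (B i).histories
      · simp only [Algorithm.Config.effect, if_pos hm, if_pos (hmiff.2 hm)]
        exact ⟨⟨h.status, fun j => addEvent_hist_inl C' h i _ j⟩, fun q hq => ⟨hq, rfl⟩⟩
      · simp only [Algorithm.Config.effect, if_neg hm, if_neg (mt hmiff.1 hm)]
        exact .refl h
    · change SimStep C' _ C C
      simp only [Algorithm.Config.effect]
      split_ifs
      · exact ⟨⟨h.status, fun j => (h.hist j).trans (addEvent_inr_hist C' i _ j).symm⟩,
          fun q hq => ⟨hq, rfl⟩⟩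
      · exact .refl h
  | idle => exact .refl h

/-- A flip of a coin of `A` also takes place in the projected run, so its outcome stands in the log
there and can be recovered from it. -/
theorem outcome_projDecision {C' : Cfg A B R} {C : A.Config B} (h : Projects C' C)
    {v : A.Coin → ℕ} {d : Decision n (sig σ) (withRegs B R)} {c : A.Coin}
    (hd : C'.Flips d (some c)) : C.outcome v (projDecision C' d) = some (v c) := by
  obtain ⟨p, s, k, rfl, hs, hn⟩ := hd
  rcases s with ⟨a, j, ph⟩ | s
  · change gameNext A p a j ph = _ at hn
    cases ph <;> cases hn
  · change liftAction A (A.next p s) = _ at hn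
    have hp := h.status p
    rw [hs] at hp
    change C.status p = .ready s at hp
    have e1 : projDecision C' (.step p) = .step p := by simp [projDecision, hs]
    rw [e1]
    rcases hA : A.next p s with ⟨i, op, k⟩ | ⟨c', k⟩ | y <;> rw [hA] at hn <;> cases hn
    simp [Algorithm.Config.outcome, hp, hA]

/-! ### The simulation -/

variable (x : Fin n → In) (S : (withGame A).Adversary (withRegs B R)) (g : ℕ → ℕ)

/-- The configuration of the algorithm with the game, reconstructed from the log of the run of `A`
and the outcomes of the coin of the game. -/
noncomputable def rebuild : List (Decision n σ B × Option ℕ) → Cfg A B R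
  | [] => (withGame A).initial (withRegs B R) x
  | (_, o) :: l => (rebuild l).exec
      (fun c => match c with
        | none => g l.length
        | some _ => o.getD 0) (S (rebuild l))

/-- The adversary against `A` that simulates `S`. -/
noncomputable def projAdversary : A.Adversary B := fun C =>
  projDecision (rebuild x S g C.log) (S (rebuild x S g C.log))

/-- The two claims support each other: the projection shows that the log contains the outcomes that
`rebuild` needs, and the reconstruction shows that `projAdversary` mirrors the decision of `S`.
Outcomes of the game coin come from `g`, at the time given by the length of the earlier log; the
default `0` in `rebuild` only occurs where no coin of `A` is flipped. -/
theorem rebuild_run (ω : ℕ × A.Coin → ℕ) (t : ℕ) :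
    rebuild x S g (A.run B x (projAdversary x S g) ω t).log =
        (withGame A).run (withRegs B R) x S (joinCoins (g, ω)) t ∧
      Projects ((withGame A).run (withRegs B R) x S (joinCoins (g, ω)) t)
        (A.run B x (projAdversary x S g) ω t) := by
  induction t with
  | zero => exact ⟨rfl, projects_initial x⟩
  | succ t ih =>
    obtain ⟨ih1, ih2⟩ := ih
    have hlen := A.run_log_length (B := B) x (projAdversary x S g) ω t
    have hw := (withGame A).run_induction (B := withRegs B R) x S (waitOK_initial x)
      waitOK_exec (joinCoins (g, ω)) t
    simp only [Algorithm.run]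
    set C := A.run B x (projAdversary x S g) ω t with hC
    set C' := (withGame A).run (withRegs B R) x S (joinCoins (g, ω)) t with hC'
    have hd : projAdversary x S g C = projDecision C' (S C') := by
      rw [projAdversary, ih1]
    constructor
    · rw [Algorithm.Config.exec_log, rebuild, ih1]
      refine Algorithm.Config.exec_congr fun c hc => ?_
      cases c with
      | none =>
        rw [hlen]
        rfl
      | some c =>
        rw [hd, outcome_projDecision ih2 hc]
        rfl
    · rw [hd]
      have := (simStep_effect ih2 hw (v' := fun c => joinCoins (g, ω) (t, c))
        (v := fun c => ω (t, c)) (fun c => rfl) (S C')).projects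
      exact ⟨this.status, this.hist⟩

theorem simStep_run (ω : ℕ × A.Coin → ℕ) (t : ℕ) :
    SimStep ((withGame A).run (withRegs B R) x S (joinCoins (g, ω)) t)
      ((withGame A).run (withRegs B R) x S (joinCoins (g, ω)) (t + 1))
      (A.run B x (projAdversary x S g) ω t) (A.run B x (projAdversary x S g) ω (t + 1)) := by
  obtain ⟨h1, h2⟩ := rebuild_run x S g ω t
  have hw := (withGame A).run_induction (B := withRegs B R) x S (waitOK_initial x)
    waitOK_exec (joinCoins (g, ω)) t
  have hd : projAdversary x S g (A.run B x (projAdversary x S g) ω t) =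
      projDecision ((withGame A).run (withRegs B R) x S (joinCoins (g, ω)) t)
        (S ((withGame A).run (withRegs B R) x S (joinCoins (g, ω)) t)) := by
    rw [projAdversary, h1]
  have := simStep_effect h2 hw (v' := fun c => joinCoins (g, ω) (t, c))
    (v := fun c => ω (t, c)) (fun c => rfl)
    (S ((withGame A).run (withRegs B R) x S (joinCoins (g, ω)) t))
  rw [← hd] at this
  exact ⟨⟨this.projects.status, this.projects.hist⟩, this.steps⟩

theorem outputs_eq {C' : Cfg A B R} {C : A.Config B} (h : Projects C' C) :
    C'.outputs = C.outputs := by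
  funext p
  simp only [Algorithm.Config.outputs, h.status p]
  rcases C'.status p with s | ⟨_ | _, k⟩ | y <;> rfl

theorem joinCoins_surjective {κ : Type} (ω : ℕ × Option κ → ℕ) :
    joinCoins (fun t => ω (t, none), fun i => ω (i.1, some i.2)) = ω := by
  funext i
  rcases i with ⟨t, _ | c⟩ <;> rfl

/-- The outputs are those of the projected run of `A`, obtained by splitting `ω` into the outcomes
of the game coin and of the coins of `A`. -/
theorem withGame_solves (T : DistributedTask n In Out) (h : A.Solves B T) :
    (withGame A).Solves (withRegs B R) T := by
  intro x hx S ω hω t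
  rw [← joinCoins_surjective ω]
  obtain ⟨-, h2⟩ := rebuild_run x S (fun t => ω (t, none)) (fun i => ω (i.1, some i.2)) t
  rw [outputs_eq h2]
  exact h x hx _ _ (fun i => hω (i.1, some i.2)) t

/-- After `p` has left the game, its step counts in the two runs differ by a constant, so infinitely
many steps in one are infinitely many in the other. -/
theorem isCorrect_of_left {ω : ℕ × A.Coin → ℕ} {p : Fin n} {t₀ : ℕ}
    (hl : Left ((withGame A).run (withRegs B R) x S (joinCoins (g, ω)) t₀) p)
    (hc : Algorithm.IsCorrect ((withGame A).run (withRegs B R) x S (joinCoins (g, ω))) p) :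
    Algorithm.IsCorrect (A.run B x (projAdversary x S g) ω) p := by
  have key : ∀ t, t₀ ≤ t → Left ((withGame A).run (withRegs B R) x S (joinCoins (g, ω)) t) p ∧
      ((withGame A).run (withRegs B R) x S (joinCoins (g, ω)) t).steps p ≤
        (A.run B x (projAdversary x S g) ω t).steps p +
          ((withGame A).run (withRegs B R) x S (joinCoins (g, ω)) t₀).steps p := by
    intro t ht
    induction ht with
    | refl => exact ⟨hl, by omega⟩
    | step _ ih =>
      obtain ⟨h1, h2⟩ := (simStep_run x S g ω _).steps p ih.1
      refine ⟨h1, ?_⟩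
      simp only [Nat.succ_eq_add_one]
      omega
  intro N
  obtain ⟨t, ht⟩ := hc (N + ((withGame A).run (withRegs B R) x S (joinCoins (g, ω)) t₀).steps p)
  have hm := (withGame A).steps_mono (B := withRegs B R) x S (joinCoins (g, ω)) p
    (le_max_left t t₀)
  have := (key (max t t₀) (le_max_right _ _)).2
  refine ⟨max t t₀, ?_⟩
  simp only at hm
  omega

-- For each fixed sequence `g` of outcomes of the game coin, the projected run is one of `A` against
-- the single adversary `projAdversary x S g`, to which the almost sure termination of `A` applies.
-- Fubini over `g` concludes.
open MeasureTheory in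
theorem ae_returns_of_left {T : DistributedTask n In Out} (h : A.TerminatesAlmostSurely B T)
    (hx : x ∈ T.legal) : ∀ᵐ ω ∂(withGame A).coinMeasure, ∀ p,
      Algorithm.IsCorrect ((withGame A).run (withRegs B R) x S ω) p →
      (∃ t, Left ((withGame A).run (withRegs B R) x S ω t) p) →
      Algorithm.Returns ((withGame A).run (withRegs B R) x S ω) p := by
  have hprob : ∀ c, IsProbabilityMeasure (((withGame A).law c).toMeasure) := fun c => inferInstance
  have hM : (withGame A).coinMeasure =
      ((Measure.infinitePi fun _ : ℕ => ((withGame A).law none).toMeasure).prod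
        A.coinMeasure).map joinCoins :=
    (map_joinCoins fun c => ((withGame A).law c).toMeasure).symm
  have hmeas : MeasurableSet {ω | ∀ p,
      Algorithm.IsCorrect ((withGame A).run (withRegs B R) x S ω) p →
      (∃ t, Left ((withGame A).run (withRegs B R) x S ω t) p) →
      Algorithm.Returns ((withGame A).run (withRegs B R) x S ω) p} := by
    have m := fun t Q => (withGame A).measurableSet_run (B := withRegs B R) x S t Q
    have m' := fun t Q => measurableSet_setOfPred.1 (m t Q)
    refine measurableSet_setOfPred.2 (.forall fun p => .imp ?_ (.imp ?_ ?_))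
    · exact .forall fun N => .exists fun t => m' t fun C => N ≤ C.steps p
    · exact .exists fun t => m' t fun C => Left C p
    · exact .exists fun t => m' t fun C => ∃ y, C.status p = .returned y
  rw [hM, ae_map_iff measurable_joinCoins.aemeasurable hmeas]
  have : SFinite A.coinMeasure := by
    unfold Algorithm.coinMeasure
    infer_instance
  refine (Measure.ae_prod_iff_ae_ae (measurable_joinCoins hmeas)).2 ?_
  refine ae_of_all _ fun g => ?_
  filter_upwards [h x hx (projAdversary x S g)] with ω hω p hc hl
  obtain ⟨t₀, hl⟩ := hl
  obtain ⟨t, y, hy⟩ := hω p (isCorrect_of_left x S g hl hc)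
  refine ⟨t, y, ?_⟩
  have := (rebuild_run x S g ω t).2.status p
  rw [hy] at this
  rcases hs : ((withGame A).run (withRegs B R) x S (joinCoins (g, ω)) t).status p with
    s | ⟨_ | _, k⟩ | y' <;> rw [hs] at this <;> simp [projStatus] at this
  rw [this]

end CoinGame

/-! ### An adversary that keeps the game going when the registers are only linearizable -/

namespace Algorithm

variable {n : ℕ} {σ : Signature} {In Out : Type} {A : Algorithm n σ In Out} {B : Objects n σ}

/-- From the given configuration, an adversary can force the run into `Q` in `k` steps. -/
def ForcesIn (Q : A.Config B → Prop) : ℕ → A.Config B → Prop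
  | 0, C => Q C
  | k + 1, C => ∃ d, ∀ v, ForcesIn Q k (C.exec v d)

/-- An adversary that can always force the next one of a sequence of conditions can force all of
them. -/
theorem exists_adversary_of_forcesIn (x : Fin n → In) (Q : ℕ → A.Config B → Prop) (P : ℕ)
    (h0 : Q 0 (A.initial B x)) (hQ : ∀ j C, Q j C → ForcesIn (Q (j + 1)) (P + 1) C) :
    ∃ S : A.Adversary B, ∀ ω j, Q j (A.run B x S ω (j * (P + 1))) := by
  classical
  -- At time `t`, the next condition can be forced in the `k` steps left in the current block of
  -- length `P + 1`; `k = 0` is a block boundary.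
  let Φ : ℕ → A.Config B → Prop := fun t C =>
    ∃ k j, t + k = j * (P + 1) ∧ k < P + 1 ∧ ForcesIn (Q j) k C
  have hΦ : ∀ t C, Φ t C → ∃ d, ∀ v, Φ (t + 1) (C.exec v d) := by
    rintro t C ⟨k, j, h1, h2, h3⟩
    cases k with
    | zero =>
      obtain ⟨d, hd⟩ := hQ j C h3
      exact ⟨d, fun v => ⟨P, j + 1, by linarith, Nat.lt_succ_self P, hd v⟩⟩
    | succ k =>
      obtain ⟨d, hd⟩ := h3
      exact ⟨d, fun v => ⟨k, j, by linarith, by omega, hd v⟩⟩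
  -- The chosen decision preserves `Φ` whatever the coins show; the time is read off the log.
  let S : A.Adversary B := fun C =>
    if h : ∃ d, ∀ v, Φ (C.log.length + 1) (C.exec v d) then h.choose else .idle
  have hS : ∀ ω t, Φ t (A.run B x S ω t) := by
    intro ω t
    induction t with
    | zero => exact ⟨0, 0, by simp, Nat.succ_pos P, h0⟩
    | succ t ih =>
      have h : ∃ d, ∀ v, Φ ((A.run B x S ω t).log.length + 1) ((A.run B x S ω t).exec v d) := by
        rw [run_log_length]
        exact hΦ t _ ih
      have key : Φ ((A.run B x S ω t).log.length + 1)
          ((A.run B x S ω t).exec (fun c => ω (t, c)) (S (A.run B x S ω t))) := by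
        simp only [S, dif_pos h]
        exact h.choose_spec fun c => ω (t, c)
      rwa [run_log_length] at key
  refine ⟨S, fun ω j => ?_⟩
  obtain ⟨k, j', h1, h2, h3⟩ := hS ω (j * (P + 1))
  -- At a multiple of `P + 1`, the number `k` of remaining steps is a multiple of `P + 1` and
  -- smaller than `P + 1`, so it is `0`.
  have hdvd : P + 1 ∣ k := by
    have : P + 1 ∣ j * (P + 1) + k := h1 ▸ dvd_mul_left _ _
    exact (Nat.dvd_add_right (dvd_mul_left _ _)).1 this
  obtain rfl : k = 0 := Nat.eq_zero_of_dvd_of_lt hdvd h2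
  obtain rfl : j = j' := Nat.eq_of_mul_eq_mul_right (Nat.succ_pos P) (by simpa using h1)
  exact h3

end Algorithm

namespace CoinGame

open Algorithm Event

variable {n : ℕ} {σ : Signature} {In Out : Type} {A : Algorithm n σ In Out} {B : Objects n σ}
  {R : Fin 3 → SharedObject n (RegOp Val) (RegRes Val)}

/-- The part of a configuration that matters for the game. -/
structure Snap (C : Cfg A B R) (st : Fin n → Status (sig σ) (State A) Out)
    (H₀ : List (Event n (RegOp Val) (RegRes Val) (R 0).Internal))
    (H₁ : List (Event n (RegOp Val) (RegRes Val) (R 1).Internal)) : Prop where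
  status : C.status = st
  hist0 : C.hist (.inr 0) = H₀
  hist1 : C.hist (.inr 1) = H₁

section forces

variable {C : Cfg A B R} {st : Fin n → Status (sig σ) (State A) Out}
  {H₀ : List (Event n (RegOp Val) (RegRes Val) (R 0).Internal)}
  {H₁ : List (Event n (RegOp Val) (RegRes Val) (R 1).Internal)}
  {Q : Cfg A B R → Prop} {m : ℕ} {p : Fin n}

theorem addEvent_hist_inr_of_ne (C : Cfg A B R) {i j : Fin 3} (h : j ≠ i)
    (e : Event n (RegOp Val) (RegRes Val) (R i).Internal) :
    (C.addEvent (.inr i) e).hist (.inr j) = C.hist (.inr j) :=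
  Config.addEvent_hist_of_ne C (i := .inr i) (j := .inr j) (by simpa using h) e

theorem addEvent_inl_hist_inr (C : Cfg A B R) (i : σ.Name)
    (e : Event n (σ.Op i) (σ.Res i) (B i).Internal) (j : Fin 3) :
    (C.addEvent (.inl i) e).hist (.inr j) = C.hist (.inr j) :=
  Config.addEvent_hist_of_ne C (i := .inl i) (j := .inr j) (by simp) e

theorem addEvent_hist_inr (C : Cfg A B R) (i : Fin 3)
    (e : Event n (RegOp Val) (RegRes Val) (R i).Internal) :
    (C.addEvent (.inr i) e).hist (.inr i) = C.hist (.inr i) ++ [e] :=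
  Config.addEvent_hist_self C (.inr i) e

theorem forcesIn_invoke0 (h : Snap C st H₀ H₁) {a j ph op k}
    (hs : st p = .ready (.inl (a, j, ph))) (hn : gameNext A p a j ph = .invoke (.inr 0) op k)
    {H} (hH : H₀ ++ [inv p op] = H) (hm : H ∈ (R 0).histories)
    (hC : ∀ C', Snap C' (Function.update st p (.waiting (.inr 0) k)) H H₁ → ForcesIn Q m C') :
    ForcesIn Q (m + 1) C := by
  obtain ⟨rfl, rfl, rfl⟩ := h
  subst hH
  refine ⟨.step p, fun v => hC _ ?_⟩
  rw [Config.exec, Config.effect_step_invoke hs hn hm]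
  exact ⟨rfl, addEvent_hist_inr C 0 _, addEvent_hist_inr_of_ne C (by simp) _⟩

theorem forcesIn_invoke1 (h : Snap C st H₀ H₁) {a j ph op k}
    (hs : st p = .ready (.inl (a, j, ph))) (hn : gameNext A p a j ph = .invoke (.inr 1) op k)
    {H} (hH : H₁ ++ [inv p op] = H) (hm : H ∈ (R 1).histories)
    (hC : ∀ C', Snap C' (Function.update st p (.waiting (.inr 1) k)) H₀ H → ForcesIn Q m C') :
    ForcesIn Q (m + 1) C := by
  obtain ⟨rfl, rfl, rfl⟩ := h
  subst hH
  refine ⟨.step p, fun v => hC _ ?_⟩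
  rw [Config.exec, Config.effect_step_invoke hs hn hm]
  exact ⟨rfl, addEvent_hist_inr_of_ne C (by simp) _, addEvent_hist_inr C 1 _⟩

theorem forcesIn_respond0 (h : Snap C st H₀ H₁) {k} (r : RegRes Val)
    (hs : st p = .waiting (.inr 0) k)
    {H} (hH : H₀ ++ [res p r] = H) (hm : H ∈ (R 0).histories)
    (hC : ∀ C', Snap C' (Function.update st p (.ready (k r))) H H₁ → ForcesIn Q m C') :
    ForcesIn Q (m + 1) C := by
  obtain ⟨rfl, rfl, rfl⟩ := h
  subst hH
  refine ⟨.respond p (.inr 0) r, fun v => hC _ ?_⟩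
  rw [Config.exec, Config.effect_respond hs hm]
  exact ⟨rfl, addEvent_hist_inr C 0 _, addEvent_hist_inr_of_ne C (by simp) _⟩

theorem forcesIn_respond1 (h : Snap C st H₀ H₁) {k} (r : RegRes Val)
    (hs : st p = .waiting (.inr 1) k)
    {H} (hH : H₁ ++ [res p r] = H) (hm : H ∈ (R 1).histories)
    (hC : ∀ C', Snap C' (Function.update st p (.ready (k r))) H₀ H → ForcesIn Q m C') :
    ForcesIn Q (m + 1) C := by
  obtain ⟨rfl, rfl, rfl⟩ := h
  subst hH
  refine ⟨.respond p (.inr 1) r, fun v => hC _ ?_⟩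
  rw [Config.exec, Config.effect_respond hs hm]
  exact ⟨rfl, addEvent_hist_inr_of_ne C (by simp) _, addEvent_hist_inr C 1 _⟩

theorem forcesIn_flip (h : Snap C st H₀ H₁) {a j} (hs : st p = .ready (.inl (a, j, .flip)))
    (hC : ∀ c C', Snap C' (Function.update st p (.ready (.inl (a, j, .check c)))) H₀ H₁ →
      ForcesIn Q m C') :
    ForcesIn Q (m + 1) C := by
  obtain ⟨rfl, rfl, rfl⟩ := h
  refine ⟨.step p, fun v => hC (decide (v none = 1)) _ ?_⟩
  rw [Config.exec, Config.effect_step_flip hs (c := none)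
    (k := fun m => Sum.inl (a, j, Phase.check (decide (m = 1)))) rfl]
  exact ⟨rfl, rfl, rfl⟩

theorem forcesIn_idle (h : Snap C st H₀ H₁) (hC : ∀ C', Snap C' st H₀ H₁ → ForcesIn Q m C') :
    ForcesIn Q (m + 1) C :=
  ⟨.idle, fun _ => hC _ ⟨h.status, h.hist0, h.hist1⟩⟩

end forces

variable (x : Fin n → In)

/-- All processes are at the start of round `j`, and there are no pending register operations. -/
def RoundStart (j : ℕ) (C : Cfg A B R) : Prop :=
  ∃ H₀ H₁ v₀ v₁, Snap C (fun p => .ready (.inl (x p, j, start p))) H₀ H₁ ∧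
    Quiescent none H₀ v₀ ∧ Quiescent none H₁ v₁

/-- The phase of process `p` after the announcement in a round, when the coin shows `c`. -/
def latePhase (c : Bool) (p : Fin n) : Phase := if p.val = 0 then .check c else .listen

/-- The status of the processes when the first `m` of them have passed round `j`. -/
def lateStatus (A : Algorithm n σ In Out) (j m : ℕ) (c : Bool) (p : Fin n) :
    Status (sig σ) (State A) Out :=
  if p.val < m ∨ p.val = 2 then .ready (.inl (x p, j + 1, start p))
  else .ready (.inl (x p, j, latePhase c p))

theorem exists_after_latePhase (A : Algorithm n σ In Out) (p : Fin n) (a : In) (j : ℕ) (c : Bool) :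
    ∃ k : RegRes Val → State A,
      gameNext A p a j (latePhase c p) = .invoke (.inr 1) (RegOp.read (V := Val)) k ∧
      k (.val (some (j, c))) = .inl (a, j + 1, start p) := by
  unfold latePhase
  split_ifs
  · exact ⟨_, rfl, by simp [afterCheck]⟩
  · exact ⟨_, rfl, by simp [afterListen]⟩

/-- With `some (j, c)` in register 1, the processes can read it one after another: process 0 passes
because its coin shows `c`, the others because the value belongs to round `j`. Process 2 has already
passed and is given two idle steps, which keeps the count uniform. -/
theorem forcesIn_late (hR : ∀ i H, Admissible none H → H ∈ (R i).histories) (j : ℕ) (c : Bool)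
    (k m : ℕ) (hkm : k + m = n) (C : Cfg A B R) {H₀ H₁ v₀}
    (hC : Snap C (lateStatus x A j m c) H₀ H₁) (h₀ : Quiescent none H₀ v₀)
    (h₁ : Quiescent none H₁ (some (j, c))) : ForcesIn (RoundStart x (j + 1)) (2 * k) C := by
  induction k generalizing m C H₁ with
  | zero =>
    refine ⟨H₀, H₁, _, _, ⟨?_, hC.hist0, hC.hist1⟩, h₀, h₁⟩
    rw [hC.status]
    funext p
    have := p.isLt
    exact if_pos (by omega)
  | succ k ih =>
    rw [Nat.mul_succ]
    by_cases hm : m = 2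
    · refine forcesIn_idle hC fun C' hC' => forcesIn_idle hC' fun C'' hC'' =>
        ih (m + 1) (by omega) C'' ?_ h₁
      convert hC'' using 1
      funext p
      simp only [lateStatus]
      congr 1
      simp only [eq_iff_iff]
      omega
    · set p : Fin n := ⟨m, by omega⟩ with hp
      obtain ⟨κ, hκ1, hκ2⟩ := exists_after_latePhase A p (x p) j c
      have h₁' := h₁.read p
      have hs : lateStatus x A j m c p = .ready (.inl (x p, j, latePhase c p)) :=
        if_neg (by simp [hp, hm])
      refine forcesIn_invoke1 hC hs hκ1 rfl
        (hR 1 _ (h₁'.admissible.of_prefix ⟨[res p (.val (some (j, c)))], by simp⟩))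
        fun C' hC' => ?_
      refine forcesIn_respond1 hC' (.val (some (j, c))) (p := p) (k := κ) (by simp) (List.append_assoc _ _ _)
        (hR 1 _ h₁'.admissible) fun C'' hC'' => ih (m + 1) (by omega) C''
          ⟨hC''.status.trans ?_, hC''.hist0, hC''.hist1⟩ h₁'
      funext q
      rw [Function.update_idem, Function.update_apply, hκ2]
      split_ifs with hq
      · rw [hq]
        exact (if_pos (.inl (Nat.lt_succ_self m))).symm
      · simp only [lateStatus]
        congr 1
        have : q.val ≠ m := fun h' => hq (Fin.ext h')
        simp only [eq_iff_iff]
        omega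

/-- Process 0 completes its write while the write of process 1 and the first read are pending. The
adversary sees the coin `c` and only then settles the order of the writes, so that process 2
announces `c`. This takes 11 steps up to the end of the announcement, and the final reads take two
for each of the `n` processes. -/
theorem forcesIn_round (hn : 3 ≤ n) (hR : ∀ i H, Admissible none H → H ∈ (R i).histories) (j : ℕ)
    (C : Cfg A B R) (hC : RoundStart x j C) :
    ForcesIn (RoundStart x (j + 1)) (2 * n + 10 + 1) C := by
  obtain ⟨H₀, H₁, v₀, v₁, hC, h₀, h₁⟩ := hC
  set p₀ : Fin n := ⟨0, by omega⟩ with hp₀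
  set p₁ : Fin n := ⟨1, by omega⟩ with hp₁
  set p₂ : Fin n := ⟨2, by omega⟩ with hp₂
  have h01 : p₀ ≠ p₁ := by simp [hp₀, hp₁]
  have h02 : p₀ ≠ p₂ := by simp [hp₀, hp₂]
  have h12 : p₁ ≠ p₂ := by simp [hp₁, hp₂]
  have s1 : start p₁ = .write1 := rfl
  have s2 : start p₂ = .read1 := rfl
  have hq := fun c => h₀.contest h01 h02 h12 (fun b => some (j, b)) c
  have hpre : ∀ c L, L <+: contest p₀ p₁ p₂ (fun b => (some (j, b) : Val)) c →
      H₀ ++ L ∈ (R 0).histories := fun c L hL =>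
    hR 0 _ ((hq c).admissible.of_prefix ((List.prefix_append_right_inj H₀).2 hL))
  -- Before the flip only the first four events of the contest occur. They do not depend on the bit,
  -- so `false` is an arbitrary choice here.
  refine forcesIn_invoke0 hC (p := p₀) (ph := .write0) rfl rfl rfl
    (hpre false _ (by simp [contest])) fun C₁ hC₁ => ?_
  refine forcesIn_invoke0 hC₁ (p := p₁) (a := x p₁) (j := j) (ph := .write1)
    (by simp [h01.symm, s1]) rfl
    (List.append_assoc _ _ _) (hpre false _ (by simp [contest])) fun C₂ hC₂ => ?_
  refine forcesIn_invoke0 hC₂ (p := p₂) (a := x p₂) (j := j) (ph := .read1)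
    (by simp [h02.symm, h12.symm, s2]) rfl
    (List.append_assoc _ _ _) (hpre false _ (by simp [contest])) fun C₃ hC₃ => ?_
  refine forcesIn_respond0 hC₃ .ack (p := p₀) (k := fun _ => .inl (x p₀, j, .flip))
    (by simp [h01, h02]) (List.append_assoc _ _ _) (hpre false _ (by simp [contest])) fun C₄ hC₄ => ?_
  refine forcesIn_flip hC₄ (p := p₀) (a := x p₀) (j := j) (by simp) fun c C₅ hC₅ => ?_
  -- From here on the history of register 0 follows the contest for the actual outcome `c`.
  refine forcesIn_respond0 hC₅ .ack (p := p₁) (k := fun _ => .inl (x p₁, j, .listen))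
    (by simp [h01.symm, h12]) (List.append_assoc _ _ _) (hpre c _ (by simp [contest])) fun C₆ hC₆ => ?_
  refine forcesIn_respond0 hC₆ (.val (some (j, c))) (p := p₂) (k := afterRead1 A (x p₂) j)
    (by simp [h02.symm, h12.symm]) (List.append_assoc _ _ _) (hpre c _ (by simp [contest])) fun C₇ hC₇ => ?_
  refine forcesIn_invoke0 hC₇ (p := p₂) (a := x p₂) (j := j) (ph := .read2 (some (j, c)))
    (by simp [afterRead1]) rfl (List.append_assoc _ _ _) (hpre c _ (by simp [contest])) fun C₈ hC₈ => ?_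
  refine forcesIn_respond0 hC₈ (.val (some (j, !c))) (p := p₂)
    (k := afterRead2 A p₂ (x p₂) j (some (j, c)))
    (by simp) (List.append_assoc _ _ _) (hpre c _ (by simp [contest])) fun C₉ hC₉ => ?_
  have hw := h₁.write p₂ (some (j, c))
  refine forcesIn_invoke1 hC₉ (p := p₂) (a := x p₂) (j := j) (ph := .announce c)
    (by cases c <;> simp [afterRead2]) rfl rfl
    (hR 1 _ (hw.admissible.of_prefix ⟨[res p₂ .ack], by simp⟩)) fun C₁₀ hC₁₀ => ?_
  refine forcesIn_respond1 hC₁₀ .ack (p := p₂) (k := fun _ => .inl (x p₂, j + 1, start p₂))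
    (by simp) (List.append_assoc _ _ _) (hR 1 _ hw.admissible) fun C₁₁ hC₁₁ => ?_
  refine forcesIn_late x hR j c n 0 rfl C₁₁ (H₀ := H₀ ++ contest p₀ p₁ p₂ _ c)
    ⟨hC₁₁.status.trans ?_, hC₁₁.hist0, hC₁₁.hist1⟩ (hq c) hw
  funext q
  by_cases hq2 : q = p₂
  · subst hq2
    simp [lateStatus, hp₂]
  have hv2 : q.val ≠ 2 := fun h => hq2 (Fin.ext h)
  by_cases hq0 : q = p₀
  · subst hq0
    simp [lateStatus, latePhase, h01, h02]
    simp [hp₀]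
  have hv0 : q.val ≠ 0 := fun h => hq0 (Fin.ext h)
  by_cases hq1 : q = p₁
  · subst hq1
    simp [lateStatus, latePhase, h12]
    simp [hp₁]
  have hv1 : q.val ≠ 1 := fun h => hq1 (Fin.ext h)
  have hstart : start q = .listen := by
    unfold start
    split <;> simp_all
  simp [lateStatus, latePhase, hq0, hq1, hq2, hv0, hv2, hstart]

theorem roundStart_initial : RoundStart x 0 ((withGame A).initial (withRegs B R) x) :=
  ⟨[], [], none, none, ⟨rfl, rfl, rfl⟩, .nil, .nil⟩

/-- Every round takes steps of every process. -/
def RoundLeSteps (C : Cfg A B R) : Prop :=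
  (∀ p a j ph, C.status p = .ready (.inl (a, j, ph)) → j ≤ C.steps p) ∧
    ∀ p i k, C.status p = .waiting i k → ∀ r a j ph, k r = .inl (a, j, ph) → j ≤ C.steps p + 1

/-- An operation raises the round of its process by at most one, while its invocation and its
response both count as steps. Reaching every round therefore means taking infinitely many steps. -/
theorem roundLeSteps_exec (C : Cfg A B R) (v : Option A.Coin → ℕ) (d) (h : RoundLeSteps C) :
    RoundLeSteps (C.exec v d) := by
  suffices H : ∀ C' : Cfg A B R, C.Move v d C' → RoundLeSteps C' from
    H (C.effect v d) (C.move_effect v d)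
  have key : ∀ (C' : Cfg A B R) p s, C'.status = Function.update C.status p s →
      C'.steps = Function.update C.steps p (C.steps p + 1) →
      (∀ a j ph, s = .ready (.inl (a, j, ph)) → j ≤ C.steps p + 1) →
      (∀ i k, s = .waiting i k → ∀ r a j ph, k r = .inl (a, j, ph) → j ≤ C.steps p + 2) →
      RoundLeSteps C' := by
    intro C' p s h1 h2 h3 h4
    constructor
    · intro q a j ph hq
      rw [h1] at hq
      rw [h2]
      rcases eq_or_ne q p with rfl | hqp
      · rw [Function.update_self] at hq ⊢
        exact h3 a j ph hq
      · rw [Function.update_of_ne hqp] at hq ⊢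
        exact h.1 q a j ph hq
    · intro q i k hq
      rw [h1] at hq
      rw [h2]
      rcases eq_or_ne q p with rfl | hqp
      · rw [Function.update_self] at hq ⊢
        exact h4 i k hq
      · rw [Function.update_of_ne hqp] at hq ⊢
        exact h.2 q i k hq
  intro C' hC
  cases hC with
  | stay => exact h
  | invoke p s i op k hs hn hm =>
    refine key _ p _ rfl rfl (by simp) ?_
    intro i' k' hk r a j ph hr
    cases hk
    rcases s with ⟨a', j', ph'⟩ | s
    · have h1 := h.1 p a' j' ph' hs
      suffices j ≤ j' + 1 by omega
      cases ph' <;> cases hn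
      all_goals
        first
        | (cases hr; omega)
        | (rcases r with _ | v <;>
            simp only [afterCheck, afterListen, afterRead1, afterRead2] at hr <;>
            (try split_ifs at hr) <;> cases hr <;> omega)
    · change liftAction A (A.next p s) = _ at hn
      rcases hA : A.next p s with ⟨i, op, k⟩ | ⟨c, k⟩ | y <;> rw [hA] at hn <;> cases hn
      cases hr
  | flip p s c k hs hn =>
    refine key _ p _ rfl rfl ?_ (by simp)
    intro a j ph hr
    rcases s with ⟨a', j', ph'⟩ | s
    · have h1 := h.1 p a' j' ph' hs
      cases ph' <;> cases hn
      cases hr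
      omega
    · change liftAction A (A.next p s) = _ at hn
      rcases hA : A.next p s with ⟨i, op, k⟩ | ⟨c, k⟩ | y <;> rw [hA] at hn <;> cases hn
      cases hr
  | ret p s y hs hn => exact key _ p _ rfl rfl (by simp) (by simp)
  | again p y hs => exact key _ p _ rfl rfl (by simp) (by simp)
  | respond p i k r hs hm =>
    refine key _ p _ rfl rfl ?_ (by simp)
    intro a j ph hr
    exact h.2 p i k hs r a j ph (by simpa using hr)
  | internal i e hm => exact h

theorem withGame_adversaryPreventsTermination (hn : 3 ≤ n) (T : DistributedTask n In Out)
    (hR : ∀ i, (R i).IsOnlyLinearizable none) :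
    (withGame A).AdversaryPreventsTermination (withRegs B R) T := by
  intro x _
  have hR' : ∀ i H, Admissible none H → H ∈ (R i).histories := fun i H hH =>
    (hR i).2 H hH.no_tau hH.wellFormed hH.linearizable
  obtain ⟨S, hS⟩ := exists_adversary_of_forcesIn x (RoundStart (A := A) (B := B) (R := R) x)
    (2 * n + 10) (roundStart_initial x) (forcesIn_round x hn hR')
  refine ⟨S, Filter.Eventually.of_forall fun ω p => ⟨fun N => ?_, ?_⟩⟩
  · have hlt := (withGame A).run_induction (B := withRegs B R) x S (P := RoundLeSteps)
      ⟨by simp [initial], by simp [initial]⟩ roundLeSteps_exec ω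
      (N * (2 * n + 10 + 1))
    obtain ⟨H₀, H₁, v₀, v₁, h, -⟩ := hS ω N
    exact ⟨_, hlt.1 p (x p) N (start p) (by rw [h.status])⟩
  · rintro ⟨t, y, hy⟩
    -- A process that has returned by time `t` has still returned at the start of round `t`, which
    -- is no earlier; but there every process is ready.
    have h1 := (withGame A).returned_of_le (B := withRegs B R) x S
      (Nat.le_mul_of_pos_right t (Nat.succ_pos (2 * n + 10))) hy
    obtain ⟨H₀, H₁, v₀, v₁, h, -⟩ := hS ω t
    rw [h.status] at h1
    cases h1

end CoinGame

/-! ### Termination with write strongly-linearizable registers: invariants -/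

namespace Event

variable {n : ℕ} {V Intl : Type} {v₀ : V} {H : List (Event n (RegOp V) (RegRes V) Intl)}

/-- A write operation with value `v` is invoked in `H`. -/
def Wrote (H : List (Event n (RegOp V) (RegRes V) Intl)) (v : V) : Prop :=
  ∃ (i : ℕ) (p : Fin n), H[i]? = some (inv p (RegOp.write v))

theorem Wrote.snoc {v : V} (h : Wrote H v) (e : Event n (RegOp V) (RegRes V) Intl) :
    Wrote (H ++ [e]) v := by
  obtain ⟨i, p, h⟩ := h
  exact ⟨i, p, getElem?_snoc_of_some e h⟩

theorem Wrote.of_snoc {v : V} {e : Event n (RegOp V) (RegRes V) Intl} (h : Wrote (H ++ [e]) v) :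
    Wrote H v ∨ ∃ p, e = inv p (RegOp.write v) := by
  obtain ⟨i, p, h⟩ := h
  rcases getElem?_snoc h with ⟨-, h⟩ | ⟨-, h⟩
  · exact .inl ⟨i, p, h⟩
  · exact .inr ⟨p, h⟩

theorem wrote_snoc_self (H : List (Event n (RegOp V) (RegRes V) Intl)) (p : Fin n) (v : V) :
    Wrote (H ++ [inv p (RegOp.write v)]) v :=
  ⟨H.length, p, by simp⟩

/-- No value is written twice in `H`. -/
def UniqueWrites (H : List (Event n (RegOp V) (RegRes V) Intl)) : Prop :=
  ∀ (i i' : ℕ) (p p' : Fin n) (v : V), H[i]? = some (inv p (RegOp.write v)) →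
    H[i']? = some (inv p' (RegOp.write v)) → i = i'

theorem UniqueWrites.snoc (h : UniqueWrites H) {e : Event n (RegOp V) (RegRes V) Intl}
    (he : ∀ p v, e = inv p (RegOp.write v) → ¬ Wrote H v) : UniqueWrites (H ++ [e]) := by
  intro i i' p p' v h1 h2
  rcases getElem?_snoc h1 with ⟨-, e1⟩ | ⟨l1, e1⟩ <;>
    rcases getElem?_snoc h2 with ⟨-, e2⟩ | ⟨l2, e2⟩
  · exact h i i' p p' v e1 e2
  · exact absurd ⟨i, p, e1⟩ (he p' v e2)
  · exact absurd ⟨i', p', e2⟩ (he p v e1)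
  · exact l1.trans l2.symm

/-- The values written in a sequential history. -/
def seqVals (L : List (SeqOp n V)) : List V :=
  L.filterMap fun o => match o.op with
    | .read => none
    | .write v => some v

theorem seqVals_append (L L' : List (SeqOp n V)) : seqVals (L ++ L') = seqVals L ++ seqVals L' := by
  simp [seqVals]

theorem seqVals_writes (L : List (SeqOp n V)) : seqVals (SeqOp.writes L) = seqVals L := by
  rw [SeqOp.writes, seqVals, seqVals, List.filterMap_filter]
  congr 1
  funext o
  rcases ho : o.op with _ | v <;> simp [SeqOp.isWrite, ho]

theorem mem_seqVals {L : List (SeqOp n V)} {v : V} :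
    v ∈ seqVals L ↔ ∃ o ∈ L, o.op = .write v := by
  simp only [seqVals, List.mem_filterMap]
  refine exists_congr fun o => and_congr_right fun _ => ?_
  rcases o.op with _ | w <;> simp

theorem lastValue_eq (v₀ : V) (L : List (SeqOp n V)) :
    SeqOp.lastValue v₀ L = v₀ ∧ seqVals L = [] ∨
      ∃ K, seqVals L = K ++ [SeqOp.lastValue v₀ L] := by
  induction L using List.reverseRecOn with
  | nil => exact .inl ⟨rfl, rfl⟩
  | append_singleton L o ih =>
    obtain ⟨m, p, op, r⟩ := o
    cases op with
    | read =>
      rw [seqVals_append, SeqOp.lastValue_append_read]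
      simpa [seqVals] using ih
    | write v =>
      rw [seqVals_append, SeqOp.lastValue_append_write]
      exact .inr ⟨seqVals L, rfl⟩

theorem _root_.IsLinearization.wrote {L : List (SeqOp n V)} (h : IsLinearization v₀ H L) {v : V}
    (hv : v ∈ seqVals L) : Wrote H v := by
  obtain ⟨o, ho, hop⟩ := mem_seqVals.1 hv
  exact ⟨o.id, o.proc, by rw [h.mem_history o ho, hop]⟩

/-- Operations are identified by the positions of their invocations; each value is invoked at one
position only, so different writes in `L` carry different values. -/
theorem _root_.IsLinearization.seqVals_nodup {L : List (SeqOp n V)} (h : IsLinearization v₀ H L)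
    (hu : UniqueWrites H) : (seqVals L).Nodup := by
  rw [List.Nodup, seqVals, List.pairwise_filterMap]
  refine (List.pairwise_map.1 h.nodup).imp_of_mem ?_
  rintro o o' ho ho' hne v hv v' hv' rfl
  have key : ∀ o ∈ L, (match o.op with
      | .read => none
      | .write v => some v) = some v → H[o.id]? = some (inv o.proc (RegOp.write v)) := by
    intro o ho hv
    rw [h.mem_history o ho]
    rcases hop : o.op with _ | w <;> rw [hop] at hv <;> simp at hv
    rw [hv]
  exact hne (hu _ _ _ _ v (key o ho hv) (key o' ho' hv'))

/-- A completed operation with a response `val v` is a read that is preceded in the linearization by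
writes the last of which writes `v`. -/
theorem _root_.IsLinearization.exists_of_val {L : List (SeqOp n V)} (h : IsLinearization v₀ H L)
    {i j : ℕ} {v : V} (hr : RespondsAt H i j (.val v)) :
    ∃ L₁ o L₂, L = L₁ ++ o :: L₂ ∧ o.id = i ∧ o.res = .val v ∧ SeqOp.lastValue v₀ L₁ = v := by
  obtain ⟨o, ho, hid, hres⟩ := h.complete i j _ hr
  obtain ⟨L₁, L₂, hL⟩ := List.append_of_mem ho
  refine ⟨L₁, o, L₂, hL, hid, hres, ?_⟩
  have := h.legal L₁ o L₂ hL
  rcases hop : o.op with _ | w <;> rw [hop] at this <;> simp only [hres] at this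
  · injection this with this
    exact this.symm
  · cases this

theorem _root_.IsLinearization.wrote_of_val {L : List (SeqOp n V)} (h : IsLinearization v₀ H L)
    {i j : ℕ} {v : V} (hr : RespondsAt H i j (.val v)) : v = v₀ ∨ Wrote H v := by
  obtain ⟨L₁, o, L₂, rfl, -, -, hv⟩ := h.exists_of_val hr
  rcases lastValue_eq v₀ L₁ with ⟨h1, -⟩ | ⟨K, h1⟩
  · exact .inl (hv.symm.trans h1)
  · refine .inr (h.wrote ?_)
    rw [seqVals_append, h1, hv]
    simp

/-- A read does not get an acknowledgement. -/
theorem _root_.IsLinearization.not_ack {L : List (SeqOp n V)} (h : IsLinearization v₀ H L)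
    {i j : ℕ} {p : Fin n} (hi : H[i]? = some (inv p RegOp.read)) : ¬ RespondsAt H i j .ack := by
  intro hr
  obtain ⟨o, ho, hid, hres⟩ := h.complete i j _ hr
  obtain ⟨L₁, L₂, hL⟩ := List.append_of_mem ho
  have h1 := h.mem_history o ho
  rw [hid, hi] at h1
  have := h.legal L₁ o L₂ hL
  simp only [Option.some.injEq, inv.injEq] at h1
  rw [← h1.2] at this
  simp only [hres] at this
  cases this

end Event

/-! ### What alternating reads show about the order of writes, and the invariant of a single process
-/

namespace CoinGame

open Algorithm Event

variable {n : ℕ} {I₀ I₁ : Type}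

/-- Reads of the two values of round `j`, one after the other. -/
def Alternates (H : List (Event n (RegOp Val) (RegRes Val) I₀)) (j : ℕ) (b : Bool) : Prop :=
  ∃ i₁ i₁' i₂ i₂', RespondsAt H i₁ i₁' (.val (some (j, b))) ∧
    RespondsAt H i₂ i₂' (.val (some (j, !b))) ∧ i₁' < i₂

theorem Alternates.snoc {H : List (Event n (RegOp Val) (RegRes Val) I₀)} {j : ℕ} {b : Bool}
    (h : Alternates H j b) (e) : Alternates (H ++ [e]) j b := by
  obtain ⟨i₁, i₁', i₂, i₂', h1, h2, h3⟩ := h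
  exact ⟨i₁, i₁', i₂, i₂', h1.snoc e, h2.snoc e, h3⟩

/-- For either `b`, one of the two values read is `some (j, false)`, and a value other than the
initial one has been written. So an announcement proves that process 0 has invoked its write of
round `j`. -/
theorem Alternates.wrote {H : List (Event n (RegOp Val) (RegRes Val) I₀)} {j : ℕ} {b : Bool}
    (h : Alternates H j b) {L} (hL : IsLinearization none H L) : Wrote H (some (j, false)) := by
  obtain ⟨i₁, i₁', i₂, i₂', h1, h2, h3⟩ := h
  have h1' := (hL.wrote_of_val h1).resolve_left (by simp)
  have h2' := (hL.wrote_of_val h2).resolve_left (by simp)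
  cases b
  · exact h1'
  · exact h2'

/-- The first value of round `j` in a list. -/
def firstOf (j : ℕ) (l : List Val) : Option Val := l.find? fun v => v.map Prod.fst = some j

/-- As soon as the list contains a value of round `j`, appending further values cannot change which
one is first. -/
theorem firstOf_of_prefix {j : ℕ} {l l' : List Val} (h : l <+: l') {b : Bool}
    (hb : some (j, b) ∈ l) : firstOf j l' = firstOf j l := by
  obtain ⟨K, rfl⟩ := h
  rw [firstOf, firstOf, List.find?_append]
  have : (l.find? fun v => v.map Prod.fst = some j).isSome := by
    rw [List.find?_isSome]
    exact ⟨_, hb, by simp⟩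
  obtain ⟨v, hv⟩ := Option.isSome_iff_exists.1 this
  rw [hv]
  rfl

/-- The order of the writes of a round decides which pair of reads is possible. -/
theorem Alternates.firstOf {H : List (Event n (RegOp Val) (RegRes Val) I₀)} {j : ℕ} {b : Bool}
    (h : Alternates H j b) {L} (hL : IsLinearization none H L) (hu : UniqueWrites H) :
    firstOf j (seqVals L) = some (some (j, b)) := by
  obtain ⟨i₁, i₁', i₂, i₂', h1, h2, h3⟩ := h
  have hnd := hL.seqVals_nodup hu
  obtain ⟨A₁, o₁, B₁, rfl, hid1, hres1, hv1⟩ := hL.exists_of_val h1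
  obtain ⟨A₂, o₂, B₂, hL2, hid2, hres2, hv2⟩ := hL.exists_of_val h2
  have hne : o₁ ≠ o₂ := by
    rintro rfl
    rw [hres1] at hres2
    cases b <;> simp at hres2
  have hK1 : ∃ K, seqVals A₁ = K ++ [some (j, b)] := by
    rcases lastValue_eq none A₁ with ⟨h, -⟩ | ⟨K, h⟩
    · rw [hv1] at h
      cases h
    · exact ⟨K, by rw [h, hv1]⟩
  have hK2 : ∃ K, seqVals A₂ = K ++ [some (j, !b)] := by
    rcases lastValue_eq none A₂ with ⟨h, -⟩ | ⟨K, h⟩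
    · rw [hv2] at h
      cases h
    · exact ⟨K, by rw [h, hv2]⟩
  -- The first read responds before the second is invoked, so no linearization can exchange them.
  have hpre : A₁ <+: A₂ := by
    have hp1 : A₁ <+: A₂ ++ o₂ :: B₂ := hL2 ▸ List.prefix_append _ _
    rcases List.prefix_or_prefix_of_prefix hp1 (List.prefix_append A₂ (o₂ :: B₂)) with h | h
    · exact h
    exfalso
    obtain ⟨D, rfl⟩ := h
    rw [List.append_assoc, List.append_cancel_left_eq] at hL2
    rcases D with _ | ⟨d, D⟩
    · exact hne (by simpa using hL2 |> List.cons.inj |>.1)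
    · simp only [List.cons_append, List.cons.injEq] at hL2
      obtain ⟨rfl, -⟩ := hL2
      have ho := hL.order
      rw [List.append_assoc, List.pairwise_append] at ho
      have := (List.pairwise_cons.1 ho.2.1).1 o₁ (by simp)
      exact this (hid1 ▸ hid2 ▸ ⟨i₁', _, h1, h3⟩)
  obtain ⟨K₁, hK1⟩ := hK1
  obtain ⟨K₂, hK2⟩ := hK2
  obtain ⟨D, rfl⟩ := hpre
  have hne' : (some (j, b) : Val) ≠ some (j, !b) := by cases b <;> simp
  rw [seqVals_append] at hK2
  -- The last write before the second read differs from the last write before the first, so it lies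
  -- between the two reads.
  have hD : (some (j, !b) : Val) ∈ seqVals D := by
    have h5 : seqVals A₁ ++ seqVals D = K₂ ++ [some (j, !b)] := hK2
    rcases List.eq_nil_or_concat (seqVals D) with h4 | ⟨D', d, h4⟩
    · rw [h4, hK1, List.append_nil] at h5
      obtain ⟨-, h6⟩ := List.append_inj' h5 rfl
      exact absurd (List.cons.inj h6).1 hne'
    · rw [List.concat_eq_append] at h4
      rw [h4, ← List.append_assoc] at h5
      obtain ⟨-, h6⟩ := List.append_inj' h5 rfl
      rw [h4, (List.cons.inj h6).1]
      simp
  rw [hL2, seqVals_append, seqVals_append, hK1] at hnd ⊢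
  -- A value of round `j` ahead of `some (j, b)` would repeat either this value or the later `some
  -- (j, !b)`, and no value is written twice.
  have hnone : K₁.find? (fun v => decide (v.map Prod.fst = some j)) = none := by
    rw [List.find?_eq_none]
    intro v hv hvj
    simp only [decide_eq_true_eq] at hvj
    rcases v with _ | ⟨j', b'⟩
    · simp at hvj
    · obtain rfl : j' = j := by simpa using hvj
      rcases eq_or_ne b' b with rfl | hb
      · exact (List.nodup_append.1 (List.nodup_append.1 (List.nodup_append.1 hnd).1).1).2.2
          _ hv _ (by simp) rfl
      · obtain rfl : b' = !b := by cases b <;> cases b' <;> simp_all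
        exact (List.nodup_append.1 (List.nodup_append.1 hnd).1).2.2 _ (by simp [hv]) _ hD rfl
  simp only [CoinGame.firstOf, List.find?_append, hnone, List.find?_cons, Option.map_some,
    decide_true, Option.none_or, Option.some_or]

/-- The processes that run through a phase. -/
def roleOK (p : Fin n) : Phase → Prop
  | .write0 | .flip | .check _ => p.val = 0
  | .write1 => p.val = 1
  | .listen => p.val ≠ 0 ∧ p.val ≠ 2
  | .read1 | .read2 _ | .announce _ => p.val = 2

theorem roleOK_start (p : Fin n) : roleOK p (start p) := by
  unfold start
  split <;> rename_i h <;> simp_all [roleOK]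

/-- The number of steps that a process may have taken in a round before a phase. -/
def rank : Phase → ℕ
  | .write0 | .write1 | .read1 => 0
  | .flip | .listen | .read2 _ => 2
  | .check _ => 3
  | .announce _ => 4

/-- A bound for the rounds of the values that the process in the given phase has written. -/
def roundBound (j : ℕ) : Phase → ℕ
  | .write0 | .write1 => j
  | _ => j + 1

theorem le_roundBound (j : ℕ) (ph : Phase) : j ≤ roundBound j ph := by
  cases ph <;> simp [roundBound]

/-- The values written by `p` belong to rounds before `b`. -/
def Fresh (H₀ : List (Event n (RegOp Val) (RegRes Val) I₀)) (p : Fin n) (b : ℕ) : Prop :=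
  (p.val = 0 → ∀ j, Wrote H₀ (some (j, false)) → j < b) ∧
    (p.val = 1 → ∀ j, Wrote H₀ (some (j, true)) → j < b)

theorem Fresh.mono {H₀ : List (Event n (RegOp Val) (RegRes Val) I₀)} {p : Fin n} {b b' : ℕ}
    (h : Fresh H₀ p b) (hb : b ≤ b') : Fresh H₀ p b' :=
  ⟨fun h' j hj => (h.1 h' j hj).trans_le hb, fun h' j hj => (h.2 h' j hj).trans_le hb⟩

/-- The write of `some (j, false)` is complete. -/
def WriteDone (H₀ : List (Event n (RegOp Val) (RegRes Val) I₀)) (j : ℕ) : Prop :=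
  ∃ i i' r p, RespondsAt H₀ i i' r ∧ H₀[i]? = some (inv p (RegOp.write (some (j, false))))

/-- A completed write occurs in every linearization. Since process 0 flips only after its write has
responded, the linearization then already contains a write of the round. -/
theorem WriteDone.mem {H : List (Event n (RegOp Val) (RegRes Val) I₀)} {j : ℕ} (h : WriteDone H j)
    {L} (hL : IsLinearization none H L) : some (j, false) ∈ seqVals L := by
  obtain ⟨i, i', r, p, hr, hi⟩ := h
  obtain ⟨o, ho, hid, -⟩ := hL.complete i i' r hr
  have := hL.mem_history o ho
  rw [hid, hi] at this
  simp only [Option.some.injEq, inv.injEq] at this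
  exact mem_seqVals.2 ⟨o, ho, this.2.symm⟩

/-- What the register histories show about a process that is about to take a step. -/
def readyExtra (H₀ : List (Event n (RegOp Val) (RegRes Val) I₀)) (j : ℕ) : Phase → Prop
  | .flip | .check _ => WriteDone H₀ j
  | .read2 v => ∃ i i', RespondsAt H₀ i i' (.val v)
  | .announce b => Alternates H₀ j b
  | _ => True

/-- What the register histories show about a process that is waiting for a response. -/
def waitExtra (H₀ : List (Event n (RegOp Val) (RegRes Val) I₀))
    (H₁ : List (Event n (RegOp Val) (RegRes Val) I₁)) (p : Fin n) (j : ℕ) : Phase → Prop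
  | .write0 => ∃ m, OpenAt H₀ p m (.write (some (j, false)))
  | .flip => False
  | .check _ => WriteDone H₀ j ∧ ∃ m, OpenAt H₁ p m .read
  | .write1 => True
  | .listen => ∃ m, OpenAt H₁ p m .read
  | .read1 => ∃ m, OpenAt H₀ p m .read
  | .read2 v => ∃ i i' m, RespondsAt H₀ i i' (.val v) ∧ i' < m ∧ OpenAt H₀ p m .read
  | .announce b => Wrote H₁ (some (j, b))

/-- Invariant for a process in the game that has taken `s` steps: `e` tells what the histories show,
`b` bounds the rounds of its writes and `s'` bounds its steps in this round. -/
structure PhaseOK (H₀ : List (Event n (RegOp Val) (RegRes Val) I₀))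
    (H₁ : List (Event n (RegOp Val) (RegRes Val) I₁)) (s : ℕ) (p : Fin n) (j : ℕ) (ph : Phase)
    (s' b : ℕ) (e : Prop) : Prop where
  role : roleOK p ph
  rounds : ∀ j' < j, ∃ b, Wrote H₁ (some (j', b))
  steps : s ≤ 8 * j + s'
  fresh : Fresh H₀ p b
  extra : e

variable {σ : Signature} {In Out : Type} {A : Algorithm n σ In Out}

/-- Invariant for a process. -/
def LocalOK (A : Algorithm n σ In Out) (H₀ : List (Event n (RegOp Val) (RegRes Val) I₀))
    (H₁ : List (Event n (RegOp Val) (RegRes Val) I₁)) (s : ℕ) (p : Fin n) :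
    Status (sig σ) (State A) Out → Prop
  | .ready (.inl (_, j, ph)) =>
    PhaseOK H₀ H₁ s p j ph (rank ph) (roundBound j ph) (readyExtra H₀ j ph)
  | .ready (.inr _) => True
  | .waiting (.inl _) k => ∀ r, ∃ s, k r = .inr s
  | .waiting (.inr i) k => ∃ a j ph op, gameNext A p a j ph = .invoke (.inr i) op k ∧
      PhaseOK H₀ H₁ s p j ph (rank ph + 1) (j + 1) (waitExtra H₀ H₁ p j ph)
  | .returned _ => True

/-- An extension of a register history that has nothing to do with process `q`. -/
structure Extends {I : Type} (q : Fin n) (H H' : List (Event n (RegOp Val) (RegRes Val) I)) :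
    Prop where
  respondsAt : ∀ {i j r}, RespondsAt H i j r → RespondsAt H' i j r
  get : ∀ {i : ℕ} {e}, H[i]? = some e → H'[i]? = some e
  openAt : ∀ {m op}, OpenAt H q m op → OpenAt H' q m op

theorem Extends.refl {I : Type} {q : Fin n} {H : List (Event n (RegOp Val) (RegRes Val) I)} :
    Extends q H H := ⟨id, id, id⟩

theorem Extends.snoc {I : Type} {q : Fin n} {H : List (Event n (RegOp Val) (RegRes Val) I)}
    {e : Event n (RegOp Val) (RegRes Val) I} (h1 : ∀ op, e ≠ inv q op) (h2 : ∀ r, e ≠ res q r) :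
    Extends q H (H ++ [e]) where
  respondsAt h := h.snoc e
  get h := getElem?_snoc_of_some e h
  openAt h := h.snoc h1 h2

theorem Fresh.snoc {q : Fin n} {H : List (Event n (RegOp Val) (RegRes Val) I₀)}
    {e : Event n (RegOp Val) (RegRes Val) I₀} {b : ℕ} (hf : Fresh H q b)
    (h3 : q.val = 0 → ∀ p j, e = inv p (.write (some (j, false))) → j < b)
    (h4 : q.val = 1 → ∀ p j, e = inv p (.write (some (j, true))) → j < b) :
    Fresh (H ++ [e]) q b := by
  refine ⟨fun hq j hj => ?_, fun hq j hj => ?_⟩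
  · rcases hj.of_snoc with hj | ⟨p, hp⟩
    · exact hf.1 hq j hj
    · exact h3 hq p j hp
  · rcases hj.of_snoc with hj | ⟨p, hp⟩
    · exact hf.2 hq j hj
    · exact h4 hq p j hp

theorem Extends.wrote {I : Type} {q : Fin n} {H H' : List (Event n (RegOp Val) (RegRes Val) I)}
    (h : Extends q H H') {v : Val} (hv : Wrote H v) : Wrote H' v := by
  obtain ⟨i, p, hi⟩ := hv
  exact ⟨i, p, h.get hi⟩

theorem WriteDone.extends {q : Fin n} {H H' : List (Event n (RegOp Val) (RegRes Val) I₀)} {j : ℕ}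
    (hd : WriteDone H j) (h : Extends q H H') : WriteDone H' j := by
  obtain ⟨i, i', r, p, hr, hi⟩ := hd
  exact ⟨i, i', r, p, h.respondsAt hr, h.get hi⟩

/-- Apart from freshness, the invariant speaks of past invocations and responses and of an open
operation of `q` itself; events of other processes disturb none of these. -/
theorem LocalOK.extends {H₀ H₀' : List (Event n (RegOp Val) (RegRes Val) I₀)}
    {H₁ H₁' : List (Event n (RegOp Val) (RegRes Val) I₁)} {s : ℕ} {q : Fin n}
    {st : Status (sig σ) (State A) Out} (h : LocalOK A H₀ H₁ s q st) (h0 : Extends q H₀ H₀')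
    (h1 : Extends q H₁ H₁') (hf : ∀ b, Fresh H₀ q b → Fresh H₀' q b) :
    LocalOK A H₀' H₁' s q st := by
  rcases st with (⟨a, j, ph⟩ | s) | ⟨i | i, k⟩ | y
  · refine ⟨h.role, fun j' hj' => ?_, h.steps, hf _ h.fresh, ?_⟩
    · obtain ⟨b, hb⟩ := h.rounds j' hj'
      exact ⟨b, h1.wrote hb⟩
    · have he := h.extra
      cases ph with
      | flip => exact WriteDone.extends he h0
      | check c => exact WriteDone.extends he h0
      | read2 v =>
        obtain ⟨i, i', hr⟩ := he
        exact ⟨i, i', h0.respondsAt hr⟩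
      | announce b =>
        obtain ⟨i₁, i₁', i₂, i₂', r1, r2, r3⟩ := he
        exact ⟨i₁, i₁', i₂, i₂', h0.respondsAt r1, h0.respondsAt r2, r3⟩
      | write0 => trivial
      | write1 => trivial
      | listen => trivial
      | read1 => trivial
  · trivial
  · exact h
  · obtain ⟨a, j, ph, op, hn, h⟩ := h
    refine ⟨a, j, ph, op, hn, h.role, fun j' hj' => ?_, h.steps, hf _ h.fresh, ?_⟩
    · obtain ⟨b, hb⟩ := h.rounds j' hj'
      exact ⟨b, h1.wrote hb⟩
    · have he := h.extra
      cases ph with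
      | flip => exact he
      | check c => exact ⟨he.1.extends h0, he.2.imp fun m hm => h1.openAt hm⟩
      | read2 v =>
        obtain ⟨i, i', m, hr, hlt, hm⟩ := he
        exact ⟨i, i', m, h0.respondsAt hr, hlt, h0.openAt hm⟩
      | announce b => exact h1.wrote he
      | write0 => exact Exists.imp (fun m hm => h0.openAt hm) he
      | write1 => trivial
      | listen => exact Exists.imp (fun m hm => h1.openAt hm) he
      | read1 => exact Exists.imp (fun m hm => h0.openAt hm) he
  · trivial

/-- A budget of `8` steps per round is generous: at most `5` have been taken before the response
that ends the round. The value in `hw` accounts for the round just finished. -/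
theorem phaseOK_start {H₀ : List (Event n (RegOp Val) (RegRes Val) I₀)}
    {H₁ : List (Event n (RegOp Val) (RegRes Val) I₁)} {s : ℕ} {p : Fin n} {j : ℕ} {ph : Phase}
    {s' b : ℕ} {e : Prop} (h : PhaseOK H₀ H₁ s p j ph s' b e) (hs : s' < 8) (hb : b ≤ j + 1)
    {c : Bool} (hw : Wrote H₁ (some (j, c))) :
    PhaseOK H₀ H₁ (s + 1) p (j + 1) (start p) (rank (start p)) (roundBound (j + 1) (start p))
      (readyExtra H₀ (j + 1) (start p)) where
  role := roleOK_start p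
  rounds j' hj' := by
    rcases Nat.lt_succ_iff_lt_or_eq.1 hj' with h' | rfl
    · exact h.rounds j' h'
    · exact ⟨c, hw⟩
  steps := by
    have := h.steps
    omega
  fresh := h.fresh.mono (hb.trans (le_roundBound _ _))
  extra := by
    unfold start
    split <;> trivial

end CoinGame

/-! ### The invariant of configurations and its preservation -/

namespace CoinGame

open Algorithm Event

variable {n : ℕ} {σ : Signature} {In Out : Type} {A : Algorithm n σ In Out} {B : Objects n σ}
  {R : Fin 3 → SharedObject n (RegOp Val) (RegRes Val)}

/-- Invariant of the runs of the game with linearizable registers. -/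
structure Inv (C : Cfg A B R) : Prop where
  mem0 : C.hist (.inr 0) ∈ (R 0).histories
  mem1 : C.hist (.inr 1) ∈ (R 1).histories
  unique : UniqueWrites (C.hist (.inr 0))
  alternates : ∀ j b, Wrote (C.hist (.inr 1)) (some (j, b)) → Alternates (C.hist (.inr 0)) j b
  loc : ∀ p, LocalOK A (C.hist (.inr 0)) (C.hist (.inr 1)) (C.steps p) p (C.status p)

theorem inv_initial (x : Fin n → In) : Inv ((withGame A).initial (withRegs B R) x) where
  mem0 := (R 0).nil_mem
  mem1 := (R 1).nil_mem
  unique i i' p p' v h := by simp [initial] at h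
  alternates j b h := by
    obtain ⟨i, p, h⟩ := h
    simp [initial] at h
  loc p := by
    refine ⟨roleOK_start p, by simp, Nat.zero_le _, ⟨?_, ?_⟩, ?_⟩
    · rintro - j ⟨i, p, h⟩
      simp [initial] at h
    · rintro - j ⟨i, p, h⟩
      simp [initial] at h
    · unfold start
      split <;> trivial

section update

variable {C : Cfg A B R} {p : Fin n} {s' : Status (sig σ) (State A) Out}

theorem Inv.update (h : Inv C)
    (hloc : LocalOK A (C.hist (.inr 0)) (C.hist (.inr 1)) (C.steps p + 1) p s') :
    Inv (C.setStatus p s') where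
  mem0 := h.mem0
  mem1 := h.mem1
  unique := h.unique
  alternates := h.alternates
  loc q := by
    simp only [Config.setStatus_status, Config.setStatus_steps, Config.setStatus_hist]
    rcases eq_or_ne q p with rfl | hqp
    · simpa using hloc
    · simpa [hqp] using h.loc q

theorem Inv.congr (h : Inv C) {C' : Cfg A B R} (h0 : C'.hist (.inr 0) = C.hist (.inr 0))
    (h1 : C'.hist (.inr 1) = C.hist (.inr 1)) (h2 : C'.status = C.status)
    (h3 : C'.steps = C.steps) : Inv C' := by
  constructor
  · rw [h0]
    exact h.mem0
  · rw [h1]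
    exact h.mem1
  · rw [h0]
    exact h.unique
  · rw [h0, h1]
    exact h.alternates
  · rw [h0, h1, h2, h3]
    exact h.loc

/-- By `hw`, the bit `false` is written by process 0 only and `true` by process 1 only, so a write
by `p` does not affect the freshness of any other process. -/
theorem Inv.update0 (h : Inv C) {e : Event n (RegOp Val) (RegRes Val) (R 0).Internal}
    (hm : C.hist (.inr 0) ++ [e] ∈ (R 0).histories)
    (he : (∃ op, e = inv p op) ∨ ∃ r, e = res p r)
    (hw : ∀ v, e = inv p (.write v) → ¬ Wrote (C.hist (.inr 0)) v ∧
      ((∃ j, v = some (j, false) ∧ p.val = 0) ∨ ∃ j, v = some (j, true) ∧ p.val = 1))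
    (hloc : LocalOK A (C.hist (.inr 0) ++ [e]) (C.hist (.inr 1)) (C.steps p + 1) p s') :
    Inv ((C.addEvent (.inr 0) e).setStatus p s') := by
  have e0 : ((C.addEvent (.inr 0) e).setStatus p s').hist (.inr 0) = C.hist (.inr 0) ++ [e] :=
    addEvent_hist_inr C 0 e
  have e1 : ((C.addEvent (.inr 0) e).setStatus p s').hist (.inr 1) = C.hist (.inr 1) :=
    addEvent_hist_inr_of_ne C (by simp) e
  have hp : ∀ q op, e = inv q op → q = p := by
    rintro q op rfl
    rcases he with ⟨op', he⟩ | ⟨r, he⟩ <;> cases he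
    rfl
  constructor
  · rw [e0]
    exact hm
  · rw [e1]
    exact h.mem1
  · rw [e0]
    refine h.unique.snoc fun q v hq => ?_
    obtain rfl := hp q _ hq
    exact (hw v hq).1
  · rw [e0, e1]
    exact fun j b hj => (h.alternates j b hj).snoc e
  · intro q
    rw [e0, e1]
    simp only [Config.setStatus_status, Config.setStatus_steps, Config.addEvent_status,
      Config.addEvent_steps]
    rcases eq_or_ne q p with rfl | hqp
    · simpa using hloc
    · simp only [ne_eq, hqp, not_false_eq_true, Function.update_of_ne]
      have hqv : q.val ≠ p.val := fun h' => hqp (Fin.ext h')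
      refine (h.loc q).extends (.snoc ?_ ?_) .refl fun b hb => hb.snoc ?_ ?_
      · intro op hop
        exact hqp (hp q op hop)
      · rintro r rfl
        rcases he with ⟨op', he⟩ | ⟨r, he⟩ <;> cases he
        exact hqp rfl
      · intro hq q' j hj
        obtain rfl := hp q' _ hj
        rcases (hw _ hj).2 with ⟨j', hv, h0⟩ | ⟨j', hv, h0⟩
        · omega
        · simp at hv
      · intro hq q' j hj
        obtain rfl := hp q' _ hj
        rcases (hw _ hj).2 with ⟨j', hv, h0⟩ | ⟨j', hv, h0⟩
        · simp at hv
        · omega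

/-- By `hw`, a new announcement in register 1 is backed by alternating reads in the history of
register 0. -/
theorem Inv.update1 (h : Inv C) {e : Event n (RegOp Val) (RegRes Val) (R 1).Internal}
    (hm : C.hist (.inr 1) ++ [e] ∈ (R 1).histories)
    (he : (∃ op, e = inv p op) ∨ ∃ r, e = res p r)
    (hw : ∀ j b, e = inv p (.write (some (j, b))) → Alternates (C.hist (.inr 0)) j b)
    (hloc : LocalOK A (C.hist (.inr 0)) (C.hist (.inr 1) ++ [e]) (C.steps p + 1) p s') :
    Inv ((C.addEvent (.inr 1) e).setStatus p s') := by
  have e0 : ((C.addEvent (.inr 1) e).setStatus p s').hist (.inr 0) = C.hist (.inr 0) :=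
    addEvent_hist_inr_of_ne C (by simp) e
  have e1 : ((C.addEvent (.inr 1) e).setStatus p s').hist (.inr 1) = C.hist (.inr 1) ++ [e] :=
    addEvent_hist_inr C 1 e
  have hp : ∀ q op, e = inv q op → q = p := by
    rintro q op rfl
    rcases he with ⟨op', he⟩ | ⟨r, he⟩ <;> cases he
    rfl
  constructor
  · rw [e0]
    exact h.mem0
  · rw [e1]
    exact hm
  · rw [e0]
    exact h.unique
  · rw [e0, e1]
    intro j b hj
    rcases hj.of_snoc with hj | ⟨q, hq⟩
    · exact h.alternates j b hj
    · obtain rfl := hp q _ hq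
      exact hw j b hq
  · intro q
    rw [e0, e1]
    simp only [Config.setStatus_status, Config.setStatus_steps, Config.addEvent_status,
      Config.addEvent_steps]
    rcases eq_or_ne q p with rfl | hqp
    · simpa using hloc
    · simp only [ne_eq, hqp, not_false_eq_true, Function.update_of_ne]
      refine (h.loc q).extends .refl (.snoc ?_ ?_) fun b hb => hb
      · intro op hop
        exact hqp (hp q op hop)
      · rintro r rfl
        rcases he with ⟨op', he⟩ | ⟨r, he⟩ <;> cases he
        exact hqp rfl

theorem Inv.internal (h : Inv C) (i : (sig σ).Name) (e : (withRegs B R i).Internal)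
    (hm : C.hist i ++ [.tau e] ∈ (withRegs B R i).histories) : Inv (C.addEvent i (.tau e)) := by
  rcases i with i | i
  · exact h.congr (addEvent_inl_hist_inr C i _ 0) (addEvent_inl_hist_inr C i _ 1) rfl rfl
  · obtain rfl | rfl | rfl : i = 0 ∨ i = 1 ∨ i = 2 := by fin_cases i <;> simp
    · have e0 : (C.addEvent (.inr 0) (.tau e)).hist (.inr 0) = C.hist (.inr 0) ++ [tau e] :=
        addEvent_hist_inr C 0 _
      have e1 : (C.addEvent (.inr 0) (.tau e)).hist (.inr 1) = C.hist (.inr 1) :=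
        addEvent_hist_inr_of_ne C (by simp) _
      constructor
      · rw [e0]
        exact hm
      · rw [e1]
        exact h.mem1
      · rw [e0]
        exact h.unique.snoc (by simp)
      · rw [e0, e1]
        exact fun j b hj => (h.alternates j b hj).snoc _
      · intro q
        rw [e0, e1]
        exact (h.loc q).extends (.snoc (by simp) (by simp)) .refl
          fun b hb => hb.snoc (by simp) (by simp)
    · have e0 : (C.addEvent (.inr 1) (.tau e)).hist (.inr 0) = C.hist (.inr 0) :=
        addEvent_hist_inr_of_ne C (by simp) _
      have e1 : (C.addEvent (.inr 1) (.tau e)).hist (.inr 1) = C.hist (.inr 1) ++ [tau e] :=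
        addEvent_hist_inr C 1 _
      constructor
      · rw [e0]
        exact h.mem0
      · rw [e1]
        exact hm
      · rw [e0]
        exact h.unique
      · rw [e0, e1]
        intro j b hj
        rcases hj.of_snoc with hj | ⟨q, hq⟩
        · exact h.alternates j b hj
        · cases hq
      · intro q
        rw [e0, e1]
        exact (h.loc q).extends .refl (.snoc (by simp) (by simp)) fun b hb => hb
    · exact h.congr (addEvent_hist_inr_of_ne C (by simp) _)
        (addEvent_hist_inr_of_ne C (by simp) _) rfl rfl

end update

/-- The response to a pending read of a linearizable register. -/
theorem exists_val_of_read {R : SharedObject n (RegOp Val) (RegRes Val)}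
    (hR : R.IsLinearizable none) {H : List (Event n (RegOp Val) (RegRes Val) R.Internal)}
    {p : Fin n} {m : ℕ} {r : RegRes Val} (hm : H ++ [res p r] ∈ R.histories)
    (ho : OpenAt H p m .read) :
    ∃ v, r = .val v ∧ RespondsAt (H ++ [res p r]) m H.length (.val v) ∧
      (v = none ∨ Wrote (H ++ [res p r]) v) := by
  obtain ⟨f, hf⟩ := hR
  have hL := hf _ hm
  have hr := ho.respondsAt r
  cases r with
  | ack => exact absurd hr (hL.not_ack (getElem?_snoc_of_some _ ho.get))
  | val v => exact ⟨v, rfl, hr, hL.wrote_of_val hr⟩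

theorem inv_invoke {C : Cfg A B R} (h : Inv C) {p : Fin n} {a : In} {j : ℕ} {ph : Phase} {i op k}
    (hs : C.status p = .ready (.inl (a, j, ph))) (hn : gameNext A p a j ph = .invoke i op k)
    (hm : C.hist i ++ [.inv p op] ∈ (withRegs B R i).histories) :
    Inv ((C.addEvent i (.inv p op)).setStatus p (.waiting i k)) := by
  have hl := h.loc p
  rw [hs] at hl
  obtain ⟨role, rounds, steps, fresh, extra⟩ := hl
  cases ph with
  | write0 =>
    cases hn
    have hpend := ((R 0).wellFormed _ hm).enabled
    have hp0 : p.val = 0 := role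
    refine h.update0 hm (.inl ⟨_, rfl⟩) ?_
      ⟨a, j, .write0, _, rfl, role, rounds, ?_, ?_, _, OpenAt.of_inv hpend _⟩
    · rintro v hv
      simp only [inv.injEq, RegOp.write.injEq, true_and] at hv
      subst hv
      -- Before this write, process 0 has written only in rounds before `j`, so the value is new.
      exact ⟨fun hw => absurd (fresh.1 hp0 j hw) (lt_irrefl j), .inl ⟨j, rfl, hp0⟩⟩
    · omega
    · refine (fresh.mono (Nat.le_succ j)).snoc ?_ ?_
      · intro _ q j' hj'
        simp at hj'
        omega
      · intro _ q j' hj'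
        simp at hj'
  | flip => cases hn
  | check c =>
    cases hn
    have hpend := ((R 1).wellFormed _ hm).enabled
    refine h.update1 hm (.inl ⟨_, rfl⟩) (by simp)
      ⟨a, j, .check c, _, rfl, role, fun j' hj' => ?_, ?_, fresh, extra, _, OpenAt.of_inv hpend _⟩
    · exact (rounds j' hj').imp fun b hb => hb.snoc _
    · omega
  | write1 =>
    cases hn
    have hp0 : p.val = 1 := role
    refine h.update0 hm (.inl ⟨_, rfl⟩) ?_
      ⟨a, j, .write1, _, rfl, role, rounds, ?_, ?_, trivial⟩
    · rintro v hv
      simp only [inv.injEq, RegOp.write.injEq, true_and] at hv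
      subst hv
      exact ⟨fun hw => absurd (fresh.2 hp0 j hw) (lt_irrefl j), .inr ⟨j, rfl, hp0⟩⟩
    · omega
    · refine (fresh.mono (Nat.le_succ j)).snoc ?_ ?_
      · intro _ q j' hj'
        simp at hj'
      · intro _ q j' hj'
        simp at hj'
        omega
  | listen =>
    cases hn
    have hpend := ((R 1).wellFormed _ hm).enabled
    refine h.update1 hm (.inl ⟨_, rfl⟩) (by simp)
      ⟨a, j, .listen, _, rfl, role, fun j' hj' => ?_, ?_, fresh, _, OpenAt.of_inv hpend _⟩
    · exact (rounds j' hj').imp fun b hb => hb.snoc _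
    · omega
  | read1 =>
    cases hn
    have hpend := ((R 0).wellFormed _ hm).enabled
    refine h.update0 hm (.inl ⟨_, rfl⟩) (by simp)
      ⟨a, j, .read1, _, rfl, role, rounds, ?_, fresh.snoc (by simp) (by simp), _,
        OpenAt.of_inv hpend _⟩
    omega
  | read2 v =>
    cases hn
    have hpend := ((R 0).wellFormed _ hm).enabled
    obtain ⟨i, i', hr⟩ := extra
    refine h.update0 hm (.inl ⟨_, rfl⟩) (by simp)
      ⟨a, j, .read2 v, _, rfl, role, rounds, ?_, fresh.snoc (by simp) (by simp), i, i', _,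
        hr.snoc _, hr.lt_length, OpenAt.of_inv hpend _⟩
    omega
  | announce b =>
    cases hn
    refine h.update1 hm (.inl ⟨_, rfl⟩) ?_
      ⟨a, j, .announce b, _, rfl, role, fun j' hj' => ?_, ?_, fresh, wrote_snoc_self _ _ _⟩
    · intro j' b' hj'
      simp only [inv.injEq, RegOp.write.injEq, Option.some.injEq, Prod.mk.injEq, true_and] at hj'
      obtain ⟨rfl, rfl⟩ := hj'
      exact extra
    · exact (rounds j' hj').imp fun b hb => hb.snoc _
    · omega

/-- Linearizability enters through the reads: a value other than the initial one has been written. A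
process that passes a round after a read therefore witnesses an announcement, and process 2 obtains
its alternating pair from two successive reads. -/
theorem inv_respond (hR0 : (R 0).IsLinearizable none) (hR1 : (R 1).IsLinearizable none)
    {C : Cfg A B R} (h : Inv C) {p : Fin n} {i : Fin 3} {k r}
    (hs : C.status p = .waiting (.inr i) k)
    (hm : C.hist (.inr i) ++ [.res p r] ∈ (withRegs B R (.inr i)).histories) :
    Inv ((C.addEvent (.inr i) (.res p r)).setStatus p (.ready (k r))) := by
  have hl := h.loc p
  rw [hs] at hl
  obtain ⟨a, j, ph, op, hn, hl⟩ := hl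
  obtain ⟨role, rounds, steps, fresh, extra⟩ := id hl
  cases ph with
  | write0 =>
    cases hn
    obtain ⟨m, ho⟩ := extra
    refine h.update0 hm (.inr ⟨_, rfl⟩) (by simp)
      ⟨role, rounds, ?_, fresh.snoc (by simp) (by simp), m, _, r, p, ho.respondsAt r,
        getElem?_snoc_of_some _ ho.get⟩
    simp only [rank] at steps ⊢
    omega
  | flip => exact extra.elim
  | check c =>
    cases hn
    obtain ⟨hd, m, ho⟩ := extra
    obtain ⟨v, rfl, hr, hv⟩ := exists_val_of_read hR1 hm ho
    refine h.update1 hm (.inr ⟨_, rfl⟩) (by simp) ?_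
    simp only [afterCheck]
    split_ifs with hvj
    · subst hvj
      have hv := hv.resolve_left (by simp)
      exact phaseOK_start (ph := .check c) (s' := 4) (b := j + 1) (e := True)
        ⟨role, fun j' hj' => (rounds j' hj').imp fun b hb => hb.snoc _, steps, fresh, trivial⟩
        (by omega) le_rfl hv
    · trivial
  | write1 =>
    cases hn
    refine h.update0 hm (.inr ⟨_, rfl⟩) (by simp)
      ⟨?_, rounds, ?_, fresh.snoc (by simp) (by simp), trivial⟩
    · have : p.val = 1 := role
      exact ⟨by omega, by omega⟩
    · simp only [rank] at steps ⊢
      omega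
  | listen =>
    cases hn
    obtain ⟨m, ho⟩ := extra
    obtain ⟨v, rfl, hr, hv⟩ := exists_val_of_read hR1 hm ho
    refine h.update1 hm (.inr ⟨_, rfl⟩) (by simp) ?_
    simp only [afterListen]
    split_ifs with hvj
    · rcases v with _ | ⟨j', b⟩
      · simp at hvj
      obtain rfl : j' = j := by simpa using hvj
      have hv := hv.resolve_left (by simp)
      exact phaseOK_start (ph := .listen) (s' := 3) (b := j' + 1) (e := True)
        ⟨role, fun j' hj' => (rounds j' hj').imp fun b hb => hb.snoc _, steps, fresh, trivial⟩
        (by omega) le_rfl hv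
    · trivial
  | read1 =>
    cases hn
    obtain ⟨m, ho⟩ := extra
    obtain ⟨v, rfl, hr, hv⟩ := exists_val_of_read hR0 hm ho
    refine h.update0 hm (.inr ⟨_, rfl⟩) (by simp)
      ⟨role, rounds, ?_, fresh.snoc (by simp) (by simp), m, _, hr⟩
    simp only [rank] at steps ⊢
    omega
  | read2 v =>
    cases hn
    obtain ⟨i, i', m, hr1, hlt, ho⟩ := extra
    obtain ⟨w, rfl, hr, hv⟩ := exists_val_of_read hR0 hm ho
    refine h.update0 hm (.inr ⟨_, rfl⟩) (by simp) ?_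
    have key : ∀ b, v = some (j, b) → w = some (j, !b) →
        LocalOK A (C.hist (.inr 0) ++ [res p (.val w)]) (C.hist (.inr 1)) (C.steps p + 1) p
          (.ready (.inl (a, j, .announce b))) := by
      rintro b rfl rfl
      refine ⟨role, rounds, ?_, fresh.snoc (by simp) (by simp), i, i', m, _, hr1.snoc _, hr, hlt⟩
      simp only [rank] at steps ⊢
      omega
    simp only [afterRead2]
    split_ifs with h1 h2
    · exact key false h1.1 h1.2
    · exact key true h2.1 h2.2
    · trivial
  | announce b =>
    cases hn
    refine h.update1 hm (.inr ⟨_, rfl⟩) (by simp) ?_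
    exact phaseOK_start (ph := .announce b) (s' := 5) (b := j + 1) (e := True)
      ⟨role, fun j' hj' => (rounds j' hj').imp fun b hb => hb.snoc _, steps, fresh, trivial⟩
      (by omega) le_rfl (extra.snoc _)

theorem inv_exec (hR0 : (R 0).IsLinearizable none) (hR1 : (R 1).IsLinearizable none)
    (C : Cfg A B R) (v : Option A.Coin → ℕ) (d) (h : Inv C) : Inv (C.exec v d) := by
  suffices H : ∀ C' : Cfg A B R, C.Move v d C' → Inv C' from
    (H (C.effect v d) (C.move_effect v d)).congr rfl rfl rfl rfl
  intro C' hC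
  cases hC with
  | stay => exact h
  | invoke p s i op k hs hn hm =>
    rcases s with ⟨a, j, ph⟩ | s
    · exact inv_invoke h hs hn hm
    · change liftAction A (A.next p s) = _ at hn
      rcases hA : A.next p s with ⟨i, op, k⟩ | ⟨c, k⟩ | y <;> rw [hA] at hn <;> cases hn
      have h' : Inv (C.addEvent (.inl i) (.inv p op)) :=
        h.congr (addEvent_inl_hist_inr C i _ 0) (addEvent_inl_hist_inr C i _ 1) rfl rfl
      exact h'.update fun r => ⟨_, rfl⟩
  | flip p s c k hs hn =>
    refine h.update ?_
    rcases s with ⟨a, j, ph⟩ | s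
    · have hl := h.loc p
      rw [hs] at hl
      cases ph <;> cases hn
      refine ⟨hl.role, hl.rounds, ?_, hl.fresh, hl.extra⟩
      have := hl.steps
      simp only [rank] at this ⊢
      omega
    · change liftAction A (A.next p s) = _ at hn
      rcases hA : A.next p s with ⟨i, op, k⟩ | ⟨c, k⟩ | y <;> rw [hA] at hn <;> cases hn
      trivial
  | ret p s y hs hn => exact h.update trivial
  | again p y hs => exact h.update trivial
  | respond p i k r hs hm =>
    rcases i with i | i
    · have h' : Inv (C.addEvent (.inl i) (.res p r)) :=
        h.congr (addEvent_inl_hist_inr C i _ 0) (addEvent_inl_hist_inr C i _ 1) rfl rfl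
      refine h'.update ?_
      have hl := h.loc p
      rw [hs] at hl
      obtain ⟨s, hk⟩ := hl r
      rw [hk]
      trivial
    · exact inv_respond hR0 hR1 h hs hm
  | internal i e hm => exact h.internal i e hm

end CoinGame

/-! ### Termination with write strongly-linearizable registers: the value of the game -/

namespace CoinGame

open Algorithm Event
open scoped ENNReal

variable {n : ℕ} {σ : Signature} {In Out : Type} {A : Algorithm n σ In Out} {B : Objects n σ}
  {R : Fin 3 → SharedObject n (RegOp Val) (RegRes Val)}

/-- The weight of a local state of process `0`, where `l` lists the writes to register `0`: it is
twice the weight of the previous round if the coin agrees with the first write of the round, and `0`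
if it does not. -/
noncomputable def weight (l : List Val) : State A → ℝ≥0∞
  | .inl (_, j, .check c) => if firstOf j l = some (some (j, c)) then 2 ^ (j + 1) else 0
  | .inl (_, j, _) => 2 ^ j
  | .inr _ => 0

@[simp] theorem weight_start (l : List Val) (p : Fin n) (a : In) (j : ℕ) :
    weight (A := A) l (.inl (a, j, start p)) = 2 ^ j := by
  unfold start
  split <;> rfl

/-- The weight of a status of process `0`. -/
noncomputable def statusWeight (l : List Val) : Status (sig σ) (State A) Out → ℝ≥0∞
  | .ready s => weight l s
  | .waiting (.inr _) k => weight l (k (RegRes.ack (V := Val)))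
  | .waiting (.inl _) _ => 0
  | .returned _ => 0

variable (f : List (Event n (RegOp Val) (RegRes Val) (R 0).Internal) → List (SeqOp n Val))
  (p₀ : Fin n)

/-- The weight of process `p₀` in a configuration, according to the linearizations `f`. -/
noncomputable def mass (C : Cfg A B R) : ℝ≥0∞ :=
  statusWeight (seqVals (f (C.hist (.inr 0)))) (C.status p₀)

/-- A linearization function such that the writes are extended only at the end. -/
structure WriteStrong : Prop where
  linearization : (R 0).IsLinearizationFunction none f
  mono : ∀ G ∈ (R 0).histories, ∀ H ∈ (R 0).histories, G <+: H →
    SeqOp.writes (f G) <+: SeqOp.writes (f H)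

variable {f p₀}

theorem WriteStrong.seqVals_prefix (hf : WriteStrong f) {G H} (hG : G ∈ (R 0).histories)
    (hH : H ∈ (R 0).histories) (h : G <+: H) : seqVals (f G) <+: seqVals (f H) := by
  rw [← seqVals_writes (f G), ← seqVals_writes (f H)]
  exact (hf.mono G hG H hH h).filterMap _

/-- Here write strong-linearizability does its work: once the write of process 0 is complete, no
continuation can change which write of round `j` is first. -/
theorem WriteStrong.firstOf_eq (hf : WriteStrong f) {G H} (hG : G ∈ (R 0).histories)
    (hH : H ∈ (R 0).histories) (h : G <+: H) {j : ℕ} (hd : WriteDone G j) :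
    firstOf j (seqVals (f H)) = firstOf j (seqVals (f G)) :=
  firstOf_of_prefix (hf.seqVals_prefix hG hH h) (hd.mem (hf.linearization G hG))

/-- The weight of a process does not change while the history of the register is extended. -/
theorem WriteStrong.statusWeight_eq (hf : WriteStrong f) {C : Cfg A B R} (h : Inv C)
    {H} (hH : H ∈ (R 0).histories) (hp : C.hist (.inr 0) <+: H) :
    statusWeight (seqVals (f H)) (C.status p₀) = mass f p₀ C := by
  have hl := h.loc p₀
  rw [mass]
  rcases hs : C.status p₀ with (⟨a, j, ph⟩ | s) | ⟨i | i, k⟩ | y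
  · rw [hs] at hl
    cases ph with
    | check c => simp only [statusWeight, weight, hf.firstOf_eq h.mem0 hH hp hl.extra]
    | _ => rfl
  · rfl
  · rfl
  · rw [hs] at hl
    obtain ⟨a, j, ph, op, hn, hl⟩ := hl
    cases ph with
    | check c =>
      cases hn
      simp only [statusWeight, weight, afterCheck, hf.firstOf_eq h.mem0 hH hp hl.extra.1]
    | announce b =>
      cases hn
      simp only [statusWeight, weight_start]
    | _ => cases hn <;> rfl
  · rfl

theorem WriteStrong.mass_eq (hf : WriteStrong f) {C C' : Cfg A B R} (h : Inv C) (h' : Inv C')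
    (hs : C'.status p₀ = C.status p₀) (hp : C.hist (.inr 0) <+: C'.hist (.inr 0)) :
    mass f p₀ C' = mass f p₀ C := by
  rw [← hf.statusWeight_eq h h'.mem0 hp, mass, hs]

/-- The flip of the coin of the game doubles the mass for one of the two outcomes. -/
theorem mass_exec_of_flips (hf : WriteStrong f) (hp₀ : p₀.val = 0) {C : Cfg A B R} (h : Inv C)
    {d} (hd : C.Flips d none) : ∃ b : Bool, ∀ v,
      mass f p₀ (C.exec v d) = if decide (v none = 1) = b then 2 * mass f p₀ C else 0 := by
  obtain ⟨p, s, k, rfl, hs, hn⟩ := hd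
  rcases s with ⟨a, j, ph⟩ | s
  · have hl := h.loc p
    rw [hs] at hl
    cases ph <;> cases hn
    obtain rfl : p = p₀ := Fin.ext (Eq.trans (b := 0) hl.role hp₀.symm)
    have hm := WriteDone.mem hl.extra (hf.linearization _ h.mem0)
    -- As the write of process 0 is complete, some value of round `j` is already first; its bit `b`
    -- is determined before the coin is flipped.
    have h1 : ((seqVals (f (C.hist (.inr 0)))).find?
        fun v => decide (v.map Prod.fst = some j)).isSome := by
      rw [List.find?_isSome]
      exact ⟨_, hm, by simp⟩
    obtain ⟨w, hw⟩ := Option.isSome_iff_exists.1 h1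
    have h2 := List.find?_some hw
    rcases w with _ | ⟨j', b⟩
    · simp at h2
    obtain rfl : j' = j := by simpa using h2
    refine ⟨b, fun v => ?_⟩
    have e1 : (C.exec v (.step p)).status p = .ready (.inl (a, j', .check (decide (v none = 1)))) := by
      rw [Config.exec_status, Config.effect_step_flip hs rfl]
      simp
    have e2 : (C.exec v (.step p)).hist (.inr 0) = C.hist (.inr 0) := by
      rw [Config.exec_hist, Config.effect_step_flip hs rfl]
      rfl
    have h3 : firstOf j' (seqVals (f (C.hist (.inr 0)))) = some (some (j', b)) := hw
    simp only [mass, e1, e2, hs, statusWeight, weight, h3, pow_succ']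
    congr 1
    simp [eq_comm]
  · change liftAction A (A.next p s) = _ at hn
    rcases hA : A.next p s with ⟨i, op, k⟩ | ⟨c, k⟩ | y <;> rw [hA] at hn <;> cases hn

/-- Without a flip of the coin of the game, the mass stays the same or gets lost. -/
theorem mass_exec_of_not_flips (hf : WriteStrong f) (hp₀ : p₀.val = 0)
    (hR0 : (R 0).IsLinearizable none) (hR1 : (R 1).IsLinearizable none) {C : Cfg A B R} (h : Inv C)
    {d} (hd : ¬ C.Flips d none) (v) :
    mass f p₀ (C.exec v d) = mass f p₀ C ∨ mass f p₀ (C.exec v d) = 0 := by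
  have h' := inv_exec hR0 hR1 C v d h
  have hpre : C.hist (.inr 0) <+: (C.exec v d).hist (.inr 0) := hist_prefix_exec C v d _
  have hlin := hf.linearization _ h'.mem0
  have hm := hf.statusWeight_eq (p₀ := p₀) h h'.mem0 hpre
  by_cases hst : (C.exec v d).status p₀ = C.status p₀
  · exact .inl (hf.mass_eq h h' hst hpre)
  -- Both weights now refer to the history after the step, so only the change in the status of `p₀`
  -- remains to be examined.
  rw [← hm, mass]
  have hl := h.loc p₀
  have key : ∀ C' : Cfg A B R, (C.exec v d).status = C'.status →
      (∀ i, (C.exec v d).hist i = C'.hist i) → C.Move v d C' →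
      statusWeight (seqVals (f ((C.exec v d).hist (.inr 0)))) (C'.status p₀) =
        statusWeight (seqVals (f ((C.exec v d).hist (.inr 0)))) (C.status p₀) ∨
      statusWeight (seqVals (f ((C.exec v d).hist (.inr 0)))) (C'.status p₀) = 0 := by
    intro C' hC' hH hC
    rw [hC'] at hst
    have hp : ∀ (D : Cfg A B R) p s', D.status = C.status → (D.setStatus p s') = C' → p = p₀ := by
      rintro D p s' hD rfl
      by_contra hne
      exact hst (by simp [Function.update_of_ne (Ne.symm hne), hD])
    cases hC with
    | stay => exact absurd rfl hst
    | invoke p s i op k hs hn hm =>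
      obtain rfl := hp (C.addEvent i _) p _ rfl rfl
      simp only [Config.setStatus_status, Function.update_self, hs]
      rcases s with ⟨a, j, ph⟩ | s
      · left
        rw [hs] at hl
        have hrole := hl.role
        cases ph with
        | announce b =>
          simp only [roleOK] at hrole
          omega
        | _ => cases hn <;> rfl
      · right
        change liftAction A (A.next p s) = _ at hn
        rcases hA : A.next p s with ⟨i, op, k⟩ | ⟨c, k⟩ | y <;> rw [hA] at hn <;> cases hn
        rfl
    | flip p s c k hs hn hd' =>
      obtain rfl := hp _ p _ rfl rfl
      simp only [Config.setStatus_status, Function.update_self, hs]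
      rcases s with ⟨a, j, ph⟩ | s
      · exfalso
        cases ph <;> cases hn
        exact hd ⟨p, _, _, hd', hs, rfl⟩
      · right
        change liftAction A (A.next p s) = _ at hn
        rcases hA : A.next p s with ⟨i, op, k⟩ | ⟨c, k⟩ | y <;> rw [hA] at hn <;> cases hn
        rfl
    | ret p s y hs hn =>
      obtain rfl := hp _ p _ rfl rfl
      right
      simp [statusWeight]
    | again p y hs =>
      obtain rfl := hp _ p _ rfl rfl
      right
      simp [statusWeight]
    | respond p i k r hs hm' =>
      obtain rfl := hp (C.addEvent i _) p _ rfl rfl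
      rw [hs] at hl
      simp only [Config.setStatus_status, Function.update_self, hs]
      rcases i with i | i
      · obtain ⟨s, hk⟩ := hl r
        right
        rw [hk]
        rfl
      obtain ⟨a, j, ph, op, hn, hl⟩ := hl
      have hrole := hl.role
      cases ph with
      | write0 =>
        cases hn
        exact .inl rfl
      | flip => exact hl.extra.elim
      | check c =>
        cases hn
        obtain ⟨-, m, ho⟩ := hl.extra
        obtain ⟨w, rfl, -, hv⟩ := exists_val_of_read hR1 hm' ho
        simp only [afterCheck]
        split_ifs with hvj
        · left
          subst hvj
          have h1 : Wrote ((C.exec v d).hist (.inr 1)) (some (j, c)) := by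
            rw [hH, Config.setStatus_hist, addEvent_hist_inr]
            exact hv.resolve_left (by simp)
          -- Process 0 passes only if its bit `c` was announced, hence seen first in alternating
          -- reads, hence written first. So its weight is already `2 ^ (j + 1)`, as in the next
          -- round.
          have h2 := (h'.alternates j c h1).firstOf hlin h'.unique
          simp only [statusWeight, afterCheck, weight_start]
          rw [weight, h2, if_pos rfl]
        · exact .inr rfl
      | write1 | listen | read1 | read2 | announce =>
        simp only [roleOK] at hrole
        omega
    | internal i e hm => exact absurd rfl hst
  have := key (C.effect v d) rfl (fun _ => rfl) (C.move_effect v d)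
  exact this

end CoinGame

/-! ### Termination with write strongly-linearizable registers -/

namespace CoinGame

open Algorithm Event MeasureTheory
open scoped ENNReal

variable {n : ℕ} {σ : Signature} {In Out : Type} {A : Algorithm n σ In Out} {B : Objects n σ}
  {R : Fin 3 → SharedObject n (RegOp Val) (RegRes Val)}

theorem lintegral_fairCoin (F : ℕ → ℝ≥0∞) :
    ∫⁻ m, F m ∂fairCoin.toMeasure = (F 0 + F 1) / 2 := by
  have hF : Measurable F := .of_discrete
  have hb : Measurable fun b : Bool => b.toNat := .of_discrete
  rw [fairCoin, ← PMF.toMeasure_map _ _ hb, lintegral_map hF hb, lintegral_fintype]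
  simp only [Fintype.sum_bool, PMF.toMeasure_apply_singleton _ _ (MeasurableSet.of_discrete),
    PMF.uniformOfFintype_apply, Fintype.card_bool, Bool.toNat_true, Bool.toNat_false]
  rw [← add_mul, add_comm, ENNReal.div_eq_inv_mul, mul_comm]
  rfl

/-- The liminf of a sequence that can only double, stay in place or collapse to `0`, and that takes
all powers of two as values, is infinite. -/
theorem liminf_eq_top_of_doubling {M : ℕ → ℝ≥0∞} (h0 : M 0 = 1) (h2 : ∀ t, M (t + 1) ≤ 2 * M t)
    (hz : ∀ t, M t ≤ M (t + 1) ∨ M (t + 1) = 0) (hM : ∀ j : ℕ, ∃ t, M t = 2 ^ j) :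
    Filter.liminf M Filter.atTop = ⊤ := by
  have hle : ∀ t, M t ≤ 2 ^ t := fun t => by
    induction t with
    | zero => simp [h0]
    | succ t ih =>
      rw [pow_succ']
      exact (h2 t).trans (mul_le_mul_right ih 2)
  have habs : ∀ s t, s ≤ t → M s = 0 → M t = 0 := fun s t hst hs => by
    induction hst with
    | refl => exact hs
    | @step t _ ih =>
      have := h2 t
      rwa [ih, mul_zero, nonpos_iff_eq_zero] at this
  -- The value `2 ^ t` cannot be taken before time `t`, since `M` at most doubles; and if `M t = 0`,
  -- it cannot be taken later either, since `0` is absorbing.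
  have hne : ∀ t, M t ≠ 0 := fun t ht => by
    obtain ⟨s, hs⟩ := hM t
    have h1 : (2 : ℝ≥0∞) ^ t ≤ 2 ^ s := hs ▸ hle s
    have hts : t ≤ s := (Nat.pow_le_pow_iff_right one_lt_two).1 (by exact_mod_cast h1)
    have h3 := hs.symm.trans (habs t s hts ht)
    exact (pow_ne_zero t two_ne_zero) h3
  have hmono : Monotone M := monotone_nat_of_le_succ fun t => (hz t).resolve_right (hne _)
  rw [(tendsto_atTop_iSup hmono).liminf_eq]
  refine ENNReal.eq_top_of_forall_nnreal_le fun r => ?_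
  obtain ⟨k, hk⟩ := exists_nat_gt r
  obtain ⟨t, ht⟩ := hM k
  refine le_trans ?_ (le_iSup M t)
  rw [ht]
  have h1 : (r : ℝ≥0∞) ≤ (k : ℕ) := by exact_mod_cast hk.le
  refine h1.trans ?_
  exact_mod_cast Nat.lt_two_pow_self.le

variable {f : List (Event n (RegOp Val) (RegRes Val) (R 0).Internal) → List (SeqOp n Val)}
  {p₀ : Fin n}

/-- The mass is a supermartingale. -/
theorem lintegral_mass_exec_le (hf : WriteStrong f) (hp₀ : p₀.val = 0)
    (hR0 : (R 0).IsLinearizable none) (hR1 : (R 1).IsLinearizable none) {C : Cfg A B R} (h : Inv C)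
    (d) (v : ℕ → Option A.Coin → ℕ) (hv : ∀ m, v m none = m) :
    ∫⁻ m, mass f p₀ (C.exec (v m) d) ∂fairCoin.toMeasure ≤ mass f p₀ C := by
  by_cases hd : C.Flips d none
  · obtain ⟨b, hb⟩ := mass_exec_of_flips hf hp₀ h hd
    simp only [lintegral_fairCoin, hb, hv]
    have h2 : 2 * mass f p₀ C / 2 = mass f p₀ C := by
      rw [mul_comm, ENNReal.mul_div_cancel_right two_ne_zero ENNReal.ofNat_ne_top]
    cases b <;> simp [h2]
  · calc ∫⁻ m, mass f p₀ (C.exec (v m) d) ∂fairCoin.toMeasure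
        ≤ ∫⁻ _, mass f p₀ C ∂fairCoin.toMeasure := lintegral_mono fun m => by
          rcases mass_exec_of_not_flips hf hp₀ hR0 hR1 h hd (v m) with h | h <;> simp [h]
      _ = mass f p₀ C := by simp

/-- Process `0` is about to write `some (j, false)` when this write is invoked. -/
theorem mass_eq_of_wrote (hp₀ : p₀.val = 0) {C : Cfg A B R} (h : Inv C) {v d} {j : ℕ}
    (hw : Wrote ((C.exec v d).hist (.inr 0)) (some (j, false))) :
    Wrote (C.hist (.inr 0)) (some (j, false)) ∨ mass f p₀ C = 2 ^ j := by
  suffices H : ∀ C' : Cfg A B R, C.Move v d C' → Wrote (C'.hist (.inr 0)) (some (j, false)) →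
      Wrote (C.hist (.inr 0)) (some (j, false)) ∨ mass f p₀ C = 2 ^ j from
    H _ (C.move_effect v d) hw
  have aux : ∀ i e, Wrote ((C.addEvent i e).hist (.inr 0)) (some (j, false)) →
      Wrote (C.hist (.inr 0)) (some (j, false)) ∨
        ∃ q : Fin n, HEq e (inv (Res := RegRes Val) (Intl := (R 0).Internal) q
          (RegOp.write (some (j, false) : Val))) ∧ i = .inr 0 := by
    intro i e hw
    by_cases hi : i = .inr 0
    · subst hi
      rw [addEvent_hist_inr] at hw
      exact hw.of_snoc.imp_right fun ⟨p, hp⟩ => ⟨p, heq_of_eq hp, rfl⟩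
    · rw [Config.addEvent_hist_of_ne C (Ne.symm hi)] at hw
      exact .inl hw
  intro C' hC hw
  cases hC with
  | stay => exact .inl hw
  | invoke p s i op k hs hn hm =>
    rcases aux i _ hw with hw | ⟨q, he, hi⟩
    · exact .inl hw
    · subst hi
      rcases s with ⟨a, j', ph⟩ | s
      · cases ph <;> cases hn <;> cases he
        have hl := h.loc p
        rw [hs] at hl
        obtain rfl : p = p₀ := Fin.ext (Eq.trans (b := 0) hl.role hp₀.symm)
        right
        simp only [mass, hs, statusWeight, weight]
      · change liftAction A (A.next p s) = _ at hn
        rcases hA : A.next p s with ⟨i, op, k⟩ | ⟨c, k⟩ | y <;> rw [hA] at hn <;> cases hn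
  | flip p s c k hs hn hd => exact .inl hw
  | ret p s y hs hn => exact .inl hw
  | again p y hs => exact .inl hw
  | respond p i k r hs hm =>
    rcases aux i _ hw with hw | ⟨q, he, hi⟩
    · exact .inl hw
    · subst hi
      cases he
  | internal i e hm =>
    rcases aux i _ hw with hw | ⟨q, he, hi⟩
    · exact .inl hw
    · subst hi
      cases he

/-- A process in the game has taken a bounded number of steps per announced bit. -/
theorem wrote_of_steps {C : Cfg A B R} (h : Inv C) {p : Fin n} (hp : ¬ Left C p) {j : ℕ}
    (hj : 8 * j + 14 ≤ C.steps p) : ∃ b, Wrote (C.hist (.inr 1)) (some (j, b)) := by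
  -- In round `j'` of the game, at most `8 * j' + 5` steps have been taken, so the assumed number
  -- forces `j < j'`.
  have hrank : ∀ ph, rank ph ≤ 4 := fun ph => by cases ph <;> simp [rank]
  have hl := h.loc p
  rcases hs : C.status p with (⟨a, j', ph⟩ | s) | ⟨i | i, k⟩ | y
  · rw [hs] at hl
    have := hl.steps
    have := hrank ph
    exact hl.rounds j (by omega)
  · exact absurd (.inl ⟨s, hs⟩) hp
  · exact absurd (.inr (.inl ⟨i, k, hs⟩)) hp
  · rw [hs] at hl
    obtain ⟨a, j', ph, op, -, hl⟩ := hl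
    have := hl.steps
    have := hrank ph
    exact hl.rounds j (by omega)
  · exact absurd (.inr (.inr ⟨y, hs⟩)) hp

section run

variable (x : Fin n → In) (S : (withGame A).Adversary (withRegs B R))

theorem lintegral_mass_run_le (hf : WriteStrong f) (hp₀ : p₀.val = 0)
    (hR0 : (R 0).IsLinearizable none) (hR1 : (R 1).IsLinearizable none) (t : ℕ) :
    ∫⁻ ω, mass f p₀ ((withGame A).run (withRegs B R) x S ω t) ∂(withGame A).coinMeasure ≤ 1 := by
  classical
  have hprob : IsProbabilityMeasure (withGame A).coinMeasure := by
    unfold coinMeasure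
    infer_instance
  induction t with
  | zero => simp [run, initial, mass, statusWeight]
  | succ t ih =>
    refine le_trans ?_ ih
    unfold coinMeasure
    -- The configuration at time `t`, and with it the decision of the adversary, does not depend on
    -- the game coin of time `t`. Integrating over this coordinate first reduces the claim to a
    -- single step.
    rw [lintegral_infinitePi_update _ (t, none)
      (measurable_comp_run (A := withGame A) (B := withRegs B R) x S (t + 1) (mass f p₀))]
    refine lintegral_mono fun ω => ?_
    have hrun : ∀ m, (withGame A).run (withRegs B R) x S (Function.update ω (t, none) m) t =
        (withGame A).run (withRegs B R) x S ω t := fun m =>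
      run_congr x S fun s c hs => Function.update_of_ne (by simp [hs.ne]) _ _
    simp only [run, hrun]
    exact lintegral_mass_exec_le hf hp₀ hR0 hR1
      (run_induction x S (inv_initial x) (inv_exec hR0 hR1) ω t) _ _ fun m => by simp

/-- By Fatou, the liminf of the mass has expectation at most `1` and is almost surely finite,
whereas taking all powers of two makes it infinite. -/
theorem ae_not_unbounded (hf : WriteStrong f) (hp₀ : p₀.val = 0)
    (hR0 : (R 0).IsLinearizable none) (hR1 : (R 1).IsLinearizable none) :
    ∀ᵐ ω ∂(withGame A).coinMeasure,
      ¬ ∀ j : ℕ, ∃ t, mass f p₀ ((withGame A).run (withRegs B R) x S ω t) = 2 ^ j := by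
  have hmeas : ∀ t, Measurable fun ω => mass f p₀ ((withGame A).run (withRegs B R) x S ω t) :=
    fun t => measurable_comp_run (A := withGame A) (B := withRegs B R) x S t (mass f p₀)
  have hfatou := lintegral_liminf_le (μ := (withGame A).coinMeasure) (u := Filter.atTop) hmeas
  have hlim : Filter.liminf (fun t => ∫⁻ ω, mass f p₀ ((withGame A).run (withRegs B R) x S ω t)
      ∂(withGame A).coinMeasure) Filter.atTop ≤ 1 :=
    Filter.liminf_le_of_frequently_le'
      (Filter.Frequently.of_forall fun t => lintegral_mass_run_le x S hf hp₀ hR0 hR1 t)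
  have hfin := ae_lt_top (Measurable.liminf hmeas) ((hfatou.trans hlim).trans_lt ENNReal.one_lt_top).ne
  filter_upwards [hfin] with ω hω hM
  have hinv := run_induction x S (inv_initial x) (inv_exec hR0 hR1) ω
  refine hω.ne (liminf_eq_top_of_doubling ?_ (fun t => ?_) (fun t => ?_) hM)
  · simp [run, initial, mass, statusWeight]
  · by_cases hd : ((withGame A).run (withRegs B R) x S ω t).Flips
        (S ((withGame A).run (withRegs B R) x S ω t)) none
    · obtain ⟨b, hb⟩ := mass_exec_of_flips hf hp₀ (hinv t) hd
      rw [run, hb]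
      split_ifs <;> simp
    · rw [run]
      rcases mass_exec_of_not_flips hf hp₀ hR0 hR1 (hinv t) hd fun c => ω (t, c) with h | h
      · rw [h, two_mul]
        exact le_self_add
      · simp [h]
  · by_cases hd : ((withGame A).run (withRegs B R) x S ω t).Flips
        (S ((withGame A).run (withRegs B R) x S ω t)) none
    · obtain ⟨b, hb⟩ := mass_exec_of_flips hf hp₀ (hinv t) hd
      rw [run, hb]
      split_ifs
      · left
        rw [two_mul]
        exact le_self_add
      · exact .inr rfl
    · rw [run]
      rcases mass_exec_of_not_flips hf hp₀ hR0 hR1 (hinv t) hd fun c => ω (t, c) with h | h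
      · exact .inl h.ge
      · exact .inr h

/-- Every correct process finishes the game almost surely. -/
theorem ae_left (hf : WriteStrong f) (hp₀ : p₀.val = 0)
    (hR0 : (R 0).IsLinearizable none) (hR1 : (R 1).IsLinearizable none) :
    ∀ᵐ ω ∂(withGame A).coinMeasure, ∀ p,
      Algorithm.IsCorrect ((withGame A).run (withRegs B R) x S ω) p →
      ∃ t, Left ((withGame A).run (withRegs B R) x S ω t) p := by
  filter_upwards [ae_not_unbounded x S hf hp₀ hR0 hR1] with ω hω p hp
  by_contra! hleft
  have hinv := run_induction x S (inv_initial x) (inv_exec hR0 hR1) ω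
  -- A process with infinitely many steps that stays in the game passes every round. So round `j` is
  -- announced, process 0 has written in it, and when this write was invoked the mass was `2 ^ j`.
  refine hω fun j => ?_
  have hmass : ∀ t, Wrote (((withGame A).run (withRegs B R) x S ω t).hist (.inr 0))
      (some (j, false)) → ∃ s, mass f p₀ ((withGame A).run (withRegs B R) x S ω s) = 2 ^ j := by
    intro t
    induction t with
    | zero =>
      rintro ⟨i, q, hi⟩
      simp [run, initial] at hi
    | succ t ih =>
      intro hw
      exact (mass_eq_of_wrote hp₀ (hinv t) hw).elim ih fun h => ⟨t, h⟩
  obtain ⟨t, ht⟩ := hp (8 * j + 14)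
  obtain ⟨b, hb⟩ := wrote_of_steps (hinv t) (hleft t) ht
  exact hmass t (((hinv t).alternates j b hb).wrote (hf.linearization _ (hinv t).mem0))

end run

theorem withGame_terminates (hn : 0 < n) {T : DistributedTask n In Out}
    (h : A.TerminatesAlmostSurely B T) (hR : ∀ i, (R i).IsWriteStronglyLinearizable none) :
    (withGame A).TerminatesAlmostSurely (withRegs B R) T := by
  intro x hx S
  obtain ⟨f, hf, hmono⟩ := hR 0
  obtain ⟨g, hg, -⟩ := hR 1
  filter_upwards [ae_returns_of_left x S h hx,
    ae_left (p₀ := ⟨0, hn⟩) x S ⟨hf, hmono⟩ rfl ⟨f, hf⟩ ⟨g, hg⟩] with ω h1 h2 p hp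
  exact h1 p hp (h2 p hp)

/-! ### Transfer to the interface with three added registers -/

theorem sig_eq (σ : Signature) : σ.addRegisters (fun _ => Val) = sig σ := by
  unfold sig Signature.addRegisters
  congr 1
  · funext i
    cases i <;> rfl
  · funext i
    cases i <;> rfl

/-- `sig` spells out by cases what `addRegisters` expresses with `Sum.elim`. The interfaces are
proved equal by extensionality, so the two families of objects are compared heterogeneously. -/
theorem addRegisters_heq (B : Objects n σ) (R : Fin 3 → SharedObject n (RegOp Val) (RegRes Val)) :
    HEq (B.addRegisters R) (withRegs B R) := by
  refine Function.hfunext rfl fun i i' hi => ?_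
  obtain rfl := eq_of_heq hi
  cases i <;> rfl

/-- Properties of an algorithm can be transferred to an equal interface. -/
theorem transfer {σ₁ σ₂ : Signature} (h : σ₁ = σ₂) (A : Algorithm n σ₂ In Out) :
    ∃ A' : Algorithm n σ₁ In Out, ∀ (P : ∀ σ, Algorithm n σ In Out → Objects n σ → Prop)
      (B₁ : Objects n σ₁) (B₂ : Objects n σ₂), HEq B₁ B₂ → P σ₂ A B₂ → P σ₁ A' B₁ := by
  subst h
  refine ⟨A, fun P B₁ B₂ hB h => ?_⟩
  rwa [eq_of_heq hB]

end CoinGame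

theorem mainTheorem4 {n : ℕ} (hn : 3 ≤ n) {In Out : Type} (T : DistributedTask n In Out)
    {σ : Signature} (B : Objects n σ) (A : Algorithm n σ In Out)
    (hsolves : A.Solves B T) (hterm : A.TerminatesAlmostSurely B T) :
    ∃ (V : Fin 3 → Type) (v₀ : ∀ i, V i) (A' : Algorithm n (σ.addRegisters V) In Out),
      (∀ R : ∀ i, SharedObject n (RegOp (V i)) (RegRes (V i)),
        (∀ i, (R i).IsLinearizable (v₀ i)) →
          A'.Solves (B.addRegisters R) T) ∧
      (∀ R : ∀ i, SharedObject n (RegOp (V i)) (RegRes (V i)),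
        (∀ i, (R i).IsOnlyLinearizable (v₀ i)) →
          A'.AdversaryPreventsTermination (B.addRegisters R) T) ∧
      (∀ R : ∀ i, SharedObject n (RegOp (V i)) (RegRes (V i)),
        (∀ i, (R i).IsWriteStronglyLinearizable (v₀ i)) →
          A'.TerminatesAlmostSurely (B.addRegisters R) T) := by
  -- One algorithm has to serve all three claims, so it is chosen before the property to be
  -- transferred.
  obtain ⟨A', hA'⟩ := CoinGame.transfer (CoinGame.sig_eq σ) (CoinGame.withGame A)
  refine ⟨fun _ => CoinGame.Val, fun _ => none, A', fun R _ => ?_, fun R hR => ?_, fun R hR => ?_⟩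
  · exact hA' (fun _ A B => A.Solves B T) _ _ (CoinGame.addRegisters_heq B R)
      (CoinGame.withGame_solves T hsolves)
  · exact hA' (fun _ A B => A.AdversaryPreventsTermination B T) _ _ (CoinGame.addRegisters_heq B R)
      (CoinGame.withGame_adversaryPreventsTermination hn T hR)
  · exact hA' (fun _ A B => A.TerminatesAlmostSurely B T) _ _ (CoinGame.addRegisters_heq B R)
      (CoinGame.withGame_terminates (by omega) hterm hR)
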